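/- **Setting.** A rank-$K$ maxout unit with $n$ inputs computes $x\mapsto\max_{j\in[K]}\{w_j\cdot x+b_j\}$ with parameters $w_j\in\mathbb{R}^n$, $b_j\in\mathbb{R}$, $j\in[K]:=\{1,\dots,K\}$. A network with $n_0\ge 1$ inputs and $L$ layers of $n_1,\dots,n_L$ rank-$K$ maxout units computes $f=\psi\circ\phi_L\circ\cdots\circ\phi_1$, where $\phi_l\colon\mathbb{R}^{n_{l-1}}\to\mathbb{R}^{n_l}$ is a layer of $n_l$ such units and $\psi\colon\mathbb{R}^{n_L}\to\mathbb{R}^m$ is a linear output layer (with weights and biases) with $m\ge 1$ outputs; its parameters are all the weights and biases of all the layers, including $\psi$. A linear region of a piecewise linear function $f$ over a set $D\subseteq\mathbb{R}^{n_0}$ is a maximal connected subset of $D$ on which $f$ is differentiable with constant gradient (constant Jacobian matrix, if $f$ is vector valued); if no $D$ is mentioned, $D=\mathbb{R}^{n_0}$. Measure means Lebesgue measure on the parameter space. **Theorem (Numbers of linear regions).** Let $n_0\ge 1$. 1. *Single unit.* Consider a rank-$K$ maxout unit with $n_0$ inputs. For each $1\le k\le K$ there are parameters for which the number of linear regions is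 exactly $k$. If $\min\{K,n_0+1\}\le k\le K$, the set of these parameters has positive measure, and if $1\le k<\min\{K,n_0+1\}$ it is a null set. The same holds for the network with this unit as its only maxout unit ($L=1$, $n_1=1$) followed by a linear output layer. 2. *Single layer.* Consider a layer of $n_1$ rank-$K$ maxout units with $n_0$ inputs. For each choice of $1\le k_1,\dots,k_{n_1}\le K$ there are parameters for which the number of linear regions is exactly $$\sum_{j=0}^{n_0}\ \sum_{S\subseteq[n_1],\,|S|=j}\ \prod_{i\in S}(k_i-1).$$ If $\min\{K,n_0+1\}\le k_i\le K$ for all $i$, the set of these parameters has positive measure. The same holds for the network with this layer as its only maxout layer ($L=1$) followed by a linear output layer. 3. *Deep network.* Consider a network with $n_0$ inputs, $L$ layers of $n_1,\dots,n_L\ge 1$ rank-$K$ maxout units, $K\ge 2$, where each $n_l/n_0$ is an even integer, and a linear output layer. For each choice of $1\le k_{li}\le K$, $l=1,\dots,L$, $i=1,\dots,n_0$, there are parameters for which the number of linear regions is exactly $$\prod_{l=1}^{L}\prod_{i=1}^{n_0}\Bigl(\frac{n_l}{n_0}(k_{li}-1)+1\Bigr).$$ Moreover, there is a positive measure subset of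 the parameters for which the latter is the number of linear regions over $(0,1)^{n_0}$. -/

import Mathlib

open MeasureTheory

noncomputable section

/-! ### Linear regions -/

/-- `R` is a linear region of `f` over the domain `D`: a maximal connected subset of `D` on which
`f` has a constant gradient. That `f` has gradient `g` at `x` means that `f` is differentiable at
`x` with derivative `g`; connected sets are nonempty by definition. The linear regions of `f` on
the whole input space are obtained for `D = Set.univ`. -/
def IsLinearRegionOn {E F : Type*} [NormedAddCommGroup E] [NormedSpace ℝ E]
    [NormedAddCommGroup F] [NormedSpace ℝ F] (f : E → F) (D R : Set E) : Prop :=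
  Maximal (fun S : Set E =>
    S ⊆ D ∧ IsConnected S ∧ ∃ g : E →L[ℝ] F, ∀ x ∈ S, HasFDerivAt f g x) R

/-- The number (possibly `∞`) of linear regions of `f` over the domain `D`. -/
def numLinearRegionsOn {E F : Type*} [NormedAddCommGroup E] [NormedSpace ℝ E]
    [NormedAddCommGroup F] [NormedSpace ℝ F] (f : E → F) (D : Set E) : ℕ∞ :=
  Set.encard {R : Set E | IsLinearRegionOn f D R}

/-- The set of parameters `θ` for which the function `F θ` has exactly `N` linear regions over
the domain `D`. -/
def regionCountSet {Θ E G : Type*} [NormedAddCommGroup E] [NormedSpace ℝ E]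
    [NormedAddCommGroup G] [NormedSpace ℝ G] (F : Θ → E → G) (D : Set E) (N : ℕ) : Set Θ :=
  {θ | numLinearRegionsOn (F θ) D = (N : ℕ∞)}

/-- `s` contains a measurable set of positive (Lebesgue) measure. For a measurable set `s` this
says that `s` has positive measure. -/
def HasPositiveMeasure {Θ : Type*} [MeasureSpace Θ] (s : Set Θ) : Prop :=
  ∃ t ⊆ s, MeasurableSet t ∧ 0 < volume t

/-- The open unit cube `(0,1)^n`. -/
def openUnitCube (n : ℕ) : Set (Fin n → ℝ) :=
  Set.univ.pi fun _ => Set.Ioo (0 : ℝ) 1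

/-! ### Maxout networks

The parameter spaces are finite products of copies of `ℝ` and carry Lebesgue measure. -/

/-- Parameters of a rank-`K` maxout unit with `a` inputs: for each of the `K` pre-activation
features, a weight vector and a bias. -/
abbrev UnitParams (a K : ℕ) : Type := Fin K → (Fin a → ℝ) × ℝ

/-- Parameters of a layer of `b` rank-`K` maxout units with `a` inputs. -/
abbrev LayerParams (a b K : ℕ) : Type := Fin b → UnitParams a K

/-- Parameters of a linear output layer with `a` inputs and `m` outputs: weights and biases. -/
abbrev OutputParams (a m : ℕ) : Type := Fin m → (Fin a → ℝ) × ℝ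

/-- Parameters of `L` layers of rank-`K` maxout units, where the `l`-th layer has `n l` inputs
and `n (l + 1)` units, `l = 0, …, L - 1`. -/
abbrev HiddenParams (n : ℕ → ℕ) (K L : ℕ) : Type :=
  ∀ l : Fin L, LayerParams (n l) (n (l + 1)) K

/-- The function `x ↦ max_j (w_j ⬝ x + b_j)` of a rank-`K` maxout unit (`K ≥ 1`). -/
def maxoutUnit {a K : ℕ} (θ : UnitParams a K) (x : Fin a → ℝ) : ℝ :=
  ⨆ j : Fin K, ((∑ i, (θ j).1 i * x i) + (θ j).2)

/-- The function of a layer of maxout units. -/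
def maxoutLayer {a b K : ℕ} (θ : LayerParams a b K) (x : Fin a → ℝ) : Fin b → ℝ :=
  fun i => maxoutUnit (θ i) x

/-- The function of the linear output layer. -/
def outputLayer {a m : ℕ} (ψ : OutputParams a m) (x : Fin a → ℝ) : Fin m → ℝ :=
  fun o => (∑ i, (ψ o).1 i * x i) + (ψ o).2

/-- The composition of `L` layers of maxout units. -/
def hiddenMap (n : ℕ → ℕ) (K : ℕ) :
    (L : ℕ) → HiddenParams n K L → (Fin (n 0) → ℝ) → (Fin (n L) → ℝ)
  | 0, _, x => x
  | L + 1, θ, x =>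
      maxoutLayer (θ (Fin.last L)) (hiddenMap n K L (fun l => θ l.castSucc) x)

/-- The function of the network with a single layer of `b` rank-`K` maxout units, followed by a
linear output layer with `m` outputs; a parameter of it collects those of both layers. -/
def shallowNetwork {a b K m : ℕ} (θ : LayerParams a b K × OutputParams b m)
    (x : Fin a → ℝ) : Fin m → ℝ :=
  outputLayer θ.2 (maxoutLayer θ.1 x)

/-- The function of the network with `L` layers of rank-`K` maxout units of widths
`n 1, …, n L`, with `n 0` inputs, followed by a linear output layer with `m` outputs. -/
def deepNetwork {n : ℕ → ℕ} {K L m : ℕ} (θ : HiddenParams n K L × OutputParams (n L) m)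
    (x : Fin (n 0) → ℝ) : Fin m → ℝ :=
  outputLayer θ.2 (hiddenMap n K L θ.1 x)

/-- The number `∑_{j = 0}^{d} ∑_{S ⊆ [b], |S| = j} ∏_{i ∈ S} (k_i - 1)`, for `k_i ≥ 1`. -/
def shallowCount {b : ℕ} (d : ℕ) (k : Fin b → ℕ) : ℕ :=
  ∑ j ∈ Finset.range (d + 1),
    ∑ S ∈ Finset.powersetCard j (Finset.univ : Finset (Fin b)), ∏ i ∈ S, (k i - 1)

end

/-!
The inputs of a maxout network are sorted by their activation patterns, that is, by the choice of
a maximizing feature at each unit. Where the maximizers are unique, the network is differentiable,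
with a gradient that depends on the pattern only. If every pattern that is weakly active (attains
the maxima somewhere, with ties allowed) is also strictly active somewhere, and adjacent patterns
have different gradients, then the network has no gradient at a tie: on the segments from a tie to
two adjacent open cells it is affine, with incompatible gradients. The linear regions are then
exactly the cells of the strictly active patterns, and counting regions means counting patterns
(`numLinearRegionsOn_eq_ncard_cells`, `HasGenericPatterns.numLinearRegionsOn`,
`numLinearRegionsOn_deepNetwork`).

*One layer.* If the features of unit `i` are tangent to a convex function of one linear form, then
its breaks are `k i - 1` parallel hyperplanes. With normal vectors on the moment curve and suitable
offsets the hyperplanes are in general position. By deletion and restriction, the number of cells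
is the number of sets of hyperplanes with a common point (`card_signPatterns_eq_card_flats`), which
are the sets of at most `d` hyperplanes from different units; these are counted by `shallowCount`.
The remaining `K - k i` features are one less than the average of the given ones, so they are never
active. The set of patterns is stable under perturbations if no further pattern is weakly active at
infinity, by compactness of the half-sphere of homogenized inputs (`HasStablePatterns.eventually`).
The average of features is active at infinity only in directions along which all of them have the
same slope. There are no such directions once the weights affinely span the input space, which can
be arranged if `d + 1 ≤ k i`. A neighbourhood of parameters has positive measure.

*One unit, few regions.* Outside of a null set, no weight vector of a unit is a convex combination
of at most `n₀` others (`volume_setOf_not_hasGenericWeights`). Suppose that the set `J` of features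
that are strictly maximal somewhere has at most `n₀` elements and misses a feature. Separating the
weight vector of that feature from the hull of those in `J` yields a generic direction in which
some feature outside of `J` grows fastest, so that it is strictly maximal far out, a contradiction.
Hence there are at least `min K (n₀ + 1)` different gradients
(`HasGenericWeights.min_le_numLinearRegionsOn`).

*Deep networks.* For each input coordinate, `q = n (l + 1) / n 0` units of layer `l` with
interleaved thresholds have an alternating sum that is a zigzag function with
`q * (k - 1) + 1` affine pieces, each mapped onto the unit interval. Since `q` is even, the
thresholds of one unit have the same parity in the common order, so that the breaks of the
alternating sum alternate in sign. Every box of pieces is mapped onto the unit cube, so that under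
composition the numbers of pieces multiply and every weakly active pattern is strictly active
inside the cube
(`exists_zigzagNetwork`). Over the cube, the patterns and the differences of adjacent gradients are
stable under perturbations by compactness (`eventually_numLinearRegionsOn_deepNetwork`).
-/

/-! ### Counting linear regions by polyhedral cells -/

section Count

variable {E F : Type*} [NormedAddCommGroup E] [NormedSpace ℝ E]
  [NormedAddCommGroup F] [NormedSpace ℝ F]

/-- A continuous linear map is determined by its values on differences `y - x`, for `y` in a
nonempty open set. -/
theorem ContinuousLinearMap.eq_of_eqOn_sub_isOpen {g g' : E →L[ℝ] F} {C : Set E} (hC : IsOpen C)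
    (hne : C.Nonempty) (x : E) (h : ∀ y ∈ C, g (y - x) = g' (y - x)) : g = g' := by
  obtain ⟨y₀, hy₀⟩ := hne
  ext v
  have hcont : Filter.Tendsto (fun s : ℝ => y₀ + s • v) (nhds 0) (nhds y₀) := by
    have : Continuous fun s : ℝ => y₀ + s • v := by fun_prop
    simpa using this.tendsto 0
  have hev : ∀ᶠ s : ℝ in nhds 0, y₀ + s • v ∈ C := hcont (hC.mem_nhds hy₀)
  have hev' : ∀ᶠ s : ℝ in nhdsWithin 0 {0}ᶜ, y₀ + s • v ∈ C := hev.filter_mono nhdsWithin_le_nhds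
  obtain ⟨s, hs, hs0⟩ := (hev'.and self_mem_nhdsWithin).exists
  have h1 := h _ hs
  have h0 := h _ hy₀
  have e : y₀ + s • v - x = (y₀ - x) + s • v := by abel
  rw [e, map_add, map_add, h0, map_smul, map_smul] at h1
  exact smul_right_injective F (by simpa using hs0) (add_left_cancel h1)

/-- If `f` is affine on the segments from `x` to the points of an open cell on which `f` has
gradient `g`, then `g` is the only possible gradient of `f` at `x`. -/
theorem HasFDerivAt.eq_of_affine_on_segments {f : E → F} {x : E} {g g' : E →L[ℝ] F} {C : Set E}
    (hC : IsOpen C) (hne : C.Nonempty) (hg : ∀ y ∈ C, HasFDerivAt f g y)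
    (hseg : ∀ y ∈ C, ∀ s : ℝ, 0 < s → s ≤ 1 → AffineMap.lineMap x y s ∈ C ∧
      f (AffineMap.lineMap x y s) = AffineMap.lineMap (f x) (f y) s)
    (hx : HasFDerivAt f g' x) : g' = g := by
  refine ContinuousLinearMap.eq_of_eqOn_sub_isOpen hC hne x fun y hy => ?_
  have hline : ∀ s : ℝ, HasDerivAt (fun s : ℝ => (AffineMap.lineMap x y s : E)) (y - x) s :=
    fun s => AffineMap.hasDerivAt_lineMap
  have hlineF : ∀ s : ℝ, HasDerivAt (fun s : ℝ => (AffineMap.lineMap (f x) (f y) s : F))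
      (f y - f x) s := fun s => AffineMap.hasDerivAt_lineMap
  have key : ∀ s : ℝ, 0 ≤ s → s < 1 → ∀ a : E →L[ℝ] F,
      HasFDerivAt f a (AffineMap.lineMap x y s) → a (y - x) = f y - f x := by
    intro s hs0 hs1 a ha
    have h1 : HasDerivAt (fun s : ℝ => f (AffineMap.lineMap x y s)) (a (y - x)) s :=
      ha.comp_hasDerivAt s (hline s)
    have hI : UniqueDiffWithinAt ℝ (Set.Icc s 1) s :=
      uniqueDiffOn_Icc hs1 s ⟨le_rfl, hs1.le⟩
    refine hI.eq_deriv _ h1.hasDerivWithinAt ((hlineF s).hasDerivWithinAt.congr ?_ ?_)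
    · intro r hr
      rcases eq_or_lt_of_le (hs0.trans hr.1) with h | h
      · simp [← h]
      · exact (hseg y hy r h hr.2).2
    · rcases eq_or_lt_of_le hs0 with h | h
      · simp [← h]
      · exact (hseg y hy s h hs1.le).2
  have hz := hseg y hy (1 / 2) (by norm_num) (by norm_num)
  rw [key 0 le_rfl one_pos g' (by simpa using hx),
    key (1 / 2) (by norm_num) (by norm_num) g (hg _ hz.1)]

/-- The linear regions of `f` over a convex set `D` are the nonempty sets `D ∩ C J`, for
finitely many disjoint open cells `C J` with constant gradients `g J`, provided that every point
of `D` outside the cells is a corner: it lies in the closed cells `W J`, `W J'` of two nonempty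
open cells with different gradients. -/
theorem numLinearRegionsOn_eq_ncard_cells {f : E → F} {D : Set E} (hDc : Convex ℝ D)
    {ι : Type*} [Finite ι] {W C : ι → Set E} {g : ι → E →L[ℝ] F}
    (hCopen : ∀ J, IsOpen (C J)) (hCW : ∀ J, C J ⊆ W J)
    (hdisj : Pairwise (Function.onFun Disjoint C))
    (hder : ∀ J, ∀ x ∈ C J, HasFDerivAt f (g J) x)
    (hseg : ∀ J, ∀ x ∈ W J, ∀ y ∈ C J, ∀ s : ℝ, 0 < s → s ≤ 1 →
      AffineMap.lineMap x y s ∈ C J ∧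
        f (AffineMap.lineMap x y s) = AffineMap.lineMap (f x) (f y) s)
    (htie : ∀ x ∈ D, (∃ J, x ∈ C J) ∨ ∃ J J', x ∈ W J ∧ x ∈ W J' ∧
      (C J).Nonempty ∧ (C J').Nonempty ∧ g J ≠ g J') :
    numLinearRegionsOn f D = ({J | (D ∩ C J).Nonempty}.ncard : ℕ∞) := by
  have hdiff : ∀ x ∈ D, ∀ a : E →L[ℝ] F, HasFDerivAt f a x → ∃ J, x ∈ C J := by
    intro x hx a ha
    rcases htie x hx with h | ⟨J, J', hJ, hJ', hne, hne', hgg⟩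
    · exact h
    · refine absurd ?_ hgg
      rw [← ha.eq_of_affine_on_segments (hCopen J) hne (hder J) (hseg J x hJ),
        ← ha.eq_of_affine_on_segments (hCopen J') hne' (hder J') (hseg J' x hJ')]
  -- a connected set of points with one gradient that meets a cell stays in it
  have hsub : ∀ S : Set E, S ⊆ D → IsPreconnected S → ∀ a : E →L[ℝ] F,
      (∀ x ∈ S, HasFDerivAt f a x) → ∀ J, (S ∩ C J).Nonempty → S ⊆ D ∩ C J := by
    intro S hSD hS a ha J hJ
    refine Set.subset_inter hSD ?_
    refine hS.subset_left_of_subset_union (v := ⋃ J' ∈ {J' | J' ≠ J}, C J') (hCopen J)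
      (isOpen_biUnion fun J' _ => hCopen J') ?_ ?_ hJ
    · rw [Set.disjoint_iUnion₂_right]
      exact fun J' hJ' => hdisj (Ne.symm hJ')
    · intro x hx
      obtain ⟨J', hJ'⟩ := hdiff x (hSD hx) a (ha x hx)
      by_cases h : J' = J
      · exact Or.inl (h ▸ hJ')
      · exact Or.inr (Set.mem_biUnion (show J' ∈ {J' | J' ≠ J} from h) hJ')
  have hconv : ∀ J, Convex ℝ (C J) := by
    intro J
    refine convex_iff_segment_subset.2 fun x hx y hy z hz => ?_
    rw [segment_eq_image_lineMap] at hz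
    obtain ⟨s, hs, rfl⟩ := hz
    rcases eq_or_lt_of_le hs.1 with h | h
    · simpa [← h] using hx
    · exact (hseg J x (hCW J hx) y hy s h hs.2).1
  have hset : {R : Set E | IsLinearRegionOn f D R} =
      (fun J => D ∩ C J) '' {J | (D ∩ C J).Nonempty} := by
    ext R
    constructor
    · rintro ⟨⟨hRD, hRc, a, ha⟩, hmax⟩
      obtain ⟨x, hx⟩ := hRc.nonempty
      obtain ⟨J, hJ⟩ := hdiff x (hRD hx) a (ha x hx)
      have h1 := hsub R hRD hRc.isPreconnected a ha J ⟨x, hx, hJ⟩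
      refine ⟨J, ⟨x, hRD hx, hJ⟩, ?_⟩
      refine Set.Subset.antisymm (hmax (y := D ∩ C J) ⟨Set.inter_subset_left, ?_, g J, ?_⟩ h1) h1
      · exact ⟨⟨x, hRD hx, hJ⟩, (hDc.inter (hconv J)).isPreconnected⟩
      · exact fun y hy => hder J y hy.2
    · rintro ⟨J, hJ, rfl⟩
      refine ⟨⟨Set.inter_subset_left, ⟨hJ, (hDc.inter (hconv J)).isPreconnected⟩, g J,
        fun y hy => hder J y hy.2⟩, ?_⟩
      rintro S ⟨hSD, hS, a, ha⟩ hle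
      obtain ⟨x, hx⟩ := hJ
      exact hsub S hSD hS.isPreconnected a ha J ⟨x, hle hx, hx.2⟩
  have hinj : Set.InjOn (fun J => D ∩ C J) {J | (D ∩ C J).Nonempty} := by
    rintro J ⟨x, hx⟩ J' - h
    by_contra hne
    have hx' : x ∈ D ∩ C J' := by
      have : D ∩ C J = D ∩ C J' := h
      exact this ▸ hx
    exact Set.disjoint_left.1 (hdisj hne) hx.2 hx'.2
  rw [numLinearRegionsOn, hset, hinj.encard_image, (Set.toFinite _).cast_ncard_eq]

/-- Points at which `f` has pairwise different gradients lie in different linear regions. -/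
theorem card_le_numLinearRegionsOn_univ {f : E → F} {ι : Type*} (s : Finset ι) (x : ι → E)
    (g : ι → E →L[ℝ] F) (hg : Set.InjOn g s) (hder : ∀ j ∈ s, HasFDerivAt f (g j) (x j)) :
    (s.card : ℕ∞) ≤ numLinearRegionsOn f Set.univ := by
  set V : ι → Set E := fun j => {y | HasFDerivAt f (g j) y}
  have hreg : ∀ j ∈ s, IsLinearRegionOn f Set.univ (connectedComponentIn (V j) (x j)) := by
    intro j hj
    have hxj : x j ∈ V j := hder j hj
    refine ⟨⟨Set.subset_univ _, isConnected_connectedComponentIn_iff.2 hxj, g j,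
      fun y hy => connectedComponentIn_subset (V j) _ hy⟩, ?_⟩
    rintro S ⟨-, hS, a, ha⟩ hle
    have hx : x j ∈ S := hle (mem_connectedComponentIn hxj)
    have hag : a = g j := (ha _ hx).unique hxj
    exact hS.isPreconnected.subset_connectedComponentIn hx fun y hy =>
      show HasFDerivAt f (g j) y from hag ▸ ha y hy
  have hinj : Set.InjOn (fun j => connectedComponentIn (V j) (x j)) (s : Set ι) := by
    intro j hj j' hj' h
    refine hg hj hj' ?_
    have h1 : x j ∈ connectedComponentIn (V j') (x j') := by
      have : connectedComponentIn (V j) (x j) = connectedComponentIn (V j') (x j') := h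
      exact this ▸ mem_connectedComponentIn (hder j hj)
    exact (hder j hj).unique (connectedComponentIn_subset (V j') _ h1)
  rw [← Set.encard_coe_eq_coe_finsetCard, ← hinj.encard_image]
  exact Set.encard_le_encard (Set.image_subset_iff.2 hreg)

end Count

/-! ### Activation patterns of a layer -/

section Patterns

variable {a b K : ℕ}

/-- The value at `x` of the affine function with weights and bias `p`. -/
def featureValue (p : (Fin a → ℝ) × ℝ) (x : Fin a → ℝ) : ℝ := (∑ i, p.1 i * x i) + p.2

/-- The linear functional with coefficients `w`. -/
noncomputable def featureGrad (w : Fin a → ℝ) : (Fin a → ℝ) →L[ℝ] ℝ :=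
  ∑ i, w i • ContinuousLinearMap.proj i

theorem featureGrad_apply (w x : Fin a → ℝ) : featureGrad w x = ∑ i, w i * x i := by
  simp [featureGrad]

theorem featureValue_eq (p : (Fin a → ℝ) × ℝ) (x : Fin a → ℝ) :
    featureValue p x = featureGrad p.1 x + p.2 := by
  rw [featureGrad_apply, featureValue]

theorem featureGrad_injective : Function.Injective (featureGrad (a := a)) := by
  intro w w' h
  ext i
  have := congrArg (fun g : (Fin a → ℝ) →L[ℝ] ℝ => g (Pi.single i 1)) h
  simpa [featureGrad_apply, Pi.single_apply] using this

theorem hasFDerivAt_featureValue (p : (Fin a → ℝ) × ℝ) (x : Fin a → ℝ) :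
    HasFDerivAt (featureValue p) (featureGrad p.1) x := by
  have h := (featureGrad p.1).hasFDerivAt (x := x)
  have h2 := h.add_const p.2
  refine h2.congr_of_eventuallyEq (Filter.Eventually.of_forall fun y => ?_)
  exact featureValue_eq p y

theorem featureValue_lineMap (p : (Fin a → ℝ) × ℝ) (x y : Fin a → ℝ) (s : ℝ) :
    featureValue p (AffineMap.lineMap x y s) =
      (1 - s) * featureValue p x + s * featureValue p y := by
  rw [AffineMap.lineMap_apply_module, featureValue_eq, featureValue_eq, featureValue_eq, map_add,
    map_smul, map_smul, smul_eq_mul, smul_eq_mul]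
  ring

@[fun_prop]
theorem continuous_featureValue : Continuous fun q : ((Fin a → ℝ) × ℝ) × (Fin a → ℝ) =>
    featureValue q.1 q.2 := by
  unfold featureValue
  fun_prop

/-- The choice `J` of one feature per unit attains the maximum at every unit for the input `x`. -/
def IsWeaklyActive {κ : Fin b → Type} (θ : ∀ i, κ i → (Fin a → ℝ) × ℝ) (J : ∀ i, κ i)
    (x : Fin a → ℝ) : Prop :=
  ∀ i j, featureValue (θ i j) x ≤ featureValue (θ i (J i)) x

/-- The choice `J` of one feature per unit is the only one that attains the maximum at every unit
for the input `x`. -/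
def IsStrictlyActive {κ : Fin b → Type} (θ : ∀ i, κ i → (Fin a → ℝ) × ℝ) (J : ∀ i, κ i)
    (x : Fin a → ℝ) : Prop :=
  ∀ i j, j ≠ J i → featureValue (θ i j) x < featureValue (θ i (J i)) x

/-- The layer with parameters `θ` has exactly `N` strictly active patterns, and they are its only
weakly active patterns. The units may have different index types `κ i` of features. -/
def HasGenericPatterns {κ : Fin b → Type} (θ : ∀ i, κ i → (Fin a → ℝ) × ℝ) (N : ℕ) : Prop :=
  (∀ J x, IsWeaklyActive θ J x → ∃ y, IsStrictlyActive θ J y) ∧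
    {J | ∃ y, IsStrictlyActive θ J y}.ncard = N

section Dependent

variable {κ : Fin b → Type} {θ : ∀ i, κ i → (Fin a → ℝ) × ℝ} {J J' : ∀ i, κ i} {x y : Fin a → ℝ}

theorem IsStrictlyActive.isWeaklyActive (h : IsStrictlyActive θ J x) : IsWeaklyActive θ J x := by
  intro i j
  by_cases hj : j = J i
  · rw [hj]
  · exact (h i j hj).le

theorem IsStrictlyActive.eq_of_isWeaklyActive (h : IsStrictlyActive θ J x)
    (h' : IsWeaklyActive θ J' x) : J' = J := by
  funext i
  by_contra hne
  exact absurd (h' i (J i)) (not_le.2 (h i _ hne))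

theorem IsWeaklyActive.update [∀ i, DecidableEq (κ i)] (h : IsWeaklyActive θ J x) {i : Fin b}
    {j : κ i} (hj : featureValue (θ i (J i)) x ≤ featureValue (θ i j) x) :
    IsWeaklyActive θ (Function.update J i j) x := by
  intro i' j'
  by_cases hi : i' = i
  · subst hi
    simpa using (h i' j').trans hj
  · simpa [Function.update_of_ne hi] using h i' j'

theorem exists_isWeaklyActive [∀ i, Finite (κ i)] [∀ i, Nonempty (κ i)]
    (θ : ∀ i, κ i → (Fin a → ℝ) × ℝ) (x : Fin a → ℝ) : ∃ J, IsWeaklyActive θ J x := by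
  have h : ∀ i, ∃ j₀ : κ i, ∀ j, featureValue (θ i j) x ≤ featureValue (θ i j₀) x :=
    fun i => Finite.exists_max _
  choose J hJ using h
  exact ⟨J, hJ⟩

theorem IsWeaklyActive.isStrictlyActive_lineMap (hx : IsWeaklyActive θ J x)
    (hy : IsStrictlyActive θ J y) {s : ℝ} (hs0 : 0 < s) (hs1 : s ≤ 1) :
    IsStrictlyActive θ J (AffineMap.lineMap x y s) := by
  intro i j hj
  rw [featureValue_lineMap, featureValue_lineMap]
  have h1 := mul_le_mul_of_nonneg_left (hx i j) (sub_nonneg.2 hs1)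
  have h2 := mul_lt_mul_of_pos_left (hy i j hj) hs0
  linarith

theorem isOpen_setOf_isStrictlyActive [∀ i, Finite (κ i)] (θ : ∀ i, κ i → (Fin a → ℝ) × ℝ)
    (J : ∀ i, κ i) : IsOpen {x | IsStrictlyActive θ J x} := by
  simp only [IsStrictlyActive, Set.ofPred_forall]
  refine isOpen_iInter_of_finite fun i => isOpen_iInter_of_finite fun j =>
    isOpen_iInter_of_finite fun _ => isOpen_lt ?_ ?_
  · exact continuous_featureValue.comp (by fun_prop : Continuous fun x => (θ i j, x))
  · exact continuous_featureValue.comp (by fun_prop : Continuous fun x => (θ i (J i), x))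

end Dependent

theorem maxoutUnit_eq_featureValue {θ : UnitParams a K} {j : Fin K} {x : Fin a → ℝ}
    (h : ∀ j', featureValue (θ j') x ≤ featureValue (θ j) x) :
    maxoutUnit θ x = featureValue (θ j) x := by
  have : Nonempty (Fin K) := ⟨j⟩
  exact le_antisymm (ciSup_le h) (le_ciSup (f := fun j => featureValue (θ j) x)
    (Set.finite_range _).bddAbove j)

/-- The gradient of a layer on the cell of the pattern `J`. -/
noncomputable def layerGrad (θ : LayerParams a b K) (J : Fin b → Fin K) :
    (Fin a → ℝ) →L[ℝ] (Fin b → ℝ) :=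
  ContinuousLinearMap.pi fun i => featureGrad (θ i (J i)).1

theorem hasFDerivAt_maxoutUnit {θ : UnitParams a K} {j : Fin K} {x : Fin a → ℝ}
    (h : ∀ j', j' ≠ j → featureValue (θ j') x < featureValue (θ j) x) :
    HasFDerivAt (maxoutUnit θ) (featureGrad (θ j).1) x := by
  have hopen := isOpen_setOf_isStrictlyActive (b := 1) (κ := fun _ => Fin K) (fun _ => θ)
    (fun _ => j)
  have hx : x ∈ {x | IsStrictlyActive (b := 1) (κ := fun _ => Fin K) (fun _ => θ) (fun _ => j) x} :=
    fun _ j' hj' => h j' hj'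
  refine (hasFDerivAt_featureValue (θ j) x).congr_of_eventuallyEq ?_
  filter_upwards [hopen.mem_nhds hx] with y hy
  exact maxoutUnit_eq_featureValue (IsStrictlyActive.isWeaklyActive hy 0)

section Layer

variable {θ : LayerParams a b K} {J : Fin b → Fin K} {x y : Fin a → ℝ}

theorem IsWeaklyActive.maxoutLayer_eq (h : IsWeaklyActive θ J x) :
    maxoutLayer θ x = fun i => featureValue (θ i (J i)) x :=
  funext fun i => maxoutUnit_eq_featureValue (h i)

theorem IsStrictlyActive.hasFDerivAt_maxoutLayer (h : IsStrictlyActive θ J x) :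
    HasFDerivAt (maxoutLayer θ) (layerGrad θ J) x :=
  hasFDerivAt_pi.2 fun i => hasFDerivAt_maxoutUnit (h i)

theorem IsWeaklyActive.maxoutLayer_lineMap (hx : IsWeaklyActive θ J x)
    (hy : IsStrictlyActive θ J y) {s : ℝ} (hs0 : 0 < s) (hs1 : s ≤ 1) :
    maxoutLayer θ (AffineMap.lineMap x y s) =
      AffineMap.lineMap (maxoutLayer θ x) (maxoutLayer θ y) s := by
  rw [(hx.isStrictlyActive_lineMap hy hs0 hs1).isWeaklyActive.maxoutLayer_eq, hx.maxoutLayer_eq,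
    hy.isWeaklyActive.maxoutLayer_eq]
  funext i
  rw [featureValue_lineMap, AffineMap.lineMap_apply_module]
  simp

/-- The number of linear regions of a layer with generic patterns, followed by an affine map whose
linear part does not annihilate any unit, is the number of strictly active patterns. -/
theorem HasGenericPatterns.numLinearRegionsOn {N : ℕ} (h : HasGenericPatterns θ N)
    (hne : Nonempty (Fin b → Fin K)) {F : Type*} [NormedAddCommGroup F] [NormedSpace ℝ F]
    (Λ : (Fin b → ℝ) →L[ℝ] F) (c : F) (hΛ : ∀ i, Λ (Pi.single i 1) ≠ 0) :
    numLinearRegionsOn (fun x => Λ (maxoutLayer θ x) + c) Set.univ = N := by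
  classical
  have hK : ∀ i : Fin b, Nonempty (Fin K) := fun i => ⟨hne.some i⟩
  rw [numLinearRegionsOn_eq_ncard_cells convex_univ (W := fun J => {x | IsWeaklyActive θ J x})
    (C := fun J => {x | IsStrictlyActive θ J x}) (g := fun J => Λ ∘L layerGrad θ J)]
  · rw [← h.2]
    simp only [Set.univ_inter]
    rfl
  · exact isOpen_setOf_isStrictlyActive θ
  · exact fun J x hx => IsStrictlyActive.isWeaklyActive hx
  · intro J J' hJ
    refine Set.disjoint_left.2 fun x hx hx' => hJ ?_
    exact IsStrictlyActive.eq_of_isWeaklyActive hx' (IsStrictlyActive.isWeaklyActive hx)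
  · intro J x hx
    exact (Λ.hasFDerivAt.comp x (IsStrictlyActive.hasFDerivAt_maxoutLayer hx)).add_const c
  · intro J x hx y hy s hs0 hs1
    refine ⟨IsWeaklyActive.isStrictlyActive_lineMap hx hy hs0 hs1, ?_⟩
    change Λ (maxoutLayer θ (AffineMap.lineMap x y s)) + c =
      AffineMap.lineMap (Λ (maxoutLayer θ x) + c) (Λ (maxoutLayer θ y) + c) s
    rw [IsWeaklyActive.maxoutLayer_lineMap hx hy hs0 hs1, AffineMap.lineMap_apply_module,
      AffineMap.lineMap_apply_module, map_add, map_smul, map_smul]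
    module
  · intro x _
    obtain ⟨J, hJ⟩ := exists_isWeaklyActive θ x
    by_cases hs : IsStrictlyActive θ J x
    · exact Or.inl ⟨J, hs⟩
    simp only [IsStrictlyActive, not_forall, not_lt] at hs
    obtain ⟨i, j, hj, hle⟩ := hs
    have hJ' := hJ.update hle
    obtain ⟨y, hy⟩ := h.1 _ _ hJ
    refine Or.inr ⟨J, _, hJ, hJ', ⟨y, hy⟩, h.1 _ _ hJ', fun heq => ?_⟩
    -- the two features agree at `x`, so that equal weights would make them equal functions
    have hval : featureValue (θ i j) x = featureValue (θ i (J i)) x := le_antisymm (hJ i j) hle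
    have hw : featureGrad (θ i j).1 = featureGrad (θ i (J i)).1 := by
      by_contra hw
      obtain ⟨v, hv⟩ : ∃ v, featureGrad (θ i j).1 v ≠ featureGrad (θ i (J i)).1 v := by
        by_contra hcon
        push Not at hcon
        exact hw (ContinuousLinearMap.ext hcon)
      have h1 : Λ (layerGrad θ J v - layerGrad θ (Function.update J i j) v) = 0 := by
        rw [map_sub, sub_eq_zero]
        exact congrArg (fun g => g v) heq
      have h2 : layerGrad θ J v - layerGrad θ (Function.update J i j) v =
          (featureGrad (θ i (J i)).1 v - featureGrad (θ i j).1 v) • Pi.single i (1 : ℝ) := by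
        funext i'
        by_cases hi : i' = i
        · subst hi
          simp [layerGrad]
        · simp [layerGrad, Function.update_of_ne hi, Pi.single_eq_of_ne hi]
      rw [h2, map_smul, smul_eq_zero] at h1
      rcases h1 with h1 | h1
      · exact hv (sub_eq_zero.1 h1).symm
      · exact hΛ i h1
    have h3 := hy i j hj
    rw [featureValue_eq, featureValue_eq, hw] at hval h3
    linarith

end Layer

end Patterns

/-! ### Units whose features are tangent to a convex function of one variable -/

section Profile

/-- The affine function of one variable with slope `j + α` whose value exceeds that of
`y ↦ α * y` by `∑ l < j, (y - β l)`. For strictly increasing thresholds `β`, the maximum of the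
first `k` of these functions has its breaks at `β 0, …, β (k - 2)`. -/
noncomputable def profile (α : ℝ) (β : ℕ → ℝ) (j : ℕ) (y : ℝ) : ℝ :=
  α * y + ∑ l ∈ Finset.range j, (y - β l)

theorem profile_eq (α : ℝ) (β : ℕ → ℝ) (j : ℕ) (y : ℝ) :
    profile α β j y = (j + α) * y - ∑ l ∈ Finset.range j, β l := by
  simp [profile, Finset.sum_sub_distrib]
  ring

theorem profile_succ (α : ℝ) (β : ℕ → ℝ) (j : ℕ) (y : ℝ) :
    profile α β (j + 1) y = profile α β j y + (y - β j) := by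
  rw [profile, profile, Finset.sum_range_succ, add_assoc]

theorem profile_add_sum_Ico (α : ℝ) (β : ℕ → ℝ) {j j' : ℕ} (h : j ≤ j') (y : ℝ) :
    profile α β j' y = profile α β j y + ∑ l ∈ Finset.Ico j j', (y - β l) := by
  rw [profile, profile, add_assoc, Finset.sum_range_add_sum_Ico _ h]

/-- The slot of `y` with respect to the first `k - 1` thresholds is `j`, weak form: `y` is at
least the thresholds below `j` and at most the others. -/
def IsWeakSlot (β : ℕ → ℝ) (k j : ℕ) (y : ℝ) : Prop :=
  ∀ l, l + 1 < k → (l < j → β l ≤ y) ∧ (j ≤ l → y ≤ β l)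

/-- The slot of `y` with respect to the first `k - 1` thresholds is `j`, and `y` is not a
threshold. -/
def IsStrictSlot (β : ℕ → ℝ) (k j : ℕ) (y : ℝ) : Prop :=
  ∀ l, l + 1 < k → (l < j → β l < y) ∧ (j ≤ l → y < β l)

theorem IsWeakSlot.profile_le {α : ℝ} {β : ℕ → ℝ} {k j : ℕ} {y : ℝ} (h : IsWeakSlot β k j y)
    (hj : j < k) {j' : ℕ} (hj' : j' < k) : profile α β j' y ≤ profile α β j y := by
  rcases le_total j j' with hle | hle
  · rw [profile_add_sum_Ico α β hle]
    have : ∑ l ∈ Finset.Ico j j', (y - β l) ≤ 0 := by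
      refine Finset.sum_nonpos fun l hl => ?_
      rw [Finset.mem_Ico] at hl
      exact sub_nonpos.2 ((h l (by omega)).2 hl.1)
    linarith
  · rw [profile_add_sum_Ico α β hle]
    have : 0 ≤ ∑ l ∈ Finset.Ico j' j, (y - β l) := by
      refine Finset.sum_nonneg fun l hl => ?_
      rw [Finset.mem_Ico] at hl
      exact sub_nonneg.2 ((h l (by omega)).1 hl.2)
    linarith

theorem IsStrictSlot.profile_lt {α : ℝ} {β : ℕ → ℝ} {k j : ℕ} {y : ℝ} (h : IsStrictSlot β k j y)
    (hj : j < k) {j' : ℕ} (hj' : j' < k) (hne : j' ≠ j) :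
    profile α β j' y < profile α β j y := by
  rcases lt_or_gt_of_ne hne with hle | hle
  · rw [profile_add_sum_Ico α β hle.le]
    have : 0 < ∑ l ∈ Finset.Ico j' j, (y - β l) := by
      refine Finset.sum_pos (fun l hl => ?_) (Finset.nonempty_Ico.2 hle)
      rw [Finset.mem_Ico] at hl
      exact sub_pos.2 ((h l (by omega)).1 hl.2)
    linarith
  · rw [profile_add_sum_Ico α β hle.le]
    have : ∑ l ∈ Finset.Ico j j', (y - β l) < 0 := by
      refine Finset.sum_neg (fun l hl => ?_) (Finset.nonempty_Ico.2 hle)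
      rw [Finset.mem_Ico] at hl
      exact sub_neg.2 ((h l (by omega)).2 hl.1)
    linarith

theorem isWeakSlot_of_profile_le {α : ℝ} {β : ℕ → ℝ} (hβ : StrictMono β) {k j : ℕ} {y : ℝ}
    (hj : j < k) (h : ∀ j' < k, profile α β j' y ≤ profile α β j y) : IsWeakSlot β k j y := by
  refine fun l hl => ⟨fun hlj => ?_, fun hlj => ?_⟩
  · have h1 := h (j - 1) (by omega)
    have h2 := profile_succ α β (j - 1) y
    rw [Nat.sub_add_cancel (by omega)] at h2
    have h3 : β l ≤ β (j - 1) := hβ.monotone (by omega)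
    linarith
  · have h1 := h (j + 1) (by omega)
    rw [profile_succ] at h1
    have h3 : β j ≤ β l := hβ.monotone hlj
    linarith

theorem isStrictSlot_of_profile_lt {α : ℝ} {β : ℕ → ℝ} (hβ : StrictMono β) {k j : ℕ} {y : ℝ}
    (hj : j < k) (h : ∀ j' < k, j' ≠ j → profile α β j' y < profile α β j y) :
    IsStrictSlot β k j y := by
  refine fun l hl => ⟨fun hlj => ?_, fun hlj => ?_⟩
  · have h1 := h (j - 1) (by omega) (by omega)
    have h2 := profile_succ α β (j - 1) y
    rw [Nat.sub_add_cancel (by omega)] at h2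
    have h3 : β l ≤ β (j - 1) := hβ.monotone (by omega)
    linarith
  · have h1 := h (j + 1) (by omega) (by omega)
    rw [profile_succ] at h1
    have h3 : β j ≤ β l := hβ.monotone hlj
    linarith

end Profile

/-! ### Counting the cells of a simple hyperplane arrangement -/

section Arrangement

variable {E : Type*} [AddCommGroup E] [Module ℝ E] {ι : Type*} [DecidableEq ι]

/-- Zaslavsky's count for a simple arrangement of the hyperplanes `v t = c t`: if the functionals
of any set of hyperplanes with a common point are independent, in the sense that together they
take all tuples of values, then the sign patterns of the hyperplanes in `W` on the flat cut out by
`U` are as many as the subsets of `W` with a common point on that flat. A sign pattern is given by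
the set `P` of its positive hyperplanes. The proof is by deletion and restriction. -/
theorem card_signPatterns_eq_card_flats (v : ι → E →ₗ[ℝ] ℝ) (c : ι → ℝ)
    (hsimple : ∀ T : Finset ι, (∃ x, ∀ t ∈ T, v t x = c t) →
      ∀ z : ι → ℝ, ∃ x, ∀ t ∈ T, v t x = z t) (W : Finset ι) :
    ∀ U : Finset ι, Disjoint U W →
    {P : Finset ι | P ⊆ W ∧ ∃ x, (∀ t ∈ U, v t x = c t) ∧
        ∀ t ∈ W, (t ∈ P → c t < v t x) ∧ (t ∉ P → v t x < c t)}.ncard =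
      {T : Finset ι | T ⊆ W ∧ ∃ x, ∀ t ∈ U ∪ T, v t x = c t}.ncard := by
  induction W using Finset.induction_on with
  | empty =>
    intro U _
    congr 1
    ext P
    simp only [Finset.subset_empty, Finset.notMem_empty, false_imp_iff, implies_true, and_true,
      Set.mem_ofPred_eq]
    refine and_congr_right fun h => ?_
    simp [h]
  | insert h W hW ih =>
    intro U hU
    rw [Finset.disjoint_insert_right] at hU
    set A : Finset ι → Finset ι → Set (Finset ι) := fun U W =>
      {P | P ⊆ W ∧ ∃ x, (∀ t ∈ U, v t x = c t) ∧
        ∀ t ∈ W, (t ∈ P → c t < v t x) ∧ (t ∉ P → v t x < c t)}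
    set B : Finset ι → Finset ι → Set (Finset ι) := fun U W =>
      {T | T ⊆ W ∧ ∃ x, ∀ t ∈ U ∪ T, v t x = c t}
    have hfin : ∀ (W : Finset ι) (p : Finset ι → Prop), {P : Finset ι | P ⊆ W ∧ p P}.Finite :=
      fun W p => (W.powerset.finite_toSet).subset fun P hP => by simpa using hP.1
    have hins : Set.InjOn (insert h : Finset ι → Finset ι) {P | P ⊆ W} := by
      intro P hP Q hQ hPQ
      have hP' : h ∉ P := fun hh => hW (hP hh)
      have hQ' : h ∉ Q := fun hh => hW (hQ hh)
      rw [← Finset.erase_insert hP', ← Finset.erase_insert hQ']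
      exact congrArg (fun s => s.erase h) hPQ
    have hB : (B U (insert h W)).ncard = (B U W).ncard + (B (insert h U) W).ncard := by
      have : B U (insert h W) = B U W ∪ insert h '' B (insert h U) W := by
        ext T
        constructor
        · rintro ⟨hT, x, hx⟩
          by_cases hh : h ∈ T
          · refine Or.inr ⟨T.erase h, ⟨by rwa [← Finset.subset_insert_iff], x, ?_⟩,
              Finset.insert_erase hh⟩
            intro t ht
            refine hx t ?_
            simp only [Finset.mem_union, Finset.mem_insert, Finset.mem_erase] at ht ⊢
            rcases ht with (rfl | ht) | ht
            · exact Or.inr hh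
            · exact Or.inl ht
            · exact Or.inr ht.2
          · exact Or.inl ⟨(Finset.subset_insert_iff_of_notMem hh).1 hT, x, hx⟩
        · rintro (⟨hT, x, hx⟩ | ⟨T, ⟨hT, x, hx⟩, rfl⟩)
          · exact ⟨hT.trans (Finset.subset_insert _ _), x, hx⟩
          · refine ⟨Finset.insert_subset_insert _ hT, x, ?_⟩
            rwa [Finset.union_insert, ← Finset.insert_union]
      rw [this, Set.ncard_union_eq ?_ (hfin _ _) ((hfin _ _).image _),
        (hins.mono fun P hP => hP.1).ncard_image]
      rw [Set.disjoint_left]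
      rintro _ hT ⟨T, -, rfl⟩
      exact hW (hT.1 (Finset.mem_insert_self _ _))
    -- `X` and `Y`: the old sign patterns that persist on the negative, positive side of `h`
    set X : Set (Finset ι) := {P | P ⊆ W ∧ ∃ x, ((∀ t ∈ U, v t x = c t) ∧
        ∀ t ∈ W, (t ∈ P → c t < v t x) ∧ (t ∉ P → v t x < c t)) ∧ v h x < c h} with hX
    set Y : Set (Finset ι) := {P | P ⊆ W ∧ ∃ x, ((∀ t ∈ U, v t x = c t) ∧
        ∀ t ∈ W, (t ∈ P → c t < v t x) ∧ (t ∉ P → v t x < c t)) ∧ c h < v h x} with hY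
    have hA : (A U (insert h W)).ncard = X.ncard + Y.ncard := by
      have : A U (insert h W) = X ∪ insert h '' Y := by
        ext P
        constructor
        · rintro ⟨hP, x, hxU, hx⟩
          by_cases hh : h ∈ P
          · refine Or.inr ⟨P.erase h, ⟨by rwa [← Finset.subset_insert_iff], x, ⟨hxU, ?_⟩,
              (hx h (Finset.mem_insert_self _ _)).1 hh⟩, Finset.insert_erase hh⟩
            intro t ht
            have hth : t ≠ h := fun hth => hW (hth ▸ ht)
            simpa [hth] using hx t (Finset.mem_insert_of_mem ht)
          · exact Or.inl ⟨(Finset.subset_insert_iff_of_notMem hh).1 hP, x,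
              ⟨hxU, fun t ht => hx t (Finset.mem_insert_of_mem ht)⟩,
              (hx h (Finset.mem_insert_self _ _)).2 hh⟩
        · rintro (⟨hP, x, ⟨hxU, hx⟩, hxh⟩ | ⟨P, ⟨hP, x, ⟨hxU, hx⟩, hxh⟩, rfl⟩)
          · refine ⟨hP.trans (Finset.subset_insert _ _), x, hxU, fun t ht => ?_⟩
            rcases Finset.mem_insert.1 ht with rfl | ht
            · exact ⟨fun hh => absurd (hP hh) hW, fun _ => hxh⟩
            · exact hx t ht
          · refine ⟨Finset.insert_subset_insert _ hP, x, hxU, fun t ht => ?_⟩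
            rcases Finset.mem_insert.1 ht with rfl | ht
            · exact ⟨fun _ => hxh, fun hh => absurd (Finset.mem_insert_self _ _) hh⟩
            · have hth : t ≠ h := fun hth => hW (hth ▸ ht)
              simpa [hth] using hx t ht
      rw [this, Set.ncard_union_eq ?_ (hfin _ _) ((hfin _ _).image _),
        (hins.mono fun P hP => hP.1).ncard_image]
      rw [Set.disjoint_left]
      rintro _ hT ⟨T, -, rfl⟩
      exact hW (hT.1 (Finset.mem_insert_self _ _))
    -- moving off the hyperplane `h` within the flat of `U`, to either side
    have hmove : ∀ P ∈ A (insert h U) W, ∀ σ : ℝ, ∃ x, ((∀ t ∈ U, v t x = c t) ∧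
        ∀ t ∈ W, (t ∈ P → c t < v t x) ∧ (t ∉ P → v t x < c t)) ∧
          ∃ ε : ℝ, 0 < ε ∧ v h x = c h + ε * σ := by
      rintro P ⟨hP, x, hxU, hx⟩ σ
      obtain ⟨u, hu⟩ := hsimple (insert h U) ⟨x, hxU⟩ fun t => if t = h then σ else 0
      have hlim : ∀ t, Filter.Tendsto (fun ε : ℝ => v t x + ε * v t u) (nhdsWithin 0 (Set.Ioi 0))
          (nhds (v t x)) := by
        intro t
        have : Continuous fun ε : ℝ => v t x + ε * v t u := by fun_prop
        simpa using (this.tendsto 0).mono_left nhdsWithin_le_nhds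
      have hev : ∀ t ∈ W, ∀ᶠ ε : ℝ in nhdsWithin 0 (Set.Ioi 0),
          (t ∈ P → c t < v t x + ε * v t u) ∧ (t ∉ P → v t x + ε * v t u < c t) := by
        intro t ht
        by_cases htP : t ∈ P
        · simpa [htP] using (hlim t).eventually_const_lt ((hx t ht).1 htP)
        · simpa [htP] using (hlim t).eventually_lt_const ((hx t ht).2 htP)
      obtain ⟨ε, hε, hε0⟩ := (((Finset.eventually_all W).2 hev).and self_mem_nhdsWithin).exists
      refine ⟨x + ε • u, ⟨fun t ht => ?_, fun t ht => ?_⟩, ε, hε0, ?_⟩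
      · have hth : t ≠ h := fun hth => hU.1 (hth ▸ ht)
        rw [map_add, map_smul, hu t (Finset.mem_insert_of_mem ht), if_neg hth, smul_zero, add_zero,
          hxU t (Finset.mem_insert_of_mem ht)]
      · simpa using hε t ht
      · rw [map_add, map_smul, hu h (Finset.mem_insert_self _ _), if_pos rfl,
          hxU h (Finset.mem_insert_self _ _), smul_eq_mul]
    have hunion : X ∪ Y = A U W := by
      ext P
      constructor
      · rintro (⟨hP, x, hx, -⟩ | ⟨hP, x, hx, -⟩) <;> exact ⟨hP, x, hx⟩
      · rintro ⟨hP, x, hx⟩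
        rcases lt_trichotomy (v h x) (c h) with hlt | heq | hlt
        · exact Or.inl ⟨hP, x, hx, hlt⟩
        · have hPA : P ∈ A (insert h U) W := by
            refine ⟨hP, x, fun t ht => ?_, hx.2⟩
            rcases Finset.mem_insert.1 ht with rfl | ht
            · exact heq
            · exact hx.1 t ht
          obtain ⟨y, hy, ε, hε, hyh⟩ := hmove P hPA 1
          exact Or.inr ⟨hP, y, hy, by linarith⟩
        · exact Or.inr ⟨hP, x, hx, hlt⟩
    have hinter : X ∩ Y = A (insert h U) W := by
      ext P
      constructor
      · rintro ⟨⟨hP, x, ⟨hxU, hx⟩, hxh⟩, ⟨-, y, ⟨hyU, hy⟩, hyh⟩⟩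
        -- the segment from `x` to `y` crosses the hyperplane `h`
        have hd : 0 < v h y - v h x := by linarith
        set s : ℝ := (c h - v h x) / (v h y - v h x) with hs
        have hs0 : 0 < s := div_pos (by linarith) hd
        have hs1 : s < 1 := (div_lt_one hd).2 (by linarith)
        have hval : ∀ t, v t (x + s • (y - x)) = (1 - s) * v t x + s * v t y := by
          intro t
          rw [map_add, map_smul, map_sub, smul_eq_mul]
          ring
        refine ⟨hP, x + s • (y - x), fun t ht => ?_, fun t ht => ⟨fun htP => ?_, fun htP => ?_⟩⟩
        · rw [hval]
          rcases Finset.mem_insert.1 ht with rfl | ht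
          · rw [hs]
            field_simp
            ring
          · rw [hxU t ht, hyU t ht]
            ring
        · rw [hval]
          have h1 := mul_lt_mul_of_pos_left ((hx t ht).1 htP) (sub_pos.2 hs1)
          have h2 := mul_lt_mul_of_pos_left ((hy t ht).1 htP) hs0
          linarith
        · rw [hval]
          have h1 := mul_lt_mul_of_pos_left ((hx t ht).2 htP) (sub_pos.2 hs1)
          have h2 := mul_lt_mul_of_pos_left ((hy t ht).2 htP) hs0
          linarith
      · intro hPA
        obtain ⟨x, hx, ε, hε, hxh⟩ := hmove P hPA (-1)
        obtain ⟨y, hy, ε', hε', hyh⟩ := hmove P hPA 1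
        exact ⟨⟨hPA.1, x, hx, by linarith⟩, ⟨hPA.1, y, hy, by linarith⟩⟩
    have hfinX : X.Finite := hfin _ _
    have hfinY : Y.Finite := hfin _ _
    change (A U (insert h W)).ncard = (B U (insert h W)).ncard
    rw [hA, hB, ← Set.ncard_union_add_ncard_inter X Y hfinX hfinY, hunion, hinter]
    exact congrArg₂ _ (ih U hU.2) (ih (insert h U) (Finset.disjoint_insert_left.2 ⟨hW, hU.2⟩))

end Arrangement

/-! ### Hyperplanes in general position -/

section Moment

variable {d b : ℕ}

/-- The `i`-th node of the moment curve. The nodes are positive and distinct. -/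
def momentNode (i : Fin b) : ℝ := (i : ℝ) + 1

/-- The normal vectors `(1, t, …, t ^ (d - 1))` on the moment curve. As functionals on the
coefficient vectors of polynomials of degree less than `d` they are the evaluations at `t`. -/
def momentVec (d : ℕ) (i : Fin b) : Fin d → ℝ := fun j => momentNode i ^ (j : ℕ)

theorem momentNode_injective : Function.Injective (momentNode (b := b)) := by
  intro i i' h
  simpa [momentNode, Fin.ext_iff] using h

/-- The polynomial with coefficient vector `x`. -/
noncomputable def vecPoly (x : Fin d → ℝ) : Polynomial ℝ :=
  ∑ j : Fin d, Polynomial.C (x j) * Polynomial.X ^ (j : ℕ)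

theorem eval_vecPoly (x : Fin d → ℝ) (i : Fin b) :
    (vecPoly x).eval (momentNode i) = featureGrad (momentVec d i) x := by
  rw [vecPoly, Polynomial.eval_finsetSum, featureGrad_apply]
  refine Finset.sum_congr rfl fun j _ => ?_
  rw [Polynomial.eval_mul, Polynomial.eval_C, Polynomial.eval_pow, Polynomial.eval_X, mul_comm]
  rfl

theorem degree_vecPoly_lt (x : Fin d → ℝ) : (vecPoly x).degree < d :=
  Polynomial.degree_sum_fin_lt x

theorem vecPoly_eq_zero {x : Fin d → ℝ} (h : vecPoly x = 0) : x = 0 := by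
  funext j
  have : (vecPoly x).coeff j = x j := by
    rw [vecPoly, Polynomial.finsetSum_coeff]
    simp [Polynomial.coeff_C_mul, Polynomial.coeff_X_pow, Fin.val_inj]
  rw [← this, h]
  simp

/-- At most `d` vectors of the moment curve are independent, by Lagrange interpolation. -/
theorem exists_featureGrad_momentVec_eq (hd : 1 ≤ d) {S : Finset (Fin b)} (hS : S.card ≤ d)
    (z : Fin b → ℝ) : ∃ x : Fin d → ℝ, ∀ i ∈ S, featureGrad (momentVec d i) x = z i := by
  set p := Lagrange.interpolate S momentNode z with hp
  have hdeg : p.degree < d :=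
    (Lagrange.degree_interpolate_lt z momentNode_injective.injOn).trans_le (by exact_mod_cast hS)
  have hnat : p.natDegree < d := by
    by_cases h0 : p = 0
    · rw [h0]
      simpa using Nat.lt_of_lt_of_le Nat.zero_lt_one hd
    · exact (Polynomial.natDegree_lt_iff_degree_lt h0).2 hdeg
  refine ⟨fun j => p.coeff j, fun i hi => ?_⟩
  have h1 : p.eval (momentNode i) = z i :=
    Lagrange.eval_interpolate_at_node z momentNode_injective.injOn hi
  rw [← h1, Polynomial.eval_eq_sum_range' hnat, featureGrad_apply, Finset.sum_range]
  exact Finset.sum_congr rfl fun j _ => mul_comm _ _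

/-- A nonzero vector is orthogonal to fewer than `d` vectors of the moment curve. -/
theorem card_featureGrad_momentVec_eq_zero_lt {x : Fin d → ℝ} (hx : x ≠ 0) {S : Finset (Fin b)}
    (hS : ∀ i ∈ S, featureGrad (momentVec d i) x = 0) : S.card < d := by
  by_contra hcon
  push Not at hcon
  refine hx (vecPoly_eq_zero ?_)
  refine Polynomial.eq_zero_of_degree_lt_of_eval_index_eq_zero (v := momentNode) S
    momentNode_injective.injOn ((degree_vecPoly_lt x).trans_le (by exact_mod_cast hcon)) ?_
  intro i hi
  rw [eval_vecPoly, hS i hi]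

/-- The `l`-th threshold of the `i`-th family of parallel hyperplanes. -/
def momentThreshold (d : ℕ) (ε : ℝ) (i : Fin b) (l : ℕ) : ℝ := momentNode i ^ d + ε * l

theorem momentThreshold_strictMono {ε : ℝ} (hε : 0 < ε) (i : Fin b) :
    StrictMono (momentThreshold d ε i) := by
  intro l l' h
  have : (l : ℝ) < l' := by exact_mod_cast h
  have := mul_lt_mul_of_pos_left this hε
  simp only [momentThreshold]
  linarith

theorem exists_pos_forall_mul_abs_lt_one {α : Type*} [Finite α] (f : α → ℝ) :
    ∃ ε : ℝ, 0 < ε ∧ ∀ a, ε * |f a| < 1 := by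
  cases nonempty_fintype α
  have hM : 0 ≤ ∑ a, |f a| := Finset.sum_nonneg fun a _ => abs_nonneg _
  refine ⟨1 / (1 + ∑ a, |f a|), by positivity, fun a => ?_⟩
  have hle : |f a| ≤ ∑ a, |f a| :=
    Finset.single_le_sum (f := fun a => |f a|) (fun a _ => abs_nonneg _) (Finset.mem_univ a)
  rw [one_div_mul_eq_div, div_lt_one (by positivity)]
  linarith

theorem exists_polynomial_interpolation {α : Type*} (T : Finset α) (v r : α → ℝ) :
    ∃ e : Polynomial ℝ, Set.InjOn v T → e.degree < T.card ∧ ∀ t ∈ T, e.eval (v t) = r t := by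
  classical
  exact ⟨Lagrange.interpolate T v r, fun hinj => ⟨Lagrange.degree_interpolate_lt r hinj,
    fun t ht => Lagrange.eval_interpolate_at_node r hinj ht⟩⟩

/-- For small spacings `ε`, no point lies on more than `d` hyperplanes of different families: a
common point of `d + 1` of them would be a polynomial of degree less than `d` that is close to
`t ^ d` at `d + 1` nodes. -/
theorem exists_momentThreshold_general (d : ℕ) (k : Fin b → ℕ) :
    ∃ ε : ℝ, 0 < ε ∧ ∀ T : Finset (Σ i : Fin b, Fin (k i - 1)),
      Set.InjOn Sigma.fst (T : Set (Σ i : Fin b, Fin (k i - 1))) →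
      (∃ x : Fin d → ℝ, ∀ t ∈ T,
        featureGrad (momentVec d t.1) x = momentThreshold d ε t.1 t.2) → T.card ≤ d := by
  -- `e T` interpolates the offsets of the hyperplanes in `T`
  choose e he using fun T : Finset (Σ i : Fin b, Fin (k i - 1)) =>
    exists_polynomial_interpolation T (fun t => momentNode t.1) fun t => ((t.2 : ℕ) : ℝ)
  obtain ⟨ε, hε, hεe⟩ := exists_pos_forall_mul_abs_lt_one fun T => (e T).coeff d
  refine ⟨ε, hε, ?_⟩
  rintro T₀ hinj₀ ⟨x, hx₀⟩
  by_contra hcard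
  obtain ⟨T, hT, hTd⟩ := Finset.exists_subset_card_eq (show d + 1 ≤ T₀.card by omega)
  have hinj : Set.InjOn (fun t : Σ i : Fin b, Fin (k i - 1) => momentNode t.1) T :=
    fun t ht t' ht' h => hinj₀ (hT ht) (hT ht') (momentNode_injective h)
  set r : Polynomial ℝ := vecPoly x - Polynomial.X ^ d - Polynomial.C ε * e T with hr
  have hr0 : r = 0 := by
    refine Polynomial.eq_zero_of_degree_lt_of_eval_index_eq_zero T hinj ?_ ?_
    · have hdd : (d : WithBot ℕ) < (T.card : ℕ) := by
        rw [hTd]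
        exact_mod_cast Nat.lt_succ_self d
      refine (Polynomial.degree_sub_le _ _).trans_lt (max_lt ?_ ?_)
      · refine (Polynomial.degree_sub_le _ _).trans_lt (max_lt ?_ ?_)
        · exact (degree_vecPoly_lt x).trans hdd
        · rwa [Polynomial.degree_X_pow]
      · refine lt_of_le_of_lt ?_ (he T hinj).1
        refine (Polynomial.degree_mul_le _ _).trans ?_
        calc _ ≤ 0 + (e T).degree := by gcongr; exact Polynomial.degree_C_le
          _ = _ := zero_add _
    · intro t ht
      have h1 := (he T hinj).2 t ht
      simp only [hr, Polynomial.eval_sub, Polynomial.eval_mul, Polynomial.eval_C,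
        Polynomial.eval_pow, Polynomial.eval_X, h1, eval_vecPoly, hx₀ t (hT ht), momentThreshold]
      ring
  have hcoeff := congrArg (fun p => Polynomial.coeff p d) hr0
  simp only [hr, Polynomial.coeff_sub, Polynomial.coeff_C_mul, Polynomial.coeff_X_pow_self,
    Polynomial.coeff_zero, Polynomial.coeff_eq_zero_of_degree_lt (degree_vecPoly_lt x)] at hcoeff
  have h1 := hεe T
  rw [← abs_of_pos hε, ← abs_mul, show ε * (e T).coeff d = -1 by linarith] at h1
  norm_num at h1

/-- The sets of at most `d` hyperplanes, no two from the same family, are counted by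
`shallowCount`. -/
theorem ncard_transversals (d : ℕ) (k : Fin b → ℕ) :
    {T : Finset (Σ i : Fin b, Fin (k i - 1)) |
      Set.InjOn Sigma.fst (T : Set (Σ i : Fin b, Fin (k i - 1))) ∧ T.card ≤ d}.ncard =
      shallowCount d k := by
  classical
  set 𝒯 : Finset (Finset (Σ i : Fin b, Fin (k i - 1))) := Finset.univ.filter fun T =>
    Set.InjOn Sigma.fst (T : Set (Σ i : Fin b, Fin (k i - 1))) ∧ T.card ≤ d with h𝒯
  have h1 : {T : Finset (Σ i : Fin b, Fin (k i - 1)) |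
      Set.InjOn Sigma.fst (T : Set (Σ i : Fin b, Fin (k i - 1))) ∧ T.card ≤ d} = 𝒯 := by
    ext T
    simp [h𝒯]
  rw [h1, Set.ncard_coe_finset, shallowCount,
    Finset.card_eq_sum_card_fiberwise (f := Finset.card) (t := Finset.range (d + 1))
      (fun T hT => by
        have hT' : T ∈ 𝒯 := hT
        simp only [h𝒯, Finset.mem_filter] at hT'
        simpa [Nat.lt_succ_iff] using hT'.2.2)]
  refine Finset.sum_congr rfl fun j hj => ?_
  rw [Finset.card_eq_sum_card_fiberwise (f := Finset.image Sigma.fst)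
      (t := Finset.powersetCard j Finset.univ)
      (fun T hT => by
        have hT' : T ∈ 𝒯.filter fun T => T.card = j := hT
        simp only [h𝒯, Finset.mem_filter] at hT'
        change T.image Sigma.fst ∈ Finset.powersetCard j Finset.univ
        rw [Finset.mem_powersetCard]
        exact ⟨Finset.subset_univ _, (Finset.card_image_of_injOn hT'.1.2.1).trans hT'.2⟩)]
  refine Finset.sum_congr rfl fun S hS => ?_
  have hSj := (Finset.mem_powersetCard.1 hS).2
  have hprod : ∏ i ∈ S, (k i - 1) = (S.pi fun i => (Finset.univ : Finset (Fin (k i - 1)))).card := by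
    simp [Finset.card_pi]
  rw [hprod]
  symm
  refine Finset.card_bij (fun f _ => S.attach.image fun i => ⟨i.1, f i.1 i.2⟩) ?_ ?_ ?_
  · intro f _
    have himage : (S.attach.image fun i => (⟨i.1, f i.1 i.2⟩ : Σ i : Fin b, Fin (k i - 1))).image
        Sigma.fst = S := by
      ext i
      simp
    have hcard : (S.attach.image fun i =>
        (⟨i.1, f i.1 i.2⟩ : Σ i : Fin b, Fin (k i - 1))).card = S.card := by
      rw [Finset.card_image_of_injective _ fun i i' h => Subtype.ext (congrArg Sigma.fst h),
        Finset.card_attach]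
    simp only [h𝒯, Finset.mem_filter, Finset.mem_univ, true_and]
    refine ⟨⟨⟨?_, ?_⟩, hcard.trans hSj⟩, himage⟩
    · rw [← Finset.card_image_iff, himage, hcard]
    · rw [hcard, hSj]
      exact Nat.lt_succ_iff.1 (Finset.mem_range.1 hj)
  · intro f _ f' _ h
    funext i hi
    have hmem : (⟨i, f i hi⟩ : Σ i : Fin b, Fin (k i - 1)) ∈
        S.attach.image fun i => (⟨i.1, f' i.1 i.2⟩ : Σ i : Fin b, Fin (k i - 1)) := by
      rw [← h]
      exact Finset.mem_image.2 ⟨⟨i, hi⟩, Finset.mem_attach _ _, rfl⟩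
    obtain ⟨⟨i', hi'⟩, -, heq⟩ := Finset.mem_image.1 hmem
    obtain ⟨rfl, h2⟩ := Sigma.mk.inj_iff.1 heq
    exact (eq_of_heq h2).symm
  · intro T hT
    simp only [h𝒯, Finset.mem_filter, Finset.mem_univ, true_and] at hT
    obtain ⟨⟨⟨hinj, -⟩, -⟩, himage⟩ := hT
    have hex : ∀ i ∈ S, ∃ l : Fin (k i - 1), (⟨i, l⟩ : Σ i : Fin b, Fin (k i - 1)) ∈ T := by
      intro i hi
      rw [← himage, Finset.mem_image] at hi
      obtain ⟨⟨i', l⟩, ht, rfl⟩ := hi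
      exact ⟨l, ht⟩
    choose f hf using hex
    refine ⟨f, by simp, ?_⟩
    ext ⟨i, l⟩
    constructor
    · intro h
      obtain ⟨⟨i', hi'⟩, -, heq⟩ := Finset.mem_image.1 h
      rw [← heq]
      exact hf i' hi'
    · intro h
      have hi : i ∈ S := himage ▸ Finset.mem_image_of_mem Sigma.fst h
      refine Finset.mem_image.2 ⟨⟨i, hi⟩, Finset.mem_attach _ _, ?_⟩
      exact hinj (hf i hi) h rfl

end Moment

/-! ### A layer of units with parallel features in general position -/

section Parallel

variable {d b : ℕ}

/-- The pattern `J` attains the maximum at every unit for the homogenized features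
`(x, t) ↦ w ⬝ x + t * β`. For `t = 1` these are the features, and for `t = 0` their directions of
recession. -/
def IsHomogActive {κ : Fin b → Type} (θ : ∀ i, κ i → (Fin d → ℝ) × ℝ) (J : ∀ i, κ i)
    (x : Fin d → ℝ) (t : ℝ) : Prop :=
  ∀ i j, featureGrad (θ i j).1 x + t * (θ i j).2 ≤
    featureGrad (θ i (J i)).1 x + t * (θ i (J i)).2

/-- The layer has exactly `N` strictly active patterns, and the others are not even weakly active,
neither at points nor at infinity. Because it includes the points at infinity, this condition is
stable under small changes of the parameters. -/
def HasStablePatterns {κ : Fin b → Type} (θ : ∀ i, κ i → (Fin d → ℝ) × ℝ) (N : ℕ) : Prop :=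
  (∀ J, (∃ y, IsStrictlyActive θ J y) ∨
    ∀ x t, 0 ≤ t → IsHomogActive θ J x t → x = 0 ∧ t = 0) ∧
  {J | ∃ y, IsStrictlyActive θ J y}.ncard = N

theorem isHomogActive_one_iff {κ : Fin b → Type} {θ : ∀ i, κ i → (Fin d → ℝ) × ℝ}
    {J : ∀ i, κ i} {x : Fin d → ℝ} : IsHomogActive θ J x 1 ↔ IsWeaklyActive θ J x := by
  simp only [IsHomogActive, IsWeaklyActive, featureValue_eq, one_mul]

theorem HasStablePatterns.hasGenericPatterns {κ : Fin b → Type}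
    {θ : ∀ i, κ i → (Fin d → ℝ) × ℝ} {N : ℕ} (h : HasStablePatterns θ N) :
    HasGenericPatterns θ N := by
  refine ⟨fun J x hJ => (h.1 J).resolve_right fun hJ' => ?_, h.2⟩
  exact one_ne_zero (hJ' x 1 zero_le_one (isHomogActive_one_iff.2 hJ)).2

/-- The layer whose `i`-th unit has its breaks on `k i - 1` parallel hyperplanes that are normal to
the `i`-th vector of the moment curve. -/
noncomputable def parallelLayer (d : ℕ) (k : Fin b → ℕ) (ε : ℝ) :
    ∀ i : Fin b, Fin (k i) → (Fin d → ℝ) × ℝ := fun i j =>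
  (((j : ℕ) : ℝ) • momentVec d i, -∑ l ∈ Finset.range j, momentThreshold d ε i l)

theorem featureGrad_smul (c : ℝ) (w x : Fin d → ℝ) :
    featureGrad (c • w) x = c * featureGrad w x := by
  simp [featureGrad_apply, Finset.mul_sum, mul_assoc]

theorem featureGrad_add (w w' x : Fin d → ℝ) :
    featureGrad (w + w') x = featureGrad w x + featureGrad w' x := by
  simp [featureGrad_apply, Finset.sum_add_distrib, add_mul]

variable {k : Fin b → ℕ} {ε : ℝ}

theorem featureValue_parallelLayer (i : Fin b) (j : Fin (k i)) (x : Fin d → ℝ) :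
    featureValue (parallelLayer d k ε i j) x =
      profile 0 (momentThreshold d ε i) j (featureGrad (momentVec d i) x) := by
  rw [featureValue_eq, profile_eq, parallelLayer, featureGrad_smul]
  ring

theorem isWeaklyActive_parallelLayer_iff (hε : 0 < ε) {J : ∀ i, Fin (k i)} {x : Fin d → ℝ} :
    IsWeaklyActive (parallelLayer d k ε) J x ↔
      ∀ i, IsWeakSlot (momentThreshold d ε i) (k i) (J i) (featureGrad (momentVec d i) x) := by
  simp only [IsWeaklyActive, featureValue_parallelLayer]
  refine forall_congr' fun i => ⟨fun h => ?_, fun h j => h.profile_le (J i).2 j.2⟩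
  exact isWeakSlot_of_profile_le (momentThreshold_strictMono hε i) (J i).2
    fun j' hj' => h ⟨j', hj'⟩

theorem isStrictlyActive_parallelLayer_iff (hε : 0 < ε) {J : ∀ i, Fin (k i)} {x : Fin d → ℝ} :
    IsStrictlyActive (parallelLayer d k ε) J x ↔
      ∀ i, IsStrictSlot (momentThreshold d ε i) (k i) (J i) (featureGrad (momentVec d i) x) := by
  simp only [IsStrictlyActive, featureValue_parallelLayer]
  refine forall_congr' fun i => ⟨fun h => ?_, fun h j hj => h.profile_lt (J i).2 j.2 ?_⟩
  · exact isStrictSlot_of_profile_lt (momentThreshold_strictMono hε i) (J i).2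
      fun j' hj' hne => h ⟨j', hj'⟩ fun h => hne (congrArg Fin.val h)
  · exact fun h => hj (Fin.ext h)

/-- With thresholds in general position, the layer of parallel features has stable patterns, and
their number is the number of regions of a simple arrangement of families of parallel
hyperplanes. -/
theorem exists_hasStablePatterns_parallelLayer (hd : 1 ≤ d) (hk : ∀ i, 1 ≤ k i) :
    ∃ ε : ℝ, 0 < ε ∧ HasStablePatterns (parallelLayer d k ε) (shallowCount d k) := by
  classical
  obtain ⟨ε, hε, hgen⟩ := exists_momentThreshold_general d k
  refine ⟨ε, hε, ?_⟩
  have hne : ∀ i, Nonempty (Fin (k i)) := fun i => ⟨⟨0, hk i⟩⟩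
  set v : (Σ i : Fin b, Fin (k i - 1)) → (Fin d → ℝ) →ₗ[ℝ] ℝ :=
    fun t => (featureGrad (momentVec d t.1)).toLinearMap with hv
  set c : (Σ i : Fin b, Fin (k i - 1)) → ℝ := fun t => momentThreshold d ε t.1 t.2 with hc
  have hvapp : ∀ t x, v t x = featureGrad (momentVec d t.1) x := fun t x => rfl
  have hinj : ∀ T : Finset (Σ i : Fin b, Fin (k i - 1)), (∃ x, ∀ t ∈ T, v t x = c t) →
      Set.InjOn Sigma.fst (T : Set (Σ i : Fin b, Fin (k i - 1))) := by
    rintro T ⟨x, hx⟩ ⟨i, l⟩ ht ⟨i', l'⟩ ht' (rfl : i = i')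
    have h1 : c ⟨i, l⟩ = c ⟨i, l'⟩ := (hx ⟨i, l⟩ ht).symm.trans (hx ⟨i, l'⟩ ht')
    have h2 : (l : ℕ) = l' := (momentThreshold_strictMono hε i).injective h1
    rw [Fin.ext h2]
  have hsolve : ∀ T : Finset (Σ i : Fin b, Fin (k i - 1)),
      Set.InjOn Sigma.fst (T : Set (Σ i : Fin b, Fin (k i - 1))) → T.card ≤ d →
      ∀ z : (Σ i : Fin b, Fin (k i - 1)) → ℝ, ∃ x, ∀ t ∈ T, v t x = z t := by
    intro T hT hcard z
    have hz : ∀ i, ∃ r, ∀ t ∈ T, t.1 = i → z t = r := by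
      intro i
      by_cases hi : ∃ t ∈ T, t.1 = i
      · obtain ⟨t, ht, rfl⟩ := hi
        exact ⟨z t, fun t' ht' h => by rw [hT ht' ht h]⟩
      · exact ⟨0, fun t ht h => absurd ⟨t, ht, h⟩ hi⟩
    choose r hr using hz
    obtain ⟨x, hx⟩ := exists_featureGrad_momentVec_eq hd
      (S := T.image Sigma.fst) (Finset.card_image_le.trans hcard) r
    exact ⟨x, fun t ht => (hx _ (Finset.mem_image_of_mem _ ht)).trans (hr _ t ht rfl).symm⟩
  have hsimple : ∀ T : Finset (Σ i : Fin b, Fin (k i - 1)), (∃ x, ∀ t ∈ T, v t x = c t) →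
      ∀ z : (Σ i : Fin b, Fin (k i - 1)) → ℝ, ∃ x, ∀ t ∈ T, v t x = z t :=
    fun T hT => hsolve T (hinj T hT) (hgen T (hinj T hT) hT)
  -- a weakly active pattern becomes strictly active after a move off the tight hyperplanes
  have hweak : ∀ J x, IsWeaklyActive (parallelLayer d k ε) J x →
      ∃ y, IsStrictlyActive (parallelLayer d k ε) J y := by
    intro J x hJ
    rw [isWeaklyActive_parallelLayer_iff hε] at hJ
    obtain ⟨u, hu⟩ := hsimple (Finset.univ.filter fun t => v t x = c t)
      ⟨x, fun t ht => (Finset.mem_filter.1 ht).2⟩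
      fun t => if (t.2 : ℕ) < J t.1 then 1 else -1
    have hev : ∀ t : Σ i : Fin b, Fin (k i - 1), ∀ᶠ s : ℝ in nhdsWithin 0 (Set.Ioi 0),
        ((t.2 : ℕ) < J t.1 → c t < v t x + s * v t u) ∧
          ((J t.1 : ℕ) ≤ t.2 → v t x + s * v t u < c t) := by
      intro t
      have hlim : Filter.Tendsto (fun s : ℝ => v t x + s * v t u) (nhdsWithin 0 (Set.Ioi 0))
          (nhds (v t x)) := by
        have : Continuous fun s : ℝ => v t x + s * v t u := by fun_prop
        simpa using (this.tendsto 0).mono_left nhdsWithin_le_nhds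
      have hslot := hJ t.1 t.2 (by omega)
      by_cases htight : v t x = c t
      · filter_upwards [self_mem_nhdsWithin] with s (hs : 0 < s)
        rw [hu t (by simp [htight]), htight]
        split_ifs with hlt
        · exact ⟨fun _ => by linarith, fun h => absurd hlt (by omega)⟩
        · exact ⟨fun h => absurd h hlt, fun _ => by linarith⟩
      · by_cases hlt : (t.2 : ℕ) < J t.1
        · filter_upwards [hlim.eventually_const_lt
            (lt_of_le_of_ne (hslot.1 hlt) (Ne.symm htight))] with s hs
          exact ⟨fun _ => hs, fun h => absurd hlt (by omega)⟩
        · filter_upwards [hlim.eventually_lt_const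
            (lt_of_le_of_ne (hslot.2 (not_lt.1 hlt)) htight)] with s hs
          exact ⟨fun h => absurd h hlt, fun _ => hs⟩
    obtain ⟨s, hs⟩ := (Filter.eventually_all.2 hev).exists
    refine ⟨x + s • u, (isStrictlyActive_parallelLayer_iff hε).2 fun i l hl => ?_⟩
    have h1 := hs ⟨i, ⟨l, by omega⟩⟩
    rw [map_add, map_smul]
    exact h1
  -- a pattern that is weakly active in the direction `x` at infinity: interpolate the slots of
  -- the units that are constant along `x`, and go far in the direction `x`
  have hinfty : ∀ J x, x ≠ 0 → IsHomogActive (parallelLayer d k ε) J x 0 →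
      ∃ y, IsStrictlyActive (parallelLayer d k ε) J y := by
    intro J x hx hJ
    have hJ' : ∀ i (j : Fin (k i)), ((j : ℕ) : ℝ) * featureGrad (momentVec d i) x ≤
        ((J i : ℕ) : ℝ) * featureGrad (momentVec d i) x := by
      intro i j
      simpa [parallelLayer, featureGrad_smul] using hJ i j
    obtain ⟨y, hy⟩ := exists_featureGrad_momentVec_eq hd
      (S := Finset.univ.filter fun i : Fin b => featureGrad (momentVec d i) x = 0)
      (card_featureGrad_momentVec_eq_zero_lt hx fun i hi => (Finset.mem_filter.1 hi).2).le
      fun i => momentNode i ^ d + ε * ((J i : ℕ) - 1 / 2)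
    have hev : ∀ t : Σ i : Fin b, Fin (k i - 1), ∀ᶠ s : ℝ in Filter.atTop,
        ((t.2 : ℕ) < J t.1 → c t < v t y + s * v t x) ∧
          ((J t.1 : ℕ) ≤ t.2 → v t y + s * v t x < c t) := by
      rintro ⟨i, l⟩
      simp only [hvapp, hc]
      rcases lt_trichotomy (featureGrad (momentVec d i) x) 0 with hlt | heq | hlt
      · have hJ0 : (J i : ℕ) = 0 := by
          have := hJ' i ⟨0, hk i⟩
          by_contra hne
          have hpos : (0 : ℝ) < (J i : ℕ) := by exact_mod_cast Nat.pos_of_ne_zero hne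
          have h2 := mul_neg_of_pos_of_neg hpos hlt
          simp only [Nat.cast_zero, zero_mul] at this
          linarith
        have hlim : Filter.Tendsto (fun s : ℝ => featureGrad (momentVec d i) y +
            s * featureGrad (momentVec d i) x) Filter.atTop Filter.atBot :=
          Filter.tendsto_atBot_add_const_left _ _ (Filter.tendsto_id.atTop_mul_const_of_neg hlt)
        filter_upwards [hlim.eventually_lt_atBot (momentThreshold d ε i l)] with s hs
        exact ⟨fun h => absurd h (by omega), fun _ => hs⟩
      · refine Filter.Eventually.of_forall fun s => ?_
        rw [heq, hy i (by simp [heq])]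
        simp only [momentThreshold]
        refine ⟨fun h => ?_, fun h => ?_⟩
        · have : ((l : ℕ) : ℝ) + 1 ≤ (J i : ℕ) := by exact_mod_cast h
          have := mul_le_mul_of_nonneg_left this hε.le
          linarith
        · have : ((J i : ℕ) : ℝ) ≤ (l : ℕ) := by exact_mod_cast h
          have := mul_le_mul_of_nonneg_left this hε.le
          linarith
      · have hJ0 : k i ≤ (J i : ℕ) + 1 := by
          have := le_of_mul_le_mul_right (hJ' i ⟨k i - 1, Nat.sub_lt (hk i) one_pos⟩) hlt
          have : k i - 1 ≤ (J i : ℕ) := by exact_mod_cast this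
          omega
        have hlim : Filter.Tendsto (fun s : ℝ => featureGrad (momentVec d i) y +
            s * featureGrad (momentVec d i) x) Filter.atTop Filter.atTop :=
          Filter.tendsto_atTop_add_const_left _ _ (Filter.tendsto_id.atTop_mul_const hlt)
        filter_upwards [hlim.eventually_gt_atTop (momentThreshold d ε i l)] with s hs
        exact ⟨fun _ => hs, fun h => absurd h (by omega)⟩
    obtain ⟨s, hs⟩ := (Filter.eventually_all.2 hev).exists
    refine ⟨y + s • x, (isStrictlyActive_parallelLayer_iff hε).2 fun i l hl => ?_⟩
    have h1 := hs ⟨i, ⟨l, by omega⟩⟩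
    rw [map_add, map_smul]
    exact h1
  refine ⟨fun J => or_iff_not_imp_left.2 fun hJ x t ht hact => ?_, ?_⟩
  · rcases eq_or_lt_of_le ht with rfl | ht
    · by_contra hx
      exact hJ (hinfty J x (fun h => hx ⟨h, rfl⟩) hact)
    · refine absurd (hweak J (t⁻¹ • x) fun i j => ?_) hJ
      have h1 := mul_le_mul_of_nonneg_left (hact i j) (inv_nonneg.2 ht.le)
      rw [featureValue_eq, featureValue_eq, map_smul, map_smul, smul_eq_mul, smul_eq_mul]
      rwa [mul_add, mul_add, inv_mul_cancel_left₀ ht.ne', inv_mul_cancel_left₀ ht.ne'] at h1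
  · -- strictly active patterns and sign patterns of the hyperplanes correspond
    rw [← ncard_transversals d k]
    have hflat := card_signPatterns_eq_card_flats v c hsimple Finset.univ ∅
      (Finset.disjoint_empty_left _)
    have hT : {T : Finset (Σ i : Fin b, Fin (k i - 1)) |
        T ⊆ Finset.univ ∧ ∃ x, ∀ t ∈ ∅ ∪ T, v t x = c t} =
        {T : Finset (Σ i : Fin b, Fin (k i - 1)) |
          Set.InjOn Sigma.fst (T : Set (Σ i : Fin b, Fin (k i - 1))) ∧ T.card ≤ d} := by
      ext T
      constructor
      · rintro ⟨-, x, hx⟩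
        rw [Finset.empty_union] at hx
        exact ⟨hinj T ⟨x, hx⟩, hgen T (hinj T ⟨x, hx⟩) ⟨x, hx⟩⟩
      · rintro ⟨h1, h2⟩
        refine ⟨Finset.subset_univ _, ?_⟩
        rw [Finset.empty_union]
        exact hsolve T h1 h2 c
    rw [← hT, ← hflat]
    set Φ : (∀ i, Fin (k i)) → Finset (Σ i : Fin b, Fin (k i - 1)) :=
      fun J => Finset.univ.filter fun t => (t.2 : ℕ) < J t.1 with hΦ
    have hΦinj : Function.Injective Φ := by
      have key : ∀ (J J' : ∀ i, Fin (k i)), Φ J = Φ J' → ∀ i, (J i : ℕ) ≤ J' i := by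
        intro J J' h i
        by_contra hlt
        push Not at hlt
        have hmem : (⟨i, ⟨J' i, by omega⟩⟩ : Σ i : Fin b, Fin (k i - 1)) ∈ Φ J := by
          simpa [hΦ] using hlt
        rw [h] at hmem
        simp [hΦ] at hmem
      intro J J' h
      funext i
      exact Fin.ext (le_antisymm (key J J' h i) (key J' J h.symm i))
    rw [← Set.ncard_image_of_injective _ hΦinj]
    congr 1
    ext P
    constructor
    · rintro ⟨J, ⟨y, hy⟩, rfl⟩
      refine ⟨Finset.subset_univ _, y, by simp, fun t _ => ?_⟩
      have h1 := (isStrictlyActive_parallelLayer_iff hε).1 hy t.1 t.2 (by omega)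
      refine ⟨fun ht => h1.1 (by simpa [hΦ] using ht), fun ht => h1.2 (by simpa [hΦ] using ht)⟩
    · rintro ⟨-, x, -, hx⟩
      obtain ⟨J, hJ⟩ := exists_isWeaklyActive (parallelLayer d k ε) x
      refine ⟨J, hweak J x hJ, ?_⟩
      rw [isWeaklyActive_parallelLayer_iff hε] at hJ
      ext t
      have h1 := hJ t.1 t.2 (by omega)
      have h2 := hx t (Finset.mem_univ t)
      simp only [hvapp, hc] at h2
      by_cases ht : (t.2 : ℕ) < J t.1
      · have : t ∈ P := by
          by_contra hP
          exact absurd (h2.2 hP) (not_lt.2 (h1.1 ht))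
        simpa [hΦ, this] using ht
      · have : t ∉ P := fun hP => absurd (h2.1 hP) (not_lt.2 (h1.2 (not_lt.1 ht)))
        simpa [hΦ, this] using ht

end Parallel

/-! ### Stability of the patterns, and dominated features -/

section Stability

variable {d b : ℕ}

theorem continuous_homogFeature {Θ : Type*} [TopologicalSpace Θ] {p : Θ → (Fin d → ℝ) × ℝ}
    {x : Θ → Fin d → ℝ} {t : Θ → ℝ} (hp : Continuous p) (hx : Continuous x) (ht : Continuous t) :
    Continuous fun θ => featureGrad (p θ).1 (x θ) + t θ * (p θ).2 := by
  simp only [featureGrad_apply]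
  fun_prop

/-- The patterns of a layer with stable patterns do not change under small changes of the
parameters, since the homogenized inputs can be taken from a compact half-sphere. -/
theorem HasStablePatterns.eventually {κ : Fin b → Type} [∀ i, Finite (κ i)]
    {θ₀ : ∀ i, κ i → (Fin d → ℝ) × ℝ} {N : ℕ} (h : HasStablePatterns θ₀ N) :
    ∀ᶠ θ in nhds θ₀, HasStablePatterns θ N := by
  have hfeas : ∀ J, (∃ y, IsStrictlyActive θ₀ J y) →
      ∀ᶠ θ in nhds θ₀, ∃ y, IsStrictlyActive θ J y := by
    rintro J ⟨y, hy⟩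
    have hopen : IsOpen {θ : ∀ i, κ i → (Fin d → ℝ) × ℝ | IsStrictlyActive θ J y} := by
      simp only [IsStrictlyActive, Set.ofPred_forall]
      refine isOpen_iInter_of_finite fun i => isOpen_iInter_of_finite fun j =>
        isOpen_iInter_of_finite fun _ => isOpen_lt ?_ ?_ <;>
      · unfold featureValue
        fun_prop
    filter_upwards [hopen.mem_nhds hy] with θ hθ
    exact ⟨y, hθ⟩
  have hinfeas : ∀ J, (∀ x t, 0 ≤ t → IsHomogActive θ₀ J x t → x = 0 ∧ t = 0) →
      ∀ᶠ θ in nhds θ₀, ∀ x t, 0 ≤ t → IsHomogActive θ J x t → x = 0 ∧ t = 0 := by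
    intro J hJ
    set S : Set ((Fin d → ℝ) × ℝ) := Metric.sphere 0 1 ∩ {p | 0 ≤ p.2} with hS
    have hScomp : IsCompact S :=
      (isCompact_sphere 0 1).inter_right (isClosed_le continuous_const continuous_snd)
    have hclosed : IsClosed {q : (∀ i, κ i → (Fin d → ℝ) × ℝ) × ((Fin d → ℝ) × ℝ) |
        IsHomogActive q.1 J q.2.1 q.2.2} := by
      simp only [IsHomogActive, Set.ofPred_forall]
      refine isClosed_iInter fun i => isClosed_iInter fun j => isClosed_le ?_ ?_ <;>
      · exact continuous_homogFeature (by fun_prop) (by fun_prop) (by fun_prop)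
    have hev : ∀ᶠ θ in nhds θ₀, ∀ p ∈ S, ¬ IsHomogActive θ J p.1 p.2 := by
      refine hScomp.eventually_forall_of_forall_eventually fun p hp => ?_
      refine hclosed.isOpen_compl.mem_nhds (x := (θ₀, p)) fun hact => ?_
      obtain ⟨h1, h2⟩ := hJ p.1 p.2 hp.2 hact
      have : p = 0 := Prod.ext h1 h2
      have hp1 := hp.1
      rw [this] at hp1
      simp at hp1
    filter_upwards [hev] with θ hθ x t ht hact
    by_contra hne
    have hp0 : ((x, t) : (Fin d → ℝ) × ℝ) ≠ 0 := fun h0 =>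
      hne ⟨congrArg Prod.fst h0, congrArg Prod.snd h0⟩
    have hr : 0 < ‖((x, t) : (Fin d → ℝ) × ℝ)‖⁻¹ := inv_pos.2 (norm_pos_iff.2 hp0)
    refine hθ (‖((x, t) : (Fin d → ℝ) × ℝ)‖⁻¹ • (x, t)) ⟨?_, ?_⟩ fun i j => ?_
    · rw [mem_sphere_zero_iff_norm, norm_smul, norm_inv, norm_norm,
        inv_mul_cancel₀ (norm_ne_zero_iff.2 hp0)]
    · exact mul_nonneg hr.le ht
    · have h1 := mul_le_mul_of_nonneg_left (hact i j) hr.le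
      simp only [Prod.smul_fst, Prod.smul_snd, map_smul, smul_eq_mul]
      linarith
  have hall : ∀ J, ∀ᶠ θ in nhds θ₀,
      ((∃ y, IsStrictlyActive θ₀ J y) ∧ ∃ y, IsStrictlyActive θ J y) ∨
      ((¬ ∃ y, IsStrictlyActive θ₀ J y) ∧
        ∀ x t, 0 ≤ t → IsHomogActive θ J x t → x = 0 ∧ t = 0) := by
    intro J
    by_cases hJ : ∃ y, IsStrictlyActive θ₀ J y
    · filter_upwards [hfeas J hJ] with θ hθ
      exact Or.inl ⟨hJ, hθ⟩
    · filter_upwards [hinfeas J ((h.1 J).resolve_left hJ)] with θ hθ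
      exact Or.inr ⟨hJ, hθ⟩
  filter_upwards [Filter.eventually_all.2 hall] with θ hθ
  refine ⟨fun J => ?_, ?_⟩
  · rcases hθ J with h1 | h1
    · exact Or.inl h1.2
    · exact Or.inr h1.2
  · rw [← h.2]
    congr 1
    ext J
    rcases hθ J with h1 | h1
    · exact iff_of_true h1.2 h1.1
    · refine iff_of_false ?_ h1.1
      rintro ⟨y, hy⟩
      exact one_ne_zero (h1.2 y 1 zero_le_one (isHomogActive_one_iff.2 hy.isWeaklyActive)).2

/-- No nonzero direction has the same slope along all the features: the weights affinely span the
whole space. -/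
def HasSpanningWeights {κ : Type} (θ : κ → (Fin d → ℝ) × ℝ) : Prop :=
  ∀ x, (∀ j j', featureGrad (θ j).1 x = featureGrad (θ j').1 x) → x = 0

/-- The layer of parallel features can be perturbed, within the layers with stable patterns, so
that each unit with more than `d` features has spanning weights. -/
theorem exists_hasStablePatterns_spanning {k : Fin b → ℕ} (hd : 1 ≤ d) (hk : ∀ i, 1 ≤ k i) :
    ∃ θ : ∀ i, Fin (k i) → (Fin d → ℝ) × ℝ, HasStablePatterns θ (shallowCount d k) ∧
      ∀ i, d + 1 ≤ k i → HasSpanningWeights (θ i) := by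
  obtain ⟨ε, hε, hstab⟩ := exists_hasStablePatterns_parallelLayer hd hk
  -- the weight of feature `m + 1` is moved in the direction of the `m`-th axis
  set shift : ℕ → Fin d → ℝ := fun j m => if j = m + 1 then 1 else 0 with hshift
  set θ : ℝ → ∀ i, Fin (k i) → (Fin d → ℝ) × ℝ := fun s i j =>
    parallelLayer d k ε i j + (s • shift j, 0) with hθ
  have hcont : Continuous θ := by
    rw [hθ]
    fun_prop
  have hθ0 : θ 0 = parallelLayer d k ε := by
    funext i j
    ext <;> simp [hθ]
  have hlim : Filter.Tendsto θ (nhdsWithin 0 (Set.Ioi 0)) (nhds (parallelLayer d k ε)) := by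
    rw [← hθ0]
    exact (hcont.tendsto 0).mono_left nhdsWithin_le_nhds
  obtain ⟨s, hs, hs0⟩ := ((hlim.eventually hstab.eventually).and self_mem_nhdsWithin).exists
  have hs0 : 0 < s := hs0
  refine ⟨θ s, hs, fun i hi x hx => ?_⟩
  have hgrad : ∀ j : Fin (k i), featureGrad (θ s i j).1 x =
      (j : ℕ) * featureGrad (momentVec d i) x + s * featureGrad (shift j) x := by
    intro j
    simp only [hθ, parallelLayer, Prod.fst_add, featureGrad_add, featureGrad_smul]
  set β := featureGrad (momentVec d i) x with hβ
  have hxm : ∀ m : Fin d, s * x m = -(((m : ℕ) + 1) * β) := by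
    intro m
    have h1 := hx ⟨m + 1, by omega⟩ ⟨0, by omega⟩
    rw [hgrad, hgrad] at h1
    have h2 : featureGrad (shift (m + 1)) x = x m := by
      simp [hshift, featureGrad_apply, Fin.val_inj]
    have h3 : featureGrad (shift 0) x = 0 := by
      simp [hshift, featureGrad_apply]
    simp only [h2, h3] at h1
    push_cast at h1
    linarith
  have hsum : s * β = -(β * ∑ m : Fin d, momentVec d i m * ((m : ℕ) + 1)) := by
    conv_lhs => rw [hβ, featureGrad_apply]
    rw [Finset.mul_sum, Finset.mul_sum, ← Finset.sum_neg_distrib]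
    refine Finset.sum_congr rfl fun m _ => ?_
    rw [mul_left_comm, hxm]
    ring
  have hpos : 0 ≤ ∑ m : Fin d, momentVec d i m * (((m : ℕ) : ℝ) + 1) := by
    refine Finset.sum_nonneg fun m _ => mul_nonneg (pow_nonneg ?_ _) (by positivity)
    unfold momentNode
    positivity
  have hβ0 : β = 0 := by
    have h1 : β * (s + ∑ m : Fin d, momentVec d i m * (((m : ℕ) : ℝ) + 1)) = 0 := by linarith
    exact (mul_eq_zero.1 h1).resolve_right (by positivity)
  funext m
  have := hxm m
  rw [hβ0, mul_zero, neg_zero] at this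
  exact (mul_eq_zero.1 this).resolve_left hs0.ne'

/-- Extension of units with `k i` features to units of rank `K`: the additional features are one
less than the average of the given ones, so that they are nowhere maximal. -/
noncomputable def extendLayer {k : Fin b → ℕ} (K : ℕ) (θ : ∀ i, Fin (k i) → (Fin d → ℝ) × ℝ) :
    LayerParams d b K := fun i j =>
  if h : (j : ℕ) < k i then θ i ⟨j, h⟩ else (k i : ℝ)⁻¹ • ∑ j, θ i j - (0, 1)

section Extend

variable {k : Fin b → ℕ} {K : ℕ} {θ : ∀ i, Fin (k i) → (Fin d → ℝ) × ℝ}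

theorem extendLayer_castLE (hK : ∀ i, k i ≤ K) (i : Fin b) (j : Fin (k i)) :
    extendLayer K θ i (Fin.castLE (hK i) j) = θ i j := by
  simp [extendLayer]

theorem homogFeature_extendLayer_of_le {i : Fin b} {j : Fin K} (hj : k i ≤ j) (x : Fin d → ℝ)
    (t : ℝ) : featureGrad (extendLayer K θ i j).1 x + t * (extendLayer K θ i j).2 =
      (k i : ℝ)⁻¹ * ∑ j, (featureGrad (θ i j).1 x + t * (θ i j).2) - t := by
  have hsum : featureGrad (∑ j, θ i j).1 x = ∑ j, featureGrad (θ i j).1 x := by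
    simp only [featureGrad_apply, Prod.fst_sum, Finset.sum_apply, Finset.sum_mul]
    exact Finset.sum_comm
  rw [extendLayer, dif_neg (not_lt.2 hj)]
  simp only [Prod.fst_sub, Prod.smul_fst, sub_zero, Prod.snd_sub, Prod.smul_snd, smul_eq_mul,
    featureGrad_smul, hsum, Prod.snd_sum, Finset.sum_add_distrib, ← Finset.mul_sum]
  ring

/-- An additional feature is active only at infinity, and only in directions of equal slopes. -/
theorem IsHomogActive.of_extendLayer_of_le (hk : ∀ i, 1 ≤ k i) (hK : ∀ i, k i ≤ K)
    {J : Fin b → Fin K} {x : Fin d → ℝ} {t : ℝ} (h : IsHomogActive (extendLayer K θ) J x t)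
    (ht : 0 ≤ t) {i : Fin b} (hi : k i ≤ J i) :
    t = 0 ∧ ∀ j j', featureGrad (θ i j).1 x = featureGrad (θ i j').1 x := by
  have hkpos : (0 : ℝ) < k i := by exact_mod_cast hk i
  have h1 : ∀ j : Fin (k i), featureGrad (θ i j).1 x + t * (θ i j).2 ≤
      (k i : ℝ)⁻¹ * ∑ j, (featureGrad (θ i j).1 x + t * (θ i j).2) - t := by
    intro j
    have := h i (Fin.castLE (hK i) j)
    rwa [homogFeature_extendLayer_of_le hi, extendLayer_castLE hK] at this
  set A := ∑ j, (featureGrad (θ i j).1 x + t * (θ i j).2) with hA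
  have h2 : A ≤ k i * ((k i : ℝ)⁻¹ * A - t) := by
    have := Finset.sum_le_sum fun j (_ : j ∈ (Finset.univ : Finset (Fin (k i)))) => h1 j
    simpa [mul_sub] using this
  rw [mul_sub, mul_inv_cancel_left₀ hkpos.ne'] at h2
  have ht0 : t = 0 := by
    refine le_antisymm ?_ ht
    have : (k i : ℝ) * t ≤ 0 := by linarith
    exact nonpos_of_mul_nonpos_right this hkpos
  refine ⟨ht0, ?_⟩
  subst ht0
  have h3 : ∀ j ∈ (Finset.univ : Finset (Fin (k i))),
      featureGrad (θ i j).1 x + 0 * (θ i j).2 = (k i : ℝ)⁻¹ * A := by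
    refine (Finset.sum_eq_sum_iff_of_le fun j _ => (h1 j).trans_eq (sub_zero _)).1 ?_
    rw [← hA, Finset.sum_const, Finset.card_univ, Fintype.card_fin, nsmul_eq_mul,
      mul_inv_cancel_left₀ hkpos.ne']
  intro j j'
  have := (h3 j (Finset.mem_univ _)).trans (h3 j' (Finset.mem_univ _)).symm
  simpa using this

theorem IsHomogActive.of_extendLayer_castLE (hK : ∀ i, k i ≤ K) {J : ∀ i, Fin (k i)}
    {x : Fin d → ℝ} {t : ℝ}
    (h : IsHomogActive (extendLayer K θ) (fun i => Fin.castLE (hK i) (J i)) x t) :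
    IsHomogActive θ J x t := by
  intro i j
  have := h i (Fin.castLE (hK i) j)
  rwa [extendLayer_castLE hK, extendLayer_castLE hK] at this

theorem isStrictlyActive_extendLayer_castLE_iff (hk : ∀ i, 1 ≤ k i) (hK : ∀ i, k i ≤ K)
    {J : ∀ i, Fin (k i)} {x : Fin d → ℝ} :
    IsStrictlyActive (extendLayer K θ) (fun i => Fin.castLE (hK i) (J i)) x ↔
      IsStrictlyActive θ J x := by
  constructor
  · intro h i j hj
    have := h i (Fin.castLE (hK i) j) fun heq => hj (Fin.castLE_injective (hK i) heq)
    rwa [extendLayer_castLE hK, extendLayer_castLE hK] at this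
  · intro h i j hj
    by_cases hjk : (j : ℕ) < k i
    · obtain ⟨j, rfl⟩ : ∃ j' : Fin (k i), j = Fin.castLE (hK i) j' := ⟨⟨j, hjk⟩, rfl⟩
      rw [extendLayer_castLE hK, extendLayer_castLE hK]
      exact h i j fun heq => hj (congrArg _ heq)
    · have hkpos : (0 : ℝ) < k i := by exact_mod_cast hk i
      have h1 := homogFeature_extendLayer_of_le (θ := θ) (K := K) (j := j) (not_lt.1 hjk) x 1
      rw [one_mul, ← featureValue_eq] at h1
      rw [extendLayer_castLE hK, h1]
      have h2 : ∑ j, (featureGrad (θ i j).1 x + 1 * (θ i j).2) ≤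
          k i * featureValue (θ i (J i)) x := by
        have := Finset.sum_le_sum fun j (_ : j ∈ (Finset.univ : Finset (Fin (k i)))) =>
          h.isWeaklyActive i j
        simpa [featureValue_eq, mul_add] using this
      have h3 := mul_le_mul_of_nonneg_left h2 (inv_nonneg.2 hkpos.le)
      rw [inv_mul_cancel_left₀ hkpos.ne'] at h3
      linarith

theorem exists_castLE_eq (hK : ∀ i, k i ≤ K) {J : Fin b → Fin K} (hJ : ∀ i, (J i : ℕ) < k i) :
    ∃ J' : ∀ i, Fin (k i), J = fun i => Fin.castLE (hK i) (J' i) :=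
  ⟨fun i => ⟨J i, hJ i⟩, rfl⟩

theorem lt_of_isWeaklyActive_extendLayer (hk : ∀ i, 1 ≤ k i) (hK : ∀ i, k i ≤ K)
    {J : Fin b → Fin K} {x : Fin d → ℝ} (h : IsWeaklyActive (extendLayer K θ) J x) (i : Fin b) :
    (J i : ℕ) < k i := by
  by_contra hi
  exact one_ne_zero ((isHomogActive_one_iff.2 h).of_extendLayer_of_le hk hK zero_le_one
    (not_lt.1 hi)).1

theorem ncard_strictlyActive_extendLayer (hk : ∀ i, 1 ≤ k i) (hK : ∀ i, k i ≤ K) :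
    {J | ∃ y, IsStrictlyActive (extendLayer K θ) J y}.ncard =
      {J | ∃ y, IsStrictlyActive θ J y}.ncard := by
  have hinj : Function.Injective
      fun (J : ∀ i, Fin (k i)) (i : Fin b) => Fin.castLE (hK i) (J i) := by
    intro J J' h
    funext i
    exact Fin.castLE_injective (hK i) (congrFun h i)
  rw [← Set.ncard_image_of_injective _ hinj]
  congr 1
  ext J
  constructor
  · rintro ⟨y, hy⟩
    obtain ⟨J', rfl⟩ := exists_castLE_eq hK
      (lt_of_isWeaklyActive_extendLayer hk hK hy.isWeaklyActive)
    exact ⟨J', ⟨y, (isStrictlyActive_extendLayer_castLE_iff hk hK).1 hy⟩, rfl⟩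
  · rintro ⟨J', ⟨y, hy⟩, rfl⟩
    exact ⟨y, (isStrictlyActive_extendLayer_castLE_iff hk hK).2 hy⟩

theorem HasGenericPatterns.extendLayer (hk : ∀ i, 1 ≤ k i) (hK : ∀ i, k i ≤ K) {N : ℕ}
    (h : HasGenericPatterns θ N) : HasGenericPatterns (extendLayer K θ) N := by
  refine ⟨fun J x hJ => ?_, (ncard_strictlyActive_extendLayer hk hK).trans h.2⟩
  obtain ⟨J', rfl⟩ := exists_castLE_eq hK (lt_of_isWeaklyActive_extendLayer hk hK hJ)
  obtain ⟨y, hy⟩ := h.1 J' x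
    (isHomogActive_one_iff.1 (isHomogActive_one_iff.2 hJ).of_extendLayer_castLE)
  exact ⟨y, (isStrictlyActive_extendLayer_castLE_iff hk hK).2 hy⟩

theorem HasStablePatterns.extendLayer (hk : ∀ i, 1 ≤ k i) (hK : ∀ i, k i ≤ K) {N : ℕ}
    (h : HasStablePatterns θ N) (hspan : ∀ i, k i < K → HasSpanningWeights (θ i)) :
    HasStablePatterns (extendLayer K θ) N := by
  refine ⟨fun J => ?_, (ncard_strictlyActive_extendLayer hk hK).trans h.2⟩
  by_cases hJ : ∀ i, (J i : ℕ) < k i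
  · obtain ⟨J', rfl⟩ := exists_castLE_eq hK hJ
    refine (h.1 J').imp ?_ fun h' x t ht hact => h' x t ht hact.of_extendLayer_castLE
    rintro ⟨y, hy⟩
    exact ⟨y, (isStrictlyActive_extendLayer_castLE_iff hk hK).2 hy⟩
  · push Not at hJ
    obtain ⟨i, hi⟩ := hJ
    refine Or.inr fun x t ht hact => ?_
    obtain ⟨h1, h2⟩ := hact.of_extendLayer_of_le hk hK ht hi
    exact ⟨hspan i (hi.trans_lt (J i).2) x h2, h1⟩

end Extend

/-- There are layers with generic patterns whose units have any given numbers of effective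
features. -/
theorem exists_hasGenericPatterns {k : Fin b → ℕ} {K : ℕ} (hd : 1 ≤ d)
    (hk : ∀ i, 1 ≤ k i ∧ k i ≤ K) :
    ∃ θ : LayerParams d b K, HasGenericPatterns θ (shallowCount d k) := by
  obtain ⟨θ, hθ, -⟩ := exists_hasStablePatterns_spanning hd fun i => (hk i).1
  exact ⟨_, hθ.hasGenericPatterns.extendLayer (fun i => (hk i).1) fun i => (hk i).2⟩

/-- If the numbers of effective features are large enough, then all the layers near some layer
have generic patterns. -/
theorem exists_eventually_hasGenericPatterns {k : Fin b → ℕ} {K : ℕ} (hd : 1 ≤ d)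
    (hk : ∀ i, 1 ≤ k i ∧ k i ≤ K) (hmin : ∀ i, min K (d + 1) ≤ k i) :
    ∃ θ₀ : LayerParams d b K, ∀ᶠ θ in nhds θ₀, HasGenericPatterns θ (shallowCount d k) := by
  obtain ⟨θ, hθ, hspan⟩ := exists_hasStablePatterns_spanning hd fun i => (hk i).1
  have h := hθ.extendLayer (K := K) (fun i => (hk i).1) (fun i => (hk i).2) fun i hi =>
    hspan i (by have := hmin i; omega)
  exact ⟨_, h.eventually.mono fun θ h => h.hasGenericPatterns⟩

end Stability

/-! ### Activation patterns of deep networks -/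

section Deep

variable {n : ℕ → ℕ} {K : ℕ}

/-- A choice of one feature for each unit of each of `L` layers. -/
abbrev DeepPattern (n : ℕ → ℕ) (K L : ℕ) : Type := ∀ l : Fin L, Fin (n (l + 1)) → Fin K

/-- The pattern `J` attains the maxima at all units of all layers for the network input `x`. -/
def IsDeepWeaklyActive (n : ℕ → ℕ) (K : ℕ) :
    (L : ℕ) → HiddenParams n K L → DeepPattern n K L → (Fin (n 0) → ℝ) → Prop
  | 0, _, _, _ => True
  | L + 1, θ, J, x =>
      IsDeepWeaklyActive n K L (fun l => θ l.castSucc) (fun l => J l.castSucc) x ∧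
        IsWeaklyActive (θ (Fin.last L)) (J (Fin.last L))
          (hiddenMap n K L (fun l => θ l.castSucc) x)

/-- The pattern `J` is the only one that attains the maxima at all units of all layers for the
network input `x`. -/
def IsDeepStrictlyActive (n : ℕ → ℕ) (K : ℕ) :
    (L : ℕ) → HiddenParams n K L → DeepPattern n K L → (Fin (n 0) → ℝ) → Prop
  | 0, _, _, _ => True
  | L + 1, θ, J, x =>
      IsDeepStrictlyActive n K L (fun l => θ l.castSucc) (fun l => J l.castSucc) x ∧
        IsStrictlyActive (θ (Fin.last L)) (J (Fin.last L))
          (hiddenMap n K L (fun l => θ l.castSucc) x)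

/-- Two patterns are adjacent if they differ at exactly one unit. -/
def IsAdjacent (n : ℕ → ℕ) (K : ℕ) : (L : ℕ) → DeepPattern n K L → DeepPattern n K L → Prop
  | 0, _, _ => False
  | L + 1, J, J' =>
      (IsAdjacent n K L (fun l => J l.castSucc) (fun l => J' l.castSucc) ∧
        J (Fin.last L) = J' (Fin.last L)) ∨
      ((fun l : Fin L => J l.castSucc) = (fun l : Fin L => J' l.castSucc) ∧
        ∃ i, J (Fin.last L) i ≠ J' (Fin.last L) i ∧
          ∀ i', i' ≠ i → J (Fin.last L) i' = J' (Fin.last L) i')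

/-- The gradient of the hidden layers on the cell of the pattern `J`. -/
noncomputable def deepGrad (n : ℕ → ℕ) (K : ℕ) : (L : ℕ) → HiddenParams n K L →
    DeepPattern n K L → (Fin (n 0) → ℝ) →L[ℝ] (Fin (n L) → ℝ)
  | 0, _, _ => ContinuousLinearMap.id ℝ _
  | L + 1, θ, J =>
      layerGrad (θ (Fin.last L)) (J (Fin.last L)) ∘L
        deepGrad n K L (fun l => θ l.castSucc) (fun l => J l.castSucc)

/-- The linear part of the output layer. -/
noncomputable def outputGrad {a m : ℕ} (ψ : OutputParams a m) : (Fin a → ℝ) →L[ℝ] (Fin m → ℝ) :=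
  ContinuousLinearMap.pi fun o => featureGrad (ψ o).1

theorem outputLayer_eq {a m : ℕ} (ψ : OutputParams a m) (x : Fin a → ℝ) :
    outputLayer ψ x = outputGrad ψ x + fun o => (ψ o).2 :=
  funext fun o => featureValue_eq (ψ o) x

/-- A pattern of `L + 1` layers, from one of `L` layers and one of the last layer. -/
def snocPattern {L : ℕ} (J : DeepPattern n K L) (J' : Fin (n (L + 1)) → Fin K) :
    DeepPattern n K (L + 1) :=
  Fin.snoc (α := fun l : Fin (L + 1) => Fin (n (l + 1)) → Fin K) J J'

theorem snocPattern_castSucc {L : ℕ} (J : DeepPattern n K L) (J' : Fin (n (L + 1)) → Fin K)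
    (l : Fin L) : snocPattern J J' l.castSucc = J l :=
  Fin.snoc_castSucc (α := fun l : Fin (L + 1) => Fin (n (l + 1)) → Fin K) J' J l

theorem snocPattern_last {L : ℕ} (J : DeepPattern n K L) (J' : Fin (n (L + 1)) → Fin K) :
    snocPattern J J' (Fin.last L) = J' :=
  Fin.snoc_last (α := fun l : Fin (L + 1) => Fin (n (l + 1)) → Fin K) J' J

theorem deepPattern_ext {L : ℕ} {J J' : DeepPattern n K (L + 1)}
    (h : (fun l : Fin L => J l.castSucc) = fun l : Fin L => J' l.castSucc)
    (hlast : J (Fin.last L) = J' (Fin.last L)) : J = J' := by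
  funext l
  refine Fin.lastCases ?_ (fun l => ?_) l
  · exact hlast
  · exact congrFun h l

theorem IsDeepStrictlyActive.isDeepWeaklyActive {L : ℕ} {θ : HiddenParams n K L}
    {J : DeepPattern n K L} {x : Fin (n 0) → ℝ} (h : IsDeepStrictlyActive n K L θ J x) :
    IsDeepWeaklyActive n K L θ J x := by
  induction L with
  | zero => trivial
  | succ L ih => exact ⟨ih h.1, h.2.isWeaklyActive⟩

theorem IsDeepStrictlyActive.eq_of_isDeepWeaklyActive {L : ℕ} {θ : HiddenParams n K L}
    {J J' : DeepPattern n K L} {x : Fin (n 0) → ℝ} (h : IsDeepStrictlyActive n K L θ J x)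
    (h' : IsDeepWeaklyActive n K L θ J' x) : J' = J := by
  induction L with
  | zero => exact funext fun l => l.elim0
  | succ L ih => exact deepPattern_ext (ih h.1 h'.1) (h.2.eq_of_isWeaklyActive h'.2)

theorem exists_isDeepWeaklyActive (hK : 1 ≤ K) {L : ℕ} (θ : HiddenParams n K L)
    (x : Fin (n 0) → ℝ) : ∃ J, IsDeepWeaklyActive n K L θ J x := by
  have : Nonempty (Fin K) := ⟨⟨0, hK⟩⟩
  induction L with
  | zero => exact ⟨fun l => l.elim0, trivial⟩
  | succ L ih =>
    obtain ⟨J, hJ⟩ := ih fun l => θ l.castSucc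
    obtain ⟨J', hJ'⟩ := exists_isWeaklyActive (θ (Fin.last L))
      (hiddenMap n K L (fun l => θ l.castSucc) x)
    refine ⟨snocPattern J J', ?_, ?_⟩
    · simpa only [snocPattern_castSucc] using hJ
    · simpa only [snocPattern_last] using hJ'

/-- At an input where a weakly active pattern is not strictly active, an adjacent pattern is also
weakly active. -/
theorem IsDeepWeaklyActive.exists_isAdjacent {L : ℕ} {θ : HiddenParams n K L}
    {J : DeepPattern n K L} {x : Fin (n 0) → ℝ} (h : IsDeepWeaklyActive n K L θ J x)
    (hs : ¬ IsDeepStrictlyActive n K L θ J x) :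
    ∃ J', IsDeepWeaklyActive n K L θ J' x ∧ IsAdjacent n K L J J' := by
  induction L with
  | zero => exact absurd trivial hs
  | succ L ih =>
    by_cases hs' : IsDeepStrictlyActive n K L (fun l => θ l.castSucc) (fun l => J l.castSucc) x
    · have hlast : ¬ IsStrictlyActive (θ (Fin.last L)) (J (Fin.last L))
          (hiddenMap n K L (fun l => θ l.castSucc) x) := fun hl => hs ⟨hs', hl⟩
      simp only [IsStrictlyActive, not_forall, not_lt] at hlast
      obtain ⟨i, j, hj, hle⟩ := hlast
      refine ⟨snocPattern (fun l => J l.castSucc) (Function.update (J (Fin.last L)) i j),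
        ⟨?_, ?_⟩, Or.inr ⟨?_, i, ?_, fun i' hi' => ?_⟩⟩
      · simpa only [snocPattern_castSucc] using h.1
      · simpa only [snocPattern_last] using h.2.update hle
      · simp only [snocPattern_castSucc]
      · rw [snocPattern_last, Function.update_self]
        exact hj.symm
      · rw [snocPattern_last, Function.update_of_ne hi']
    · obtain ⟨J', hJ', hadj⟩ := ih h.1 hs'
      refine ⟨snocPattern J' (J (Fin.last L)), ⟨?_, ?_⟩, Or.inl ⟨?_, ?_⟩⟩
      · simpa only [snocPattern_castSucc] using hJ'
      · simpa only [snocPattern_last] using h.2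
      · simpa only [snocPattern_castSucc] using hadj
      · rw [snocPattern_last]

/-- The hidden layers are affine on the segment from a point where `J` is weakly active to one
where it is strictly active. -/
theorem IsDeepWeaklyActive.lineMap {L : ℕ} {θ : HiddenParams n K L} {J : DeepPattern n K L}
    {x y : Fin (n 0) → ℝ} (hx : IsDeepWeaklyActive n K L θ J x)
    (hy : IsDeepStrictlyActive n K L θ J y) {s : ℝ} (hs0 : 0 < s) (hs1 : s ≤ 1) :
    IsDeepStrictlyActive n K L θ J (AffineMap.lineMap x y s) ∧
      hiddenMap n K L θ (AffineMap.lineMap x y s) =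
        AffineMap.lineMap (hiddenMap n K L θ x) (hiddenMap n K L θ y) s := by
  induction L with
  | zero => exact ⟨trivial, rfl⟩
  | succ L ih =>
    obtain ⟨h1, h2⟩ := ih hx.1 hy.1
    refine ⟨⟨h1, ?_⟩, ?_⟩
    · rw [h2]
      exact hx.2.isStrictlyActive_lineMap hy.2 hs0 hs1
    · change maxoutLayer _ (hiddenMap n K L (fun l => θ l.castSucc) _) = _
      rw [h2]
      exact hx.2.maxoutLayer_lineMap hy.2 hs0 hs1

theorem IsDeepStrictlyActive.hasFDerivAt_hiddenMap {L : ℕ} {θ : HiddenParams n K L}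
    {J : DeepPattern n K L} {x : Fin (n 0) → ℝ} (h : IsDeepStrictlyActive n K L θ J x) :
    HasFDerivAt (hiddenMap n K L θ) (deepGrad n K L θ J) x := by
  induction L with
  | zero => exact hasFDerivAt_id x
  | succ L ih => exact h.2.hasFDerivAt_maxoutLayer.comp x (ih h.1)

theorem continuous_maxoutUnit {a : ℕ} (hK : 1 ≤ K) {Θ : Type*} [TopologicalSpace Θ]
    {θ : Θ → UnitParams a K} {x : Θ → Fin a → ℝ} (hθ : Continuous θ) (hx : Continuous x) :
    Continuous fun p => maxoutUnit (θ p) (x p) := by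
  have : Nonempty (Fin K) := ⟨⟨0, hK⟩⟩
  have h : (fun p => maxoutUnit (θ p) (x p)) = fun p =>
      Finset.univ.sup' Finset.univ_nonempty fun j => featureValue (θ p j) (x p) :=
    funext fun p => (Finset.sup'_univ_eq_ciSup _).symm
  rw [h]
  refine Continuous.finset_sup'_apply _ fun j _ => ?_
  unfold featureValue
  fun_prop

theorem continuous_hiddenMap (hK : 1 ≤ K) (L : ℕ) :
    Continuous fun p : HiddenParams n K L × (Fin (n 0) → ℝ) => hiddenMap n K L p.1 p.2 := by
  induction L with
  | zero => exact continuous_snd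
  | succ L ih =>
    refine continuous_pi fun i => continuous_maxoutUnit hK (by fun_prop) ?_
    exact ih.comp (by fun_prop :
      Continuous fun p : HiddenParams n K (L + 1) × (Fin (n 0) → ℝ) =>
        ((fun l : Fin L => p.1 l.castSucc : HiddenParams n K L), p.2))

theorem isClosed_setOf_isDeepWeaklyActive (hK : 1 ≤ K) {L : ℕ} (J : DeepPattern n K L) :
    IsClosed {p : HiddenParams n K L × (Fin (n 0) → ℝ) |
      IsDeepWeaklyActive n K L p.1 J p.2} := by
  induction L with
  | zero => exact isClosed_const
  | succ L ih =>
    have hinit : Continuous fun p : HiddenParams n K (L + 1) × (Fin (n 0) → ℝ) =>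
        ((fun l : Fin L => p.1 l.castSucc : HiddenParams n K L), p.2) := by fun_prop
    refine ((ih fun l => J l.castSucc).preimage hinit).and ?_
    have hmap := (continuous_hiddenMap (n := n) hK L).comp hinit
    simp only [IsWeaklyActive, Set.ofPred_forall]
    refine isClosed_iInter fun i => isClosed_iInter fun j => isClosed_le ?_ ?_ <;>
    · exact continuous_featureValue.comp (Continuous.prodMk (by fun_prop) hmap)

theorem isOpen_setOf_isDeepStrictlyActive (hK : 1 ≤ K) {L : ℕ} (J : DeepPattern n K L) :
    IsOpen {p : HiddenParams n K L × (Fin (n 0) → ℝ) |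
      IsDeepStrictlyActive n K L p.1 J p.2} := by
  induction L with
  | zero => exact isOpen_const
  | succ L ih =>
    have hinit : Continuous fun p : HiddenParams n K (L + 1) × (Fin (n 0) → ℝ) =>
        ((fun l : Fin L => p.1 l.castSucc : HiddenParams n K L), p.2) := by fun_prop
    refine ((ih fun l => J l.castSucc).preimage hinit).and ?_
    have hmap := (continuous_hiddenMap (n := n) hK L).comp hinit
    simp only [IsStrictlyActive, Set.ofPred_forall]
    refine isOpen_iInter_of_finite fun i => isOpen_iInter_of_finite fun j =>
      isOpen_iInter_of_finite fun _ => isOpen_lt ?_ ?_ <;>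
    · exact continuous_featureValue.comp (Continuous.prodMk (by fun_prop) hmap)

theorem continuous_deepGrad_apply {L : ℕ} (J : DeepPattern n K L) (v : Fin (n 0) → ℝ) :
    Continuous fun θ : HiddenParams n K L => deepGrad n K L θ J v := by
  induction L with
  | zero => exact continuous_const
  | succ L ih =>
    have hinit : Continuous fun θ : HiddenParams n K (L + 1) =>
        (fun l : Fin L => θ l.castSucc : HiddenParams n K L) := by fun_prop
    have hprev := (ih fun l => J l.castSucc).comp hinit
    refine continuous_pi fun i => ?_
    change Continuous fun θ : HiddenParams n K (L + 1) =>
      featureGrad (θ (Fin.last L) i (J (Fin.last L) i)).1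
        (deepGrad n K L (fun l => θ l.castSucc) (fun l => J l.castSucc) v)
    simp only [featureGrad_apply]
    refine continuous_finsetSum _ fun j _ => Continuous.mul (by fun_prop) ?_
    exact (continuous_apply j).comp hprev

/-- The number of linear regions of a deep network over a convex set `D` is the number of patterns
that are strictly active somewhere in `D`, if these are the only ones that are weakly active
somewhere in `D` and adjacent ones have different gradients. -/
theorem numLinearRegionsOn_deepNetwork (hK : 1 ≤ K) {L m : ℕ}
    {p : HiddenParams n K L × OutputParams (n L) m} {D : Set (Fin (n 0) → ℝ)} (hD : Convex ℝ D)
    (hfeas : ∀ J, ∀ x ∈ D, IsDeepWeaklyActive n K L p.1 J x →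
      ∃ y ∈ D, IsDeepStrictlyActive n K L p.1 J y)
    (hgrad : ∀ J J', IsAdjacent n K L J J' → (∃ y ∈ D, IsDeepStrictlyActive n K L p.1 J y) →
      (∃ y ∈ D, IsDeepStrictlyActive n K L p.1 J' y) →
      outputGrad p.2 ∘L deepGrad n K L p.1 J ≠ outputGrad p.2 ∘L deepGrad n K L p.1 J') :
    numLinearRegionsOn (deepNetwork p) D =
      ({J | ∃ y ∈ D, IsDeepStrictlyActive n K L p.1 J y}.ncard : ℕ∞) := by
  have hf : deepNetwork p = fun x => outputGrad p.2 (hiddenMap n K L p.1 x) + fun o => (p.2 o).2 :=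
    funext fun x => outputLayer_eq p.2 _
  rw [hf, numLinearRegionsOn_eq_ncard_cells hD
    (W := fun J => {x | IsDeepWeaklyActive n K L p.1 J x})
    (C := fun J => {x | IsDeepStrictlyActive n K L p.1 J x})
    (g := fun J => outputGrad p.2 ∘L deepGrad n K L p.1 J)]
  · rfl
  · exact fun J => (isOpen_setOf_isDeepStrictlyActive hK J).preimage
      (by fun_prop : Continuous fun x => (p.1, x))
  · exact fun J x hx => IsDeepStrictlyActive.isDeepWeaklyActive hx
  · intro J J' hJ
    refine Set.disjoint_left.2 fun x hx hx' => hJ ?_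
    exact IsDeepStrictlyActive.eq_of_isDeepWeaklyActive hx'
      (IsDeepStrictlyActive.isDeepWeaklyActive hx)
  · intro J x hx
    exact ((outputGrad p.2).hasFDerivAt.comp x
      (IsDeepStrictlyActive.hasFDerivAt_hiddenMap hx)).add_const _
  · intro J x hx y hy s hs0 hs1
    obtain ⟨h1, h2⟩ := IsDeepWeaklyActive.lineMap hx hy hs0 hs1
    refine ⟨h1, ?_⟩
    change outputGrad p.2 (hiddenMap n K L p.1 (AffineMap.lineMap x y s)) + (fun o => (p.2 o).2) =
      AffineMap.lineMap (outputGrad p.2 (hiddenMap n K L p.1 x) + fun o => (p.2 o).2)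
        (outputGrad p.2 (hiddenMap n K L p.1 y) + fun o => (p.2 o).2) s
    rw [h2, AffineMap.lineMap_apply_module, AffineMap.lineMap_apply_module, map_add, map_smul,
      map_smul]
    module
  · intro x hxD
    obtain ⟨J, hJ⟩ := exists_isDeepWeaklyActive hK p.1 x
    by_cases hs : IsDeepStrictlyActive n K L p.1 J x
    · exact Or.inl ⟨J, hs⟩
    obtain ⟨J', hJ', hadj⟩ := hJ.exists_isAdjacent hs
    obtain ⟨y, hyD, hy⟩ := hfeas J x hxD hJ
    obtain ⟨y', hyD', hy'⟩ := hfeas J' x hxD hJ'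
    exact Or.inr ⟨J, J', hJ, hJ', ⟨y, hy⟩, ⟨y', hy'⟩,
      hgrad J J' hadj ⟨y, hyD, hy⟩ ⟨y', hyD', hy'⟩⟩

/-- If all weakly active patterns are strictly active somewhere in the bounded convex set `D`, and
adjacent ones have different gradients, then the number of linear regions over `D` is constant
near the given parameters. -/
theorem eventually_numLinearRegionsOn_deepNetwork (hK : 1 ≤ K) {L m : ℕ}
    {p₀ : HiddenParams n K L × OutputParams (n L) m} {D : Set (Fin (n 0) → ℝ)}
    (hD : Convex ℝ D) (hDc : IsCompact (closure D))
    (hfeas : ∀ J x, IsDeepWeaklyActive n K L p₀.1 J x →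
      ∃ y ∈ D, IsDeepStrictlyActive n K L p₀.1 J y)
    (hgrad : ∀ J J', IsAdjacent n K L J J' → (∃ y ∈ D, IsDeepStrictlyActive n K L p₀.1 J y) →
      (∃ y ∈ D, IsDeepStrictlyActive n K L p₀.1 J' y) →
      outputGrad p₀.2 ∘L deepGrad n K L p₀.1 J ≠ outputGrad p₀.2 ∘L deepGrad n K L p₀.1 J') :
    ∀ᶠ p in nhds p₀, numLinearRegionsOn (deepNetwork p) D =
      ({J | ∃ y ∈ D, IsDeepStrictlyActive n K L p₀.1 J y}.ncard : ℕ∞) := by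
  have hpat : ∀ J, ∀ᶠ p in nhds p₀,
      ((∃ y ∈ D, IsDeepStrictlyActive n K L p₀.1 J y) ∧
        ∃ y ∈ D, IsDeepStrictlyActive n K L p.1 J y) ∨
      ((¬ ∃ y ∈ D, IsDeepStrictlyActive n K L p₀.1 J y) ∧
        ∀ x ∈ closure D, ¬ IsDeepWeaklyActive n K L p.1 J x) := by
    intro J
    by_cases hJ : ∃ y ∈ D, IsDeepStrictlyActive n K L p₀.1 J y
    · obtain ⟨y, hyD, hy⟩ := hJ
      have hopen := (isOpen_setOf_isDeepStrictlyActive (n := n) hK J).preimage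
        (by fun_prop : Continuous fun p : HiddenParams n K L × OutputParams (n L) m => (p.1, y))
      filter_upwards [hopen.mem_nhds hy] with p hp
      exact Or.inl ⟨⟨y, hyD, hy⟩, y, hyD, hp⟩
    · have hev : ∀ᶠ p in nhds p₀, ∀ x ∈ closure D, ¬ IsDeepWeaklyActive n K L p.1 J x := by
        refine hDc.eventually_forall_of_forall_eventually fun x _ => ?_
        have hclosed := (isClosed_setOf_isDeepWeaklyActive (n := n) hK J).preimage
          (by fun_prop : Continuous fun q : (HiddenParams n K L × OutputParams (n L) m) ×
            (Fin (n 0) → ℝ) => (q.1.1, q.2))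
        exact hclosed.isOpen_compl.mem_nhds (x := (p₀, x)) fun hw => hJ (hfeas J x hw)
      filter_upwards [hev] with p hp
      exact Or.inr ⟨hJ, hp⟩
  have hadj : ∀ J J', ∀ᶠ p in nhds p₀, IsAdjacent n K L J J' →
      (∃ y ∈ D, IsDeepStrictlyActive n K L p₀.1 J y) →
      (∃ y ∈ D, IsDeepStrictlyActive n K L p₀.1 J' y) →
      outputGrad p.2 ∘L deepGrad n K L p.1 J ≠ outputGrad p.2 ∘L deepGrad n K L p.1 J' := by
    intro J J'
    by_cases h : IsAdjacent n K L J J' ∧ (∃ y ∈ D, IsDeepStrictlyActive n K L p₀.1 J y) ∧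
      ∃ y ∈ D, IsDeepStrictlyActive n K L p₀.1 J' y
    · have hne := hgrad J J' h.1 h.2.1 h.2.2
      obtain ⟨v, hv⟩ : ∃ v, outputGrad p₀.2 (deepGrad n K L p₀.1 J v) ≠
          outputGrad p₀.2 (deepGrad n K L p₀.1 J' v) := by
        by_contra hcon
        push Not at hcon
        exact hne (ContinuousLinearMap.ext hcon)
      have hcont : ∀ J : DeepPattern n K L, Continuous
          fun p : HiddenParams n K L × OutputParams (n L) m =>
            outputGrad p.2 (deepGrad n K L p.1 J v) := by
        intro J
        have h1 := (continuous_deepGrad_apply J v).comp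
          (continuous_fst (X := HiddenParams n K L) (Y := OutputParams (n L) m))
        refine continuous_pi fun o => ?_
        change Continuous fun p : HiddenParams n K L × OutputParams (n L) m =>
          featureGrad (p.2 o).1 (deepGrad n K L p.1 J v)
        simp only [featureGrad_apply]
        refine continuous_finsetSum _ fun j _ => Continuous.mul (by fun_prop) ?_
        exact (continuous_apply j).comp h1
      filter_upwards [(isOpen_ne_fun (hcont J) (hcont J')).mem_nhds hv] with p hp _ _ _ heq
      exact hp (congrArg (fun g => g v) heq)
    · exact Filter.Eventually.of_forall fun p h1 h2 h3 => absurd ⟨h1, h2, h3⟩ h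
  filter_upwards [Filter.eventually_all.2 hpat,
    Filter.eventually_all.2 fun J => Filter.eventually_all.2 (hadj J)] with p hp hp'
  have hiff : ∀ J, (∃ y ∈ D, IsDeepStrictlyActive n K L p.1 J y) ↔
      ∃ y ∈ D, IsDeepStrictlyActive n K L p₀.1 J y := by
    intro J
    rcases hp J with h | h
    · exact iff_of_true h.2 h.1
    · refine iff_of_false ?_ h.1
      rintro ⟨y, hyD, hy⟩
      exact h.2 y (subset_closure hyD) hy.isDeepWeaklyActive
  rw [numLinearRegionsOn_deepNetwork hK hD]
  · simp only [hiff]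
  · intro J x hx hJ
    rcases hp J with h | h
    · exact h.2
    · exact absurd hJ (h.2 x (subset_closure hx))
  · intro J J' hJJ h h'
    exact hp' J J' hJJ ((hiff J).1 h) ((hiff J').1 h')

end Deep

/-! ### Zigzag functions -/

section Zigzag

/-- The number of thresholds `r + 1 + q * l`, `l = 0, 1, …`, that are at most `s`, for `r < q`. -/
def zigzagSlot (q s r : ℕ) : ℕ := (s + (q - 1 - r)) / q

theorem lt_zigzagSlot_iff {q s r l : ℕ} (hr : r < q) : l < zigzagSlot q s r ↔ r + q * l < s := by
  rw [zigzagSlot, ← Nat.succ_le_iff, Nat.le_div_iff_mul_le (by omega), Nat.succ_mul, mul_comm l q]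
  omega

/-- The thresholds of the `r`-th of `q` units that together have their breaks at
`1 / P, …, (P - 1) / P`. -/
noncomputable def zigzagThreshold (q P r l : ℕ) : ℝ := ((r + 1 + q * l : ℕ) : ℝ) / P

/-- The slope of the first feature of the `r`-th of `q` units. In the alternating sum of the units,
which has weights `2 * P * (-1) ^ (r + 1)`, these slopes add up to `P`. -/
noncomputable def zigzagSlope (q r : ℕ) : ℝ := (-1) ^ (r + 1) / (2 * q)

theorem zigzagThreshold_strictMono {q P r : ℕ} (hq : 0 < q) (hP : 0 < P) :
    StrictMono (zigzagThreshold q P r) := by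
  intro l l' h
  have hP' : (0 : ℝ) < P := by exact_mod_cast hP
  refine div_lt_div_of_pos_right ?_ hP'
  have := Nat.mul_lt_mul_of_pos_left h hq
  exact_mod_cast Nat.add_lt_add_left this (r + 1)

/-- On each of the `P` pieces, the alternating sum of the units is the affine function that maps
the piece onto the unit interval, increasing on the even and decreasing on the odd pieces. -/
theorem sum_profile_zigzag {q P : ℕ} (hq : 0 < q) (heven : Even q) (hP : 0 < P) (s : ℕ) (y : ℝ) :
    ∑ r : Fin q, 2 * P * (-1 : ℝ) ^ ((r : ℕ) + 1) *
        profile (zigzagSlope q r) (zigzagThreshold q P r) (zigzagSlot q s r) y =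
      (-1) ^ s * (P * y - s) + (1 - (-1) ^ s) / 2 := by
  have hP' : (P : ℝ) ≠ 0 := by exact_mod_cast hP.ne'
  have hq' : (q : ℝ) ≠ 0 := by exact_mod_cast hq.ne'
  have hsq : ∀ a : ℕ, (-1 : ℝ) ^ a * (-1) ^ a = 1 := fun a => by rw [← mul_pow]; norm_num
  have h1 : ∀ r : Fin q, 2 * P * (-1 : ℝ) ^ ((r : ℕ) + 1) *
      profile (zigzagSlope q r) (zigzagThreshold q P r) (zigzagSlot q s r) y =
      P * y / q + ∑ l ∈ Finset.range (zigzagSlot q s r),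
        2 * (-1 : ℝ) ^ ((r : ℕ) + 1) * (P * y - ((r : ℕ) + q * l + 1 : ℕ)) := by
    intro r
    rw [profile, mul_add, Finset.mul_sum]
    congr 1
    · have h0 := hsq ((r : ℕ) + 1)
      rw [zigzagSlope]
      field_simp
      linear_combination y * h0
    · refine Finset.sum_congr rfl fun l _ => ?_
      rw [zigzagThreshold]
      push_cast
      field_simp
      ring
  rw [Finset.sum_congr rfl fun r _ => h1 r, Finset.sum_add_distrib, Finset.sum_const,
    Finset.card_univ, Fintype.card_fin, nsmul_eq_mul, mul_div_cancel₀ _ hq',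
    Fin.sum_univ_eq_sum_range fun r => ∑ l ∈ Finset.range (zigzagSlot q s r),
      2 * (-1 : ℝ) ^ (r + 1) * (P * y - (r + q * l + 1 : ℕ))]
  -- the thresholds below the piece, listed in increasing order
  have h2 : ∑ r ∈ Finset.range q, ∑ l ∈ Finset.range (zigzagSlot q s r),
      2 * (-1 : ℝ) ^ (r + 1) * (P * y - (r + q * l + 1 : ℕ)) =
      ∑ t ∈ Finset.range s, 2 * (-1 : ℝ) ^ (t + 1) * (P * y - (t + 1 : ℕ)) := by
    rw [Finset.sum_sigma']
    refine Finset.sum_nbij' (fun p => p.1 + q * p.2) (fun t => ⟨t % q, t / q⟩) ?_ ?_ ?_ ?_ ?_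
    · rintro ⟨r, l⟩ h
      simp only [Finset.mem_sigma, Finset.mem_range] at h ⊢
      exact (lt_zigzagSlot_iff h.1).1 h.2
    · intro t ht
      simp only [Finset.mem_sigma, Finset.mem_range] at ht ⊢
      refine ⟨Nat.mod_lt _ hq, (lt_zigzagSlot_iff (Nat.mod_lt _ hq)).2 ?_⟩
      rwa [Nat.mod_add_div]
    · rintro ⟨r, l⟩ h
      simp only [Finset.mem_sigma, Finset.mem_range] at h
      rw [Nat.add_mul_mod_self_left, Nat.mod_eq_of_lt h.1, Nat.add_mul_div_left _ _ hq,
        Nat.div_eq_of_lt h.1, zero_add]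
    · intro t _
      exact Nat.mod_add_div t q
    · rintro ⟨r, l⟩ _
      have hpow : (-1 : ℝ) ^ (r + q * l + 1) = (-1) ^ (r + 1) := by
        rw [add_right_comm, pow_add, (heven.mul_right l).neg_one_pow, mul_one]
      rw [hpow]
  rw [h2]
  clear h1 h2
  induction s with
  | zero => simp
  | succ s ih =>
    rw [Finset.sum_range_succ, ← add_assoc, ih, pow_succ]
    push_cast
    ring

theorem zigzagSlot_lt {q k s r : ℕ} (hk : 1 ≤ k) (hr : r < q) (hs : s < q * (k - 1) + 1) :
    zigzagSlot q s r < k := by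
  by_contra hcon
  have h1 := (lt_zigzagSlot_iff (s := s) (l := k - 1) hr).1 (by omega)
  omega

theorem isStrictSlot_zigzagSlot {q P k s r : ℕ} (hP : 0 < P) (hr : r < q) {y : ℝ}
    (h1 : (s : ℝ) < P * y) (h2 : P * y < s + 1) :
    IsStrictSlot (zigzagThreshold q P r) k (zigzagSlot q s r) y := by
  have hP' : (0 : ℝ) < P := by exact_mod_cast hP
  refine fun l _ => ⟨fun hl => ?_, fun hl => ?_⟩
  · have h3 : r + 1 + q * l ≤ s := by
      have := (lt_zigzagSlot_iff hr).1 hl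
      omega
    have h4 : ((r + 1 + q * l : ℕ) : ℝ) ≤ s := by exact_mod_cast h3
    rw [zigzagThreshold, div_lt_iff₀ hP']
    linarith
  · have h3 : s + 1 ≤ r + 1 + q * l := by
      by_contra hcon
      exact absurd ((lt_zigzagSlot_iff (s := s) (l := l) hr).2 (by omega)) (not_lt.2 hl)
    have h4 : (s : ℝ) + 1 ≤ ((r + 1 + q * l : ℕ) : ℝ) := by exact_mod_cast h3
    rw [zigzagThreshold, lt_div_iff₀ hP']
    linarith

/-- The slots of the `q` units at a point are the slots of one of the pieces: as the units have no
common thresholds, at most one of them is at a break. -/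
theorem exists_eq_zigzagSlot {q k : ℕ} (hq : 0 < q) {j : Fin q → ℕ}
    (hj : ∀ r, j r < k) {y : ℝ}
    (h : ∀ r : Fin q, IsWeakSlot (zigzagThreshold q (q * (k - 1) + 1) r) k (j r) y) :
    ∃ s < q * (k - 1) + 1, ∀ r : Fin q, j r = zigzagSlot q s r := by
  have hP' : (0 : ℝ) < (q * (k - 1) + 1 : ℕ) := by exact_mod_cast Nat.succ_pos _
  have hbound : ∀ (r : Fin q) (a b : ℕ), a < b → (r : ℕ) + q * a < q * b := by
    intro r a b hab
    have := Nat.mul_le_mul_left q (show a + 1 ≤ b from hab)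
    rw [Nat.mul_succ] at this
    omega
  -- `s` is the largest threshold, in units of `1 / P`, below the slots
  set f : Fin q → ℕ := fun r => if j r = 0 then 0 else r + 1 + q * (j r - 1) with hf
  obtain ⟨r₀, -, hr₀⟩ := Finset.exists_mem_eq_sup Finset.univ ⟨⟨0, hq⟩, Finset.mem_univ _⟩ f
  set s := Finset.univ.sup f with hs
  have hle : ∀ r, f r ≤ s := fun r => Finset.le_sup (Finset.mem_univ r)
  refine ⟨s, ?_, fun r => le_antisymm ?_ ?_⟩
  · rw [hr₀, hf]
    dsimp only
    split_ifs with h0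
    · exact Nat.succ_pos _
    · have := hbound r₀ (j r₀ - 1) (k - 1) (by have := hj r₀; omega)
      omega
  · by_cases h0 : j r = 0
    · omega
    · have h1 := hle r
      simp only [hf, if_neg h0] at h1
      have := (lt_zigzagSlot_iff (s := s) (l := j r - 1) r.2).2 (by omega)
      omega
  · by_contra hcon
    have h1 := (lt_zigzagSlot_iff (s := s) r.2).1 (not_le.1 hcon)
    have h0 : j r₀ ≠ 0 := by
      intro h0
      simp only [hf, if_pos h0] at hr₀
      omega
    simp only [hf, if_neg h0] at hr₀
    have hr₀' : s = r₀ + 1 + q * (j r₀ - 1) := hr₀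
    have hjr : j r + 1 < k := by
      by_contra hk
      have h2 := hbound r₀ (j r₀ - 1) (j r) (by have := hj r₀; omega)
      omega
    have h2 := (h r₀ (j r₀ - 1) (by have := hj r₀; omega)).1 (by omega)
    have h3 := (h r (j r) hjr).2 le_rfl
    have h4 := h2.trans h3
    rw [zigzagThreshold, zigzagThreshold, div_le_div_iff_of_pos_right hP'] at h4
    have h5 : (r₀ : ℕ) + 1 + q * (j r₀ - 1) ≤ r + 1 + q * j r := by exact_mod_cast h4
    have h6 : (r₀ : ℕ) + q * (j r₀ - 1) = r + q * j r := by omega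
    have h7 : (r₀ : ℕ) = r := by
      have := congrArg (· % q) h6
      simpa only [Nat.add_mul_mod_self_left, Nat.mod_eq_of_lt r₀.2, Nat.mod_eq_of_lt r.2] using this
    have h8 : q * (j r₀ - 1) = q * j r := by omega
    have h9 := Nat.eq_of_mul_eq_mul_left hq h8
    rw [Fin.ext h7] at h0 h9
    omega

theorem zigzagSlot_injective {q s s' : ℕ} (hq : 0 < q)
    (h : ∀ r : Fin q, zigzagSlot q s r = zigzagSlot q s' r) : s = s' := by
  have key : ∀ s s' : ℕ, (∀ r : Fin q, zigzagSlot q s r = zigzagSlot q s' r) → s' ≤ s := by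
    intro s s' h
    by_contra hlt
    have hmod := Nat.mod_lt s hq
    have h1 : s / q < zigzagSlot q s' (s % q) :=
      (lt_zigzagSlot_iff hmod).2 (by rw [Nat.mod_add_div]; omega)
    rw [← h ⟨s % q, hmod⟩] at h1
    have h2 := (lt_zigzagSlot_iff hmod).1 h1
    rw [Nat.mod_add_div] at h2
    exact lt_irrefl _ h2
  exact le_antisymm (key s' s fun r => (h r).symm) (key s s' h)

theorem exists_zigzag_eq {P s : ℕ} (hs : s < P) {u : ℝ} (hu : u ∈ Set.Ioo (0 : ℝ) 1) :
    ∃ y ∈ Set.Ioo (0 : ℝ) 1, (s : ℝ) < P * y ∧ P * y < s + 1 ∧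
      (-1) ^ s * (P * y - s) + (1 - (-1) ^ s) / 2 = u := by
  have hP' : (0 : ℝ) < P := by exact_mod_cast (Nat.zero_le s).trans_lt hs
  have hs' : (s : ℝ) + 1 ≤ P := by exact_mod_cast hs
  obtain ⟨w, hw, hwu⟩ : ∃ w ∈ Set.Ioo (0 : ℝ) 1, (-1) ^ s * w + (1 - (-1) ^ s) / 2 = u := by
    rcases Nat.even_or_odd s with h | h
    · exact ⟨u, hu, by rw [h.neg_one_pow]; ring⟩
    · exact ⟨1 - u, ⟨by linarith [hu.2], by linarith [hu.1]⟩, by rw [h.neg_one_pow]; ring⟩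
  have hPy : P * ((s + w) / P) = s + w := mul_div_cancel₀ _ hP'.ne'
  refine ⟨(s + w) / P, ⟨by have := hw.1; positivity, ?_⟩, ?_, ?_, ?_⟩
  · rw [div_lt_one hP']
    linarith [hw.2]
  · rw [hPy]
    linarith [hw.1]
  · rw [hPy]
    linarith [hw.2]
  · rw [hPy, add_sub_cancel_left, hwu]

/-- The slope of the alternating sum of the units is an odd multiple of `P`. -/
theorem sum_slope_zigzag_ne_zero {q P : ℕ} (hq : 0 < q) (hP : 0 < P) (j : Fin q → ℕ) :
    ∑ r : Fin q, 2 * P * (-1 : ℝ) ^ ((r : ℕ) + 1) * (j r + zigzagSlope q r) ≠ 0 := by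
  have hP' : (P : ℝ) ≠ 0 := by exact_mod_cast hP.ne'
  have hq' : (q : ℝ) ≠ 0 := by exact_mod_cast hq.ne'
  have hsq : ∀ a : ℕ, (-1 : ℝ) ^ a * (-1) ^ a = 1 := fun a => by rw [← mul_pow]; norm_num
  have h1 : ∀ r : Fin q, 2 * P * (-1 : ℝ) ^ ((r : ℕ) + 1) * (j r + zigzagSlope q r) =
      P / q + P * (2 * (((-1) ^ ((r : ℕ) + 1) * (j r : ℤ) : ℤ) : ℝ)) := by
    intro r
    have h0 := hsq ((r : ℕ) + 1)
    rw [zigzagSlope]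
    push_cast
    field_simp
    linear_combination h0
  rw [Finset.sum_congr rfl fun r _ => h1 r, Finset.sum_add_distrib, Finset.sum_const,
    Finset.card_univ, Fintype.card_fin, nsmul_eq_mul, mul_div_cancel₀ _ hq', ← Finset.mul_sum,
    ← Finset.mul_sum, ← Int.cast_sum]
  set Z : ℤ := ∑ r : Fin q, (-1) ^ ((r : ℕ) + 1) * (j r : ℤ)
  have h2 : (P : ℝ) + P * (2 * Z) = P * ((1 + 2 * Z : ℤ) : ℝ) := by
    push_cast
    ring
  rw [h2]
  refine mul_ne_zero hP' (Int.cast_ne_zero.2 ?_)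
  omega

end Zigzag

/-! ### Layers of zigzag functions -/

section ZigzagLayer

variable {a b d q K : ℕ}

/-- The number of pieces of the zigzag function formed by `q` units with `k` effective features. -/
def pieceCount (q k : ℕ) : ℕ := q * (k - 1) + 1

theorem pieceCount_pos (q k : ℕ) : 0 < pieceCount q k := Nat.succ_pos _

/-- The layer whose unit `e (c, r)` is the `r`-th unit of the zigzag function with
`pieceCount q (κ c)` pieces of the coordinate `ρ c` of the layer input. Its features beyond the
first `κ c` are dominated by feature `0`. -/
noncomputable def zigzagLayer (K : ℕ) (e : Fin d × Fin q ≃ Fin b) (κ : Fin d → ℕ)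
    (ρ : Fin d → Fin a → ℝ) : LayerParams a b K := fun i j =>
  ((((if (j : ℕ) < κ (e.symm i).1 then (j : ℕ) else 0 : ℕ) : ℝ) +
      zigzagSlope q (e.symm i).2) • ρ (e.symm i).1,
    -∑ l ∈ Finset.range (if (j : ℕ) < κ (e.symm i).1 then (j : ℕ) else 0),
        zigzagThreshold q (pieceCount q (κ (e.symm i).1)) (e.symm i).2 l -
      if (j : ℕ) < κ (e.symm i).1 then 0 else 1)

/-- The coefficients of the alternating sums of the units of a zigzag layer that form the zigzag
functions. They are the coordinates of the input of the following layer. -/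
noncomputable def zigzagReadout (e : Fin d × Fin q ≃ Fin b) (κ : Fin d → ℕ) :
    Fin d → Fin b → ℝ := fun c i =>
  if (e.symm i).1 = c then
    2 * (pieceCount q (κ c) : ℝ) * (-1) ^ (((e.symm i).2 : ℕ) + 1) else 0

/-- The pattern of a zigzag layer on the box of the pieces `s c` of the coordinates `c`. -/
def zigzagPattern (e : Fin d × Fin q ≃ Fin b) {κ : Fin d → ℕ} (hκ : ∀ c, 1 ≤ κ c ∧ κ c ≤ K)
    (s : ∀ c, Fin (pieceCount q (κ c))) : Fin b → Fin K := fun i =>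
  ⟨zigzagSlot q (s (e.symm i).1) (e.symm i).2,
    (zigzagSlot_lt (hκ _).1 (e.symm i).2.2 (s (e.symm i).1).2).trans_le (hκ _).2⟩

variable {e : Fin d × Fin q ≃ Fin b} {κ : Fin d → ℕ} {ρ : Fin d → Fin a → ℝ}

theorem featureGrad_zigzagReadout (c : Fin d) (g : Fin b → ℝ) :
    featureGrad (zigzagReadout e κ c) g =
      ∑ r : Fin q, 2 * (pieceCount q (κ c) : ℝ) * (-1) ^ ((r : ℕ) + 1) * g (e (c, r)) := by
  rw [featureGrad_apply, ← e.sum_comp, Fintype.sum_prod_type, Fintype.sum_eq_single c]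
  · simp [zigzagReadout]
  · intro c' hc'
    simp [zigzagReadout, hc']

theorem featureValue_zigzagLayer_of_lt {c : Fin d} {r : Fin q} {j : Fin K} (hj : (j : ℕ) < κ c)
    (h : Fin a → ℝ) : featureValue (zigzagLayer K e κ ρ (e (c, r)) j) h =
      profile (zigzagSlope q r) (zigzagThreshold q (pieceCount q (κ c)) r) j
        (featureGrad (ρ c) h) := by
  rw [featureValue_eq, profile_eq]
  simp only [zigzagLayer, Equiv.symm_apply_apply, if_pos hj, featureGrad_smul]
  ring

theorem featureValue_zigzagLayer_of_le {c : Fin d} {r : Fin q} {j : Fin K} (hj : κ c ≤ j)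
    (h : Fin a → ℝ) : featureValue (zigzagLayer K e κ ρ (e (c, r)) j) h =
      profile (zigzagSlope q r) (zigzagThreshold q (pieceCount q (κ c)) r) 0
        (featureGrad (ρ c) h) - 1 := by
  rw [featureValue_eq, profile_eq]
  simp only [zigzagLayer, Equiv.symm_apply_apply, if_neg (not_lt.2 hj), featureGrad_smul]
  simp [sub_eq_add_neg]

theorem isWeaklyActive_zigzagLayer_lt (hκ : ∀ c, 1 ≤ κ c ∧ κ c ≤ K) {J : Fin b → Fin K}
    {h : Fin a → ℝ} (hJ : IsWeaklyActive (zigzagLayer K e κ ρ) J h) (c : Fin d) (r : Fin q) :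
    (J (e (c, r)) : ℕ) < κ c := by
  by_contra hcon
  have h0 : 0 < K := (hκ c).1.trans (hκ c).2
  have h1 := hJ (e (c, r)) ⟨0, h0⟩
  rw [featureValue_zigzagLayer_of_lt (show ((⟨0, h0⟩ : Fin K) : ℕ) < κ c from (hκ c).1),
    featureValue_zigzagLayer_of_le (not_lt.1 hcon)] at h1
  simp only at h1
  linarith

theorem exists_eq_zigzagPattern (hq : 0 < q) (hκ : ∀ c, 1 ≤ κ c ∧ κ c ≤ K) {J : Fin b → Fin K}
    {h : Fin a → ℝ} (hJ : IsWeaklyActive (zigzagLayer K e κ ρ) J h) :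
    ∃ s, J = zigzagPattern e hκ s := by
  have hlt := isWeaklyActive_zigzagLayer_lt hκ hJ
  have hex : ∀ c, ∃ s < pieceCount q (κ c), ∀ r : Fin q,
      (J (e (c, r)) : ℕ) = zigzagSlot q s r := by
    intro c
    refine exists_eq_zigzagSlot hq (hlt c) (y := featureGrad (ρ c) h) fun r => ?_
    refine isWeakSlot_of_profile_le (α := zigzagSlope q r)
      (zigzagThreshold_strictMono hq (pieceCount_pos _ _)) (hlt c r) fun j' hj' => ?_
    have h1 := hJ (e (c, r)) ⟨j', hj'.trans_le (hκ c).2⟩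
    rwa [featureValue_zigzagLayer_of_lt (hlt c r), featureValue_zigzagLayer_of_lt hj'] at h1
  choose s hs hsJ using hex
  refine ⟨fun c => ⟨s c, hs c⟩, ?_⟩
  funext i
  have := hsJ (e.symm i).1 (e.symm i).2
  rw [Prod.mk.eta, Equiv.apply_symm_apply] at this
  exact Fin.ext this

theorem zigzagPattern_apply (hκ : ∀ c, 1 ≤ κ c ∧ κ c ≤ K) (s : ∀ c, Fin (pieceCount q (κ c)))
    (c : Fin d) (r : Fin q) :
    (zigzagPattern e hκ s (e (c, r)) : ℕ) = zigzagSlot q (s c) r := by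
  have key : ∀ p : Fin d × Fin q, p = (c, r) →
      zigzagSlot q (s p.1) p.2 = zigzagSlot q (s c) r := by
    rintro _ rfl
    rfl
  exact key _ (e.symm_apply_apply (c, r))

theorem zigzagPattern_injective (hq : 0 < q) (hκ : ∀ c, 1 ≤ κ c ∧ κ c ≤ K) :
    Function.Injective (zigzagPattern e hκ) := by
  intro s s' h
  funext c
  refine Fin.ext (zigzagSlot_injective hq fun r => ?_)
  rw [← zigzagPattern_apply hκ s c r, ← zigzagPattern_apply hκ s' c r, h]

/-- Every point of the open unit cube is the image under the zigzag functions of a point in a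
given box of pieces. -/
theorem exists_isStrictlyActive_zigzagLayer (hq : 0 < q) (heven : Even q)
    (hκ : ∀ c, 1 ≤ κ c ∧ κ c ≤ K) (s : ∀ c, Fin (pieceCount q (κ c))) {u : Fin d → ℝ}
    (hu : u ∈ openUnitCube d) :
    ∃ v ∈ openUnitCube d, ∀ h : Fin a → ℝ, (∀ c, featureGrad (ρ c) h = v c) →
      IsStrictlyActive (zigzagLayer K e κ ρ) (zigzagPattern e hκ s) h ∧
        ∀ c, featureGrad (zigzagReadout e κ c) (maxoutLayer (zigzagLayer K e κ ρ) h) = u c := by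
  have hex : ∀ c, _ := fun c => exists_zigzag_eq (s c).2 (hu c trivial)
  choose v hv hv1 hv2 hvu using hex
  refine ⟨v, fun c _ => hv c, fun h hh => ?_⟩
  have hlt : ∀ (c : Fin d) (r : Fin q), zigzagSlot q (s c) r < κ c :=
    fun c r => zigzagSlot_lt (hκ c).1 r.2 (s c).2
  have hpat := zigzagPattern_apply (e := e) hκ s
  have hval : ∀ (c : Fin d) (r : Fin q),
      featureValue (zigzagLayer K e κ ρ (e (c, r)) (zigzagPattern e hκ s (e (c, r)))) h =
        profile (zigzagSlope q r) (zigzagThreshold q (pieceCount q (κ c)) r)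
          (zigzagSlot q (s c) r) (v c) := by
    intro c r
    rw [featureValue_zigzagLayer_of_lt (by rw [hpat]; exact hlt c r), hpat, hh]
  have hslot : ∀ (c : Fin d) (r : Fin q), IsStrictSlot
      (zigzagThreshold q (pieceCount q (κ c)) r) (κ c) (zigzagSlot q (s c) r) (v c) :=
    fun c r => isStrictSlot_zigzagSlot (pieceCount_pos _ _) r.2 (hv1 c) (hv2 c)
  have hstrict : IsStrictlyActive (zigzagLayer K e κ ρ) (zigzagPattern e hκ s) h := by
    intro i j hj
    obtain ⟨⟨c, r⟩, rfl⟩ := e.surjective i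
    rw [hval]
    by_cases hjκ : (j : ℕ) < κ c
    · rw [featureValue_zigzagLayer_of_lt hjκ, hh]
      refine (hslot c r).profile_lt (hlt c r) hjκ fun heq => hj (Fin.ext ?_)
      rw [hpat, heq]
    · rw [featureValue_zigzagLayer_of_le (not_lt.1 hjκ), hh]
      have hweak : IsWeakSlot (zigzagThreshold q (pieceCount q (κ c)) r) (κ c)
          (zigzagSlot q (s c) r) (v c) := fun l hl =>
        ⟨fun h => ((hslot c r l hl).1 h).le, fun h => ((hslot c r l hl).2 h).le⟩
      have := hweak.profile_le (α := zigzagSlope q r) (hlt c r) (hκ c).1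
      linarith
  refine ⟨hstrict, fun c => ?_⟩
  rw [hstrict.isWeaklyActive.maxoutLayer_eq, featureGrad_zigzagReadout, ← hvu c,
    ← sum_profile_zigzag hq heven (pieceCount_pos _ _)]
  exact Finset.sum_congr rfl fun r _ => by rw [hval]

/-- The slope of the zigzag function of the coordinate `c` on the cell of the pattern `J`. -/
noncomputable def zigzagGrad (e : Fin d × Fin q ≃ Fin b) (κ : Fin d → ℕ) (J : Fin b → Fin K)
    (c : Fin d) : ℝ :=
  ∑ r : Fin q, 2 * (pieceCount q (κ c) : ℝ) * (-1) ^ ((r : ℕ) + 1) *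
    (((if (J (e (c, r)) : ℕ) < κ c then (J (e (c, r)) : ℕ) else 0 : ℕ) : ℝ) + zigzagSlope q r)

theorem zigzagGrad_ne_zero (hq : 0 < q) (J : Fin b → Fin K) (c : Fin d) :
    zigzagGrad e κ J c ≠ 0 :=
  sum_slope_zigzag_ne_zero hq (pieceCount_pos _ _) _

theorem featureGrad_zigzagReadout_layerGrad (J : Fin b → Fin K) (c : Fin d) (w : Fin a → ℝ) :
    featureGrad (zigzagReadout e κ c) (layerGrad (zigzagLayer K e κ ρ) J w) =
      zigzagGrad e κ J c * featureGrad (ρ c) w := by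
  rw [featureGrad_zigzagReadout, zigzagGrad, Finset.sum_mul]
  refine Finset.sum_congr rfl fun r _ => ?_
  change _ * featureGrad (zigzagLayer K e κ ρ (e (c, r)) (J (e (c, r)))).1 w = _
  simp only [zigzagLayer, Equiv.symm_apply_apply, featureGrad_smul]
  ring

/-- If two patterns differ at a single unit, then the slopes of one of the zigzag functions
differ. -/
theorem exists_zigzagGrad_ne {J J' : Fin b → Fin K}
    (hJ : ∀ c r, (J (e (c, r)) : ℕ) < κ c) (hJ' : ∀ c r, (J' (e (c, r)) : ℕ) < κ c)
    {i : Fin b} (hi : J i ≠ J' i) (hne : ∀ i', i' ≠ i → J i' = J' i') :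
    ∃ c, zigzagGrad e κ J c ≠ zigzagGrad e κ J' c := by
  obtain ⟨⟨c, r⟩, rfl⟩ := e.surjective i
  refine ⟨c, fun heq => hi ?_⟩
  rw [zigzagGrad, zigzagGrad, ← sub_eq_zero, ← Finset.sum_sub_distrib,
    Finset.sum_eq_single_of_mem r (Finset.mem_univ _)] at heq
  · rw [if_pos (hJ c r), if_pos (hJ' c r), ← mul_sub, add_sub_add_right_eq_sub] at heq
    have hP : (pieceCount q (κ c) : ℝ) ≠ 0 := by
      exact_mod_cast (pieceCount_pos _ _).ne'
    have h1 : (2 * (pieceCount q (κ c) : ℝ) * (-1) ^ ((r : ℕ) + 1)) ≠ 0 :=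
      mul_ne_zero (mul_ne_zero two_ne_zero hP) (pow_ne_zero _ (by norm_num))
    have h2 := sub_eq_zero.1 ((mul_eq_zero.1 heq).resolve_left h1)
    exact Fin.ext (by exact_mod_cast h2)
  · intro r' _ hr'
    have : J (e (c, r')) = J' (e (c, r')) := hne _ fun h => hr' (by simpa using h)
    rw [this, sub_self]

end ZigzagLayer

/-! ### Deep zigzag networks -/

section DeepZigzag

variable {n : ℕ → ℕ} {K : ℕ}

theorem ncard_setOf_snocPattern {L : ℕ} {S : Set (DeepPattern n K L)} {α : Type*} [Fintype α]
    {f : α → Fin (n (L + 1)) → Fin K} (hf : Function.Injective f) :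
    {J : DeepPattern n K (L + 1) | (fun l : Fin L => J l.castSucc) ∈ S ∧
      ∃ s, J (Fin.last L) = f s}.ncard = S.ncard * Fintype.card α := by
  have hinj : Function.Injective fun p : DeepPattern n K L × α => snocPattern p.1 (f p.2) := by
    rintro ⟨J, s⟩ ⟨J', s'⟩ h
    have h' : snocPattern J (f s) = snocPattern J' (f s') := h
    refine Prod.ext (funext fun l => ?_) (hf ?_)
    · change J l = J' l
      rw [← snocPattern_castSucc J (f s) l, ← snocPattern_castSucc J' (f s') l, h']
    · change f s = f s'
      rw [← snocPattern_last J (f s), ← snocPattern_last J' (f s'), h']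
  have himage : {J : DeepPattern n K (L + 1) | (fun l : Fin L => J l.castSucc) ∈ S ∧
      ∃ s, J (Fin.last L) = f s} =
      (fun p : DeepPattern n K L × α => snocPattern p.1 (f p.2)) '' (S ×ˢ Set.univ) := by
    ext J
    constructor
    · rintro ⟨hJ, s, hs⟩
      refine ⟨(fun l => J l.castSucc, s), ⟨hJ, trivial⟩, deepPattern_ext ?_ ?_⟩
      · simp only [snocPattern_castSucc]
      · exact (snocPattern_last _ _).trans hs.symm
    · rintro ⟨⟨J, s⟩, ⟨hJ, -⟩, rfl⟩
      refine ⟨?_, s, ?_⟩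
      · simpa only [snocPattern_castSucc] using hJ
      · exact snocPattern_last _ _
  rw [himage, Set.ncard_image_of_injective _ hinj, Set.ncard_prod, Set.ncard_univ,
    Nat.card_eq_fintype_card]

/-- Deep compositions of zigzag functions. For suitable coordinates `ρ` of the output of the last
hidden layer: every weakly active pattern is strictly active at inputs in the unit cube that the
coordinates send to an arbitrary point of the unit cube; the number of these patterns is the
product of the numbers of pieces; on each cell the coordinates are affine functions with a
diagonal linear part; and adjacent patterns have different linear parts. -/
theorem exists_zigzagNetwork (L : ℕ) (q : Fin L → ℕ) (hq : ∀ l, 0 < q l) (heven : ∀ l, Even (q l))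
    (hn : ∀ l : Fin L, n 0 * q l = n (l + 1)) (k : Fin L → Fin (n 0) → ℕ)
    (hk : ∀ l c, 1 ≤ k l c ∧ k l c ≤ K) :
    ∃ (θ : HiddenParams n K L) (ρ : Fin (n 0) → Fin (n L) → ℝ),
      (∀ J x, IsDeepWeaklyActive n K L θ J x → ∀ u ∈ openUnitCube (n 0),
        ∃ y ∈ openUnitCube (n 0), IsDeepStrictlyActive n K L θ J y ∧
          ∀ c, featureGrad (ρ c) (hiddenMap n K L θ y) = u c) ∧
      {J | ∃ y ∈ openUnitCube (n 0), IsDeepStrictlyActive n K L θ J y}.ncard =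
        ∏ l, ∏ c, pieceCount (q l) (k l c) ∧
      (∀ J, ∃ σ : Fin (n 0) → ℝ, (∀ c, σ c ≠ 0) ∧
        ∀ v c, featureGrad (ρ c) (deepGrad n K L θ J v) = σ c * v c) ∧
      (∀ J J', IsAdjacent n K L J J' →
        (∃ y ∈ openUnitCube (n 0), IsDeepStrictlyActive n K L θ J y) →
        (∃ y ∈ openUnitCube (n 0), IsDeepStrictlyActive n K L θ J' y) →
        ∃ c, featureGrad (ρ c) (deepGrad n K L θ J (Pi.single c 1)) ≠
          featureGrad (ρ c) (deepGrad n K L θ J' (Pi.single c 1))) := by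
  induction L with
  | zero =>
    have hgrad : ∀ (c : Fin (n 0)) (v : Fin (n 0) → ℝ), featureGrad (Pi.single c 1) v = v c := by
      intro c v
      simp [featureGrad_apply, Pi.single_apply]
    refine ⟨fun l => l.elim0, fun c => Pi.single c 1, ?_, ?_, ?_, fun J J' h => h.elim⟩
    · exact fun J x _ u hu => ⟨u, hu, trivial, fun c => hgrad c u⟩
    · have : {J : DeepPattern n K 0 | ∃ y ∈ openUnitCube (n 0),
          IsDeepStrictlyActive n K 0 (fun l => l.elim0) J y} = {fun l => l.elim0} := by
        ext J
        refine ⟨fun _ => funext fun l => l.elim0, fun _ => ⟨fun _ => 1 / 2, fun c _ => ?_, trivial⟩⟩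
        norm_num
      rw [this, Set.ncard_singleton]
      simp
    · exact fun J => ⟨fun _ => 1, fun c => one_ne_zero, fun v c => by rw [one_mul]; exact hgrad c v⟩
  | succ L ih =>
    obtain ⟨θ, ρ, hA, hB, hC, hD⟩ := ih (fun l => q l.castSucc) (fun l => hq _)
      (fun l => heven _) (fun l => hn l.castSucc) (fun l => k l.castSucc) fun l => hk _
    set e : Fin (n 0) × Fin (q (Fin.last L)) ≃ Fin (n (L + 1)) :=
      finProdFinEquiv.trans (finCongr (hn (Fin.last L)))
    set κ := k (Fin.last L)
    have hκ : ∀ c, 1 ≤ κ c ∧ κ c ≤ K := hk (Fin.last L)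
    have hq' := hq (Fin.last L)
    set θ' : HiddenParams n K (L + 1) :=
      Fin.snoc (α := fun l : Fin (L + 1) => LayerParams (n l) (n (l + 1)) K) θ
        (zigzagLayer K e κ ρ) with hθ'
    have hinit : (fun l : Fin L => θ' l.castSucc) = θ := funext fun l =>
      Fin.snoc_castSucc (α := fun l : Fin (L + 1) => LayerParams (n l) (n (l + 1)) K) _ _ l
    have hlast : θ' (Fin.last L) = zigzagLayer K e κ ρ :=
      Fin.snoc_last (α := fun l : Fin (L + 1) => LayerParams (n l) (n (l + 1)) K) _ _
    have hmap : ∀ x, hiddenMap n K (L + 1) θ' x =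
        maxoutLayer (zigzagLayer K e κ ρ) (hiddenMap n K L θ x) := by
      intro x
      rw [← hinit, ← hlast]
      rfl
    have hstrict : ∀ J x, IsDeepStrictlyActive n K (L + 1) θ' J x ↔
        IsDeepStrictlyActive n K L θ (fun l => J l.castSucc) x ∧
          IsStrictlyActive (zigzagLayer K e κ ρ) (J (Fin.last L)) (hiddenMap n K L θ x) := by
      intro J x
      rw [← hinit, ← hlast]
      rfl
    have hweak : ∀ J x, IsDeepWeaklyActive n K (L + 1) θ' J x ↔
        IsDeepWeaklyActive n K L θ (fun l => J l.castSucc) x ∧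
          IsWeaklyActive (zigzagLayer K e κ ρ) (J (Fin.last L)) (hiddenMap n K L θ x) := by
      intro J x
      rw [← hinit, ← hlast]
      rfl
    have hgrad : ∀ J v c, featureGrad (zigzagReadout e κ c) (deepGrad n K (L + 1) θ' J v) =
        zigzagGrad e κ (J (Fin.last L)) c *
          featureGrad (ρ c) (deepGrad n K L θ (fun l => J l.castSucc) v) := by
      intro J v c
      rw [← featureGrad_zigzagReadout_layerGrad, ← hlast]
      conv_rhs => rw [← hinit]
      rfl
    -- a pattern whose initial part is active extends by any box of pieces of the last layer
    have hext : ∀ (J : DeepPattern n K (L + 1)) s x,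
        IsDeepWeaklyActive n K L θ (fun l => J l.castSucc) x →
        J (Fin.last L) = zigzagPattern e hκ s → ∀ u ∈ openUnitCube (n 0),
        ∃ y ∈ openUnitCube (n 0), IsDeepStrictlyActive n K (L + 1) θ' J y ∧
          ∀ c, featureGrad (zigzagReadout e κ c) (hiddenMap n K (L + 1) θ' y) = u c := by
      intro J s x hJ hs u hu
      obtain ⟨v, hv, hvu⟩ := exists_isStrictlyActive_zigzagLayer (e := e) (ρ := ρ) hq'
        (heven (Fin.last L)) hκ s hu
      obtain ⟨y, hy, hyJ, hyv⟩ := hA _ x hJ v hv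
      obtain ⟨h1, h2⟩ := hvu _ hyv
      refine ⟨y, hy, (hstrict J y).2 ⟨hyJ, hs ▸ h1⟩, fun c => ?_⟩
      rw [hmap]
      exact h2 c
    refine ⟨θ', zigzagReadout e κ, ?_, ?_, ?_, ?_⟩
    · intro J x hJ
      obtain ⟨h1, h2⟩ := (hweak J x).1 hJ
      obtain ⟨s, hs⟩ := exists_eq_zigzagPattern hq' hκ h2
      exact hext J s x h1 hs
    · rw [Fin.prod_univ_castSucc, ← hB]
      have hset : {J | ∃ y ∈ openUnitCube (n 0), IsDeepStrictlyActive n K (L + 1) θ' J y} =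
          {J : DeepPattern n K (L + 1) | (fun l : Fin L => J l.castSucc) ∈
            {J | ∃ y ∈ openUnitCube (n 0), IsDeepStrictlyActive n K L θ J y} ∧
              ∃ s, J (Fin.last L) = zigzagPattern e hκ s} := by
        ext J
        constructor
        · rintro ⟨y, hy, hJ⟩
          obtain ⟨h1, h2⟩ := (hstrict J y).1 hJ
          exact ⟨⟨y, hy, h1⟩, exists_eq_zigzagPattern hq' hκ h2.isWeaklyActive⟩
        · rintro ⟨⟨x, -, hx⟩, s, hs⟩
          obtain ⟨y, hy, hyJ, -⟩ := hext J s x hx.isDeepWeaklyActive hs (fun _ => 1 / 2)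
            fun c _ => by norm_num
          exact ⟨y, hy, hyJ⟩
      rw [hset, ncard_setOf_snocPattern (zigzagPattern_injective hq' hκ), Fintype.card_pi]
      simp only [Fintype.card_fin]
      rfl
    · intro J
      obtain ⟨σ, hσ, hσv⟩ := hC fun l => J l.castSucc
      refine ⟨fun c => zigzagGrad e κ (J (Fin.last L)) c * σ c,
        fun c => mul_ne_zero (zigzagGrad_ne_zero hq' _ c) (hσ c), fun v c => ?_⟩
      rw [hgrad, hσv, mul_assoc]
    · rintro J J' hadj ⟨y, hy, hyJ⟩ ⟨y', hy', hyJ'⟩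
      obtain ⟨h1, h2⟩ := (hstrict J y).1 hyJ
      obtain ⟨h1', h2'⟩ := (hstrict J' y').1 hyJ'
      rcases hadj with ⟨hadj, heq⟩ | ⟨heq, i, hi, hne⟩
      · obtain ⟨c, hc⟩ := hD _ _ hadj ⟨y, hy, h1⟩ ⟨y', hy', h1'⟩
        refine ⟨c, fun h => hc ?_⟩
        rw [hgrad, hgrad, heq] at h
        exact mul_left_cancel₀ (zigzagGrad_ne_zero hq' _ c) h
      · obtain ⟨c, hc⟩ := exists_zigzagGrad_ne
          (isWeaklyActive_zigzagLayer_lt hκ h2.isWeaklyActive)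
          (isWeaklyActive_zigzagLayer_lt hκ h2'.isWeaklyActive) hi hne
        refine ⟨c, fun h => hc ?_⟩
        obtain ⟨σ, hσ, hσv⟩ := hC fun l => J' l.castSucc
        rw [hgrad, hgrad, heq, hσv, Pi.single_eq_same, mul_one] at h
        exact mul_right_cancel₀ (hσ c) h

end DeepZigzag

/-! ### A single generic unit -/

section Unit

variable {a K : ℕ} {θ : UnitParams a K}

instance isAddHaarMeasure_volume_unitParams (a K : ℕ) :
    (volume : Measure (UnitParams a K)).IsAddHaarMeasure := by
  have : BorelSpace ((Fin a → ℝ) × ℝ) := Prod.borelSpace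
  have : (volume : Measure ((Fin a → ℝ) × ℝ)).IsAddHaarMeasure :=
    Measure.prod.instIsAddHaarMeasure _ _
  exact Measure.pi.isAddHaarMeasure fun _ => (volume : Measure ((Fin a → ℝ) × ℝ))

/-- The points of the standard simplex whose coordinates vanish outside of `S`. -/
def simplexFace (S : Finset (Fin K)) : Set (Fin K → ℝ) :=
  {c | c ∈ stdSimplex ℝ (Fin K) ∧ ∀ j ∉ S, c j = 0}

theorem isCompact_simplexFace (S : Finset (Fin K)) : IsCompact (simplexFace S) := by
  have h : IsClosed {c : Fin K → ℝ | ∀ j ∉ S, c j = 0} := by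
    simp only [Set.ofPred_forall]
    exact isClosed_iInter fun j => isClosed_iInter fun _ =>
      isClosed_eq (continuous_apply j) continuous_const
  exact (isCompact_stdSimplex ℝ (Fin K)).inter_right h

theorem convex_simplexFace (S : Finset (Fin K)) : Convex ℝ (simplexFace S) := by
  refine (convex_stdSimplex ℝ (Fin K)).inter fun c hc c' hc' s t _ _ _ j hj => ?_
  simp [hc j hj, hc' j hj]

/-- No weight vector of the unit `θ` is a convex combination of at most `a` others. -/
def HasGenericWeights (θ : UnitParams a K) : Prop :=
  ∀ S : Finset (Fin K), S.card ≤ a → ∀ i ∉ S, ∀ c ∈ simplexFace S,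
    ∑ j, c j • (θ j).1 ≠ (θ i).1

theorem isClosed_setOf_exists_simplexFace (S : Finset (Fin K)) (i : Fin K) :
    IsClosed {θ : UnitParams a K | ∃ c ∈ simplexFace S, ∑ j, c j • (θ j).1 = (θ i).1} := by
  rw [← isOpen_compl_iff, isOpen_iff_mem_nhds]
  intro θ hθ
  have hc := (isCompact_simplexFace S).eventually_forall_of_forall_eventually (x₀ := θ)
    (P := fun θ c => ∑ j, c j • (θ j).1 ≠ (θ i).1) fun c hc => by
      refine (isOpen_ne_fun ?_ ?_).mem_nhds fun h => hθ ⟨c, hc, h⟩ <;> fun_prop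
  filter_upwards [hc] with θ' h
  rintro ⟨c, hc, hsum⟩
  exact h c hc hsum

/-- With the other weight vectors fixed, the condition confines the weight vector of the feature
`i` to an affine subspace of dimension less than `a`. -/
theorem volume_setOf_exists_simplexFace {S : Finset (Fin K)} (hS : S.card ≤ a) {i : Fin K}
    (hi : i ∉ S) :
    volume {θ : UnitParams a K | ∃ c ∈ simplexFace S, ∑ j, c j • (θ j).1 = (θ i).1} = 0 := by
  classical
  let L : (Fin a → ℝ) →ₗ[ℝ] UnitParams a K :=
    (LinearMap.single ℝ (fun _ : Fin K => (Fin a → ℝ) × ℝ) i) ∘ₗ LinearMap.inl ℝ (Fin a → ℝ) ℝ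
  refine measure_eq_zero_iff_ae_notMem.2 ?_
  have : BorelSpace ((Fin a → ℝ) × ℝ) := Prod.borelSpace
  refine ae_mem_of_ae_add_linearMap_mem L (volume : Measure (Fin a → ℝ)) volume
    (s := {θ : UnitParams a K | ∃ c ∈ simplexFace S, ∑ j, c j • (θ j).1 = (θ i).1}ᶜ)
    (isClosed_setOf_exists_simplexFace S i).measurableSet.compl fun θ => ?_
  set A : AffineSubspace ℝ (Fin a → ℝ) := affineSpan ℝ (S.image fun j => (θ j).1) with hA
  have hAtop : A ≠ ⊤ := by
    intro htop
    obtain hS0 | hS0 := S.eq_empty_or_nonempty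
    · simp [hA, hS0] at htop
    · have h1 := finrank_vectorSpan_image_finset_le ℝ (fun j => (θ j).1) S
        (n := S.card - 1) (by have := hS0.card_pos; omega)
      rw [← direction_affineSpan, ← hA, htop, AffineSubspace.direction_top, finrank_top,
        Module.finrank_fin_fun] at h1
      have := hS0.card_pos
      omega
  have hnull : volume ((fun v => (θ i).1 + v) ⁻¹' (A : Set (Fin a → ℝ))) = 0 := by
    rw [measure_preimage_add]
    exact Measure.addHaar_affineSubspace _ A hAtop
  filter_upwards [measure_eq_zero_iff_ae_notMem.1 hnull] with v hv
  rintro ⟨c, ⟨⟨hc0, hc1⟩, hcS⟩, hsum⟩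
  refine hv ?_
  have hval : ∀ j, ((θ + L v) j).1 = (θ j).1 + if j = i then v else 0 := by
    intro j
    by_cases hj : j = i
    · subst hj; simp [L]
    · simp [L, hj]
  have hci : c i = 0 := hcS i hi
  have hsum' : ∑ j ∈ S, c j • (θ j).1 = (θ i).1 + v := by
    rw [hval i, if_pos rfl] at hsum
    rw [← hsum, ← Finset.sum_subset (Finset.subset_univ S) fun j _ hj => by rw [hcS j hj, zero_smul]]
    refine Finset.sum_congr rfl fun j hj => ?_
    rw [hval j, if_neg (by rintro rfl; exact hi hj), add_zero]
  have hcS1 : ∑ j ∈ S, c j = 1 := by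
    rw [← hc1, Finset.sum_subset (Finset.subset_univ S) fun j _ hj => hcS j hj]
  show (θ i).1 + v ∈ A
  rw [← hsum']
  refine convexHull_subset_affineSpan _ ((convex_convexHull ℝ _).sum_mem (fun j _ => hc0 j) hcS1
    fun j hj => subset_convexHull ℝ _ ?_)
  exact Finset.mem_coe.2 (Finset.mem_image_of_mem _ hj)

theorem volume_setOf_not_hasGenericWeights (a K : ℕ) :
    volume {θ : UnitParams a K | ¬ HasGenericWeights θ} = 0 := by
  have hsub : {θ : UnitParams a K | ¬ HasGenericWeights θ} ⊆
      ⋃ S : Finset (Fin K), ⋃ i : Fin K, ⋃ (_ : S.card ≤ a ∧ i ∉ S),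
        {θ | ∃ c ∈ simplexFace S, ∑ j, c j • (θ j).1 = (θ i).1} := by
    intro θ hθ
    simp only [HasGenericWeights, not_forall, not_not, Set.mem_ofPred_eq] at hθ
    obtain ⟨S, hS, i, hi, c, hc, h⟩ := hθ
    exact Set.mem_iUnion.2 ⟨S, Set.mem_iUnion.2 ⟨i, Set.mem_iUnion.2 ⟨⟨hS, hi⟩, c, hc, h⟩⟩⟩
  refine measure_mono_null hsub (measure_iUnion_null fun S => measure_iUnion_null fun i =>
    measure_iUnion_null fun h => ?_)
  exact volume_setOf_exists_simplexFace h.1 h.2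

theorem HasGenericWeights.injective (h : HasGenericWeights θ) (ha : 1 ≤ a) :
    Function.Injective fun j => (θ j).1 := by
  classical
  intro j i hji
  by_contra hne
  refine h {j} (by simpa using ha) i (by simpa using Ne.symm hne) (Pi.single j 1)
    ⟨single_mem_stdSimplex ℝ j, fun j' hj' => Pi.single_eq_of_ne (by simpa using hj') _⟩ ?_
  rw [Finset.sum_eq_single j (fun j' _ hj' => by simp [hj']) (by simp)]
  simpa using hji

/-- A weight vector outside of the hull of those of the features in `J` beats them in some
direction. Far along a generic such direction, a feature outside of `J` attains the maximum. -/
theorem HasGenericWeights.min_le_card (h : HasGenericWeights θ) (ha : 1 ≤ a)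
    (J : Finset (Fin K))
    (hJ : ∀ j x, (∀ j', j' ≠ j → featureValue (θ j') x < featureValue (θ j) x) → j ∈ J) :
    min K (a + 1) ≤ J.card := by
  by_contra! hlt
  obtain ⟨hK, hJa⟩ := lt_min_iff.1 hlt
  obtain ⟨i, hi⟩ : ∃ i, i ∉ J := by
    by_contra! hall
    rw [Finset.eq_univ_of_forall hall, Finset.card_fin] at hK
    exact lt_irrefl _ hK
  let M : (Fin K → ℝ) →ₗ[ℝ] (Fin a → ℝ) := Fintype.linearCombination ℝ fun j => (θ j).1
  have hM : ∀ c, M c = ∑ j, c j • (θ j).1 := fun c => Fintype.linearCombination_apply ..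
  obtain ⟨f, u, hfi, hfJ⟩ := geometric_hahn_banach_point_closed
    ((convex_simplexFace J).linear_image M)
    ((isCompact_simplexFace J).image M.continuous_of_finiteDimensional).isClosed
    (x := (θ i).1) (by
      rintro ⟨c, hc, hceq⟩
      exact h J (by omega) i hi c hc (by rw [← hM, hceq]))
  have hbeat : IsOpen {v : Fin a → ℝ |
      ∀ j ∈ J, featureGrad (θ j).1 v < featureGrad (θ i).1 v} := by
    simp only [Set.ofPred_forall]
    refine isOpen_iInter_of_finite fun j => isOpen_iInter_of_finite fun _ => isOpen_lt ?_ ?_ <;>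
      fun_prop
  have hne : {v : Fin a → ℝ |
      ∀ j ∈ J, featureGrad (θ j).1 v < featureGrad (θ i).1 v}.Nonempty := by
    refine ⟨fun t => -f (Pi.single t 1), fun j hj => ?_⟩
    have hf : ∀ w : Fin a → ℝ, featureGrad w (fun t => -f (Pi.single t 1)) = -f w := by
      intro w
      conv_rhs => rw [pi_eq_sum_univ' w]
      simp [featureGrad_apply, Finset.sum_neg_distrib]
    have hmem : (θ j).1 ∈ M '' simplexFace J := by
      classical
      refine ⟨Pi.single j 1, ⟨single_mem_stdSimplex ℝ j, fun j' hj' =>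
        Pi.single_eq_of_ne (by rintro rfl; exact hj' hj) _⟩, ?_⟩
      rw [hM, Finset.sum_eq_single j (fun j' _ hj' => by simp [hj']) (by simp)]
      simp
    rw [hf, hf]
    linarith [hfJ _ hmem]
  have hdense : Dense {v : Fin a → ℝ |
      ∀ j j', j ≠ j' → featureGrad (θ j).1 v ≠ featureGrad (θ j').1 v} := by
    refine Measure.dense_of_ae (μ := volume) ?_
    refine ae_all_iff.2 fun j => ae_all_iff.2 fun j' => ae_all_iff.2 fun hjj' => ?_
    refine measure_mono_null ?_ (Measure.addHaar_submodule volume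
      (LinearMap.ker (featureGrad (θ j).1 - featureGrad (θ j').1).toLinearMap) ?_)
    · intro v hv
      simpa [sub_eq_zero] using hv
    · intro htop
      refine hjj' (h.injective ha (featureGrad_injective (sub_eq_zero.1 ?_)))
      ext1 v
      exact LinearMap.mem_ker.1 (htop ▸ Submodule.mem_top :
        v ∈ LinearMap.ker (featureGrad (θ j).1 - featureGrad (θ j').1).toLinearMap)
  obtain ⟨v, hvJ, hv⟩ := hdense.inter_open_nonempty _ hbeat hne
  have : Nonempty (Fin K) := ⟨i⟩
  obtain ⟨j₀, hj₀⟩ := Finite.exists_max fun j => featureGrad (θ j).1 v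
  have hfar : ∀ᶠ s : ℝ in Filter.atTop, ∀ j, j ≠ j₀ →
      featureValue (θ j) (s • v) < featureValue (θ j₀) (s • v) := by
    refine Filter.eventually_all.2 fun j => ?_
    by_cases hj : j = j₀
    · exact Filter.Eventually.of_forall fun s hne => absurd hj hne
    have hpos : 0 < featureGrad (θ j₀).1 v - featureGrad (θ j).1 v :=
      sub_pos.2 (lt_of_le_of_ne (hj₀ j) (hv j j₀ hj))
    filter_upwards [(Filter.tendsto_id.atTop_mul_const hpos).eventually_gt_atTop
      ((θ j).2 - (θ j₀).2)] with s hs _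
    simp only [featureValue_eq, map_smul, smul_eq_mul]
    simp only [id] at hs
    linarith
  obtain ⟨s, hs⟩ := hfar.exists
  exact absurd (hvJ j₀ (hJ j₀ _ hs)) (not_lt.2 (hj₀ i))

theorem HasGenericWeights.min_le_numLinearRegionsOn {F : Type*} [NormedAddCommGroup F]
    [NormedSpace ℝ F] (h : HasGenericWeights θ) (ha : 1 ≤ a) {v : F} (hv : v ≠ 0) (c : F) :
    (min K (a + 1) : ℕ) ≤ numLinearRegionsOn (fun x => maxoutUnit θ x • v + c) Set.univ := by
  classical
  let J : Finset (Fin K) := {j | ∃ x, ∀ j', j' ≠ j → featureValue (θ j') x < featureValue (θ j) x}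
  have hJ : ∀ j ∈ J, ∃ x, ∀ j', j' ≠ j → featureValue (θ j') x < featureValue (θ j) x :=
    fun j hj => (Finset.mem_filter.1 hj).2
  choose! x hx using hJ
  have hcard := h.min_le_card ha J fun j x hx => Finset.mem_filter.2 ⟨Finset.mem_univ _, x, hx⟩
  refine le_trans (Nat.cast_le.2 hcard) (card_le_numLinearRegionsOn_univ J x
    (fun j => (featureGrad (θ j).1).smulRight v) ?_ fun j hj =>
      ((hasFDerivAt_maxoutUnit (hx j hj)).smul_const v).add_const c)
  intro j _ j' _ hjj'
  refine h.injective ha (featureGrad_injective ?_)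
  ext1 y
  exact smul_left_injective ℝ hv (congrArg (fun g : (Fin a → ℝ) →L[ℝ] F => g y) hjj')

end Unit

/-! ### Positive and zero measure in the parameter spaces -/

section Parameters

theorem hasPositiveMeasure_of_eventually {Θ : Type*} [TopologicalSpace Θ] [MeasureSpace Θ]
    [OpensMeasurableSpace Θ] [Measure.IsOpenPosMeasure (volume : Measure Θ)] {s : Set Θ} {θ₀ : Θ}
    (h : ∀ᶠ θ in nhds θ₀, θ ∈ s) : HasPositiveMeasure s := by
  obtain ⟨t, hts, ht, hθ₀⟩ := mem_nhds_iff.1 h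
  exact ⟨t, hts, ht.measurableSet, ht.measure_pos volume ⟨θ₀, hθ₀⟩⟩

theorem isOpenPosMeasure_volume_pi {ι : Type*} [Fintype ι] (X : ι → Type*)
    [∀ i, TopologicalSpace (X i)] [∀ i, MeasureSpace (X i)]
    [∀ i, SigmaFinite (volume : Measure (X i))]
    [∀ i, Measure.IsOpenPosMeasure (volume : Measure (X i))] :
    Measure.IsOpenPosMeasure (volume : Measure (∀ i, X i)) :=
  Measure.pi.isOpenPosMeasure fun i => (volume : Measure (X i))

/-- Instance search does not find this below the dependent product `HiddenParams`. -/
instance sigmaFinite_volume_unitParams (a K : ℕ) :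
    SigmaFinite (volume : Measure (UnitParams a K)) :=
  inferInstance

instance isOpenPosMeasure_volume_layerParams (a b K : ℕ) :
    (volume : Measure (LayerParams a b K)).IsOpenPosMeasure :=
  isOpenPosMeasure_volume_pi _

instance isOpenPosMeasure_volume_hiddenParams (n : ℕ → ℕ) (K L : ℕ) :
    (volume : Measure (HiddenParams n K L)).IsOpenPosMeasure :=
  isOpenPosMeasure_volume_pi _

theorem isOpenPosMeasure_volume_prod (α β : Type*) [TopologicalSpace α] [MeasureSpace α]
    [TopologicalSpace β] [MeasureSpace β] [SigmaFinite (volume : Measure β)]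
    [Measure.IsOpenPosMeasure (volume : Measure α)]
    [Measure.IsOpenPosMeasure (volume : Measure β)] :
    Measure.IsOpenPosMeasure (volume : Measure (α × β)) :=
  inferInstanceAs (Measure.IsOpenPosMeasure ((volume : Measure α).prod (volume : Measure β)))

instance isOpenPosMeasure_volume_outputParams (a m : ℕ) :
    (volume : Measure (OutputParams a m)).IsOpenPosMeasure :=
  (isAddHaarMeasure_volume_unitParams a m).toIsOpenPosMeasure

instance isOpenPosMeasure_volume_shallowNetwork (a b K m : ℕ) :
    (volume : Measure (LayerParams a b K × OutputParams b m)).IsOpenPosMeasure :=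
  isOpenPosMeasure_volume_prod _ _

instance isOpenPosMeasure_volume_deepNetwork (n : ℕ → ℕ) (K L m : ℕ) :
    (volume : Measure (HiddenParams n K L × OutputParams (n L) m)).IsOpenPosMeasure :=
  isOpenPosMeasure_volume_prod _ _

instance opensMeasurableSpace_shallowNetwork (a b K m : ℕ) :
    OpensMeasurableSpace (LayerParams a b K × OutputParams b m) :=
  Prod.opensMeasurableSpace

instance opensMeasurableSpace_deepNetwork (n : ℕ → ℕ) (K L m : ℕ) :
    OpensMeasurableSpace (HiddenParams n K L × OutputParams (n L) m) :=
  Prod.opensMeasurableSpace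

theorem volume_setOf_weight_eq_zero {a m : ℕ} (o : Fin m) (i : Fin a) :
    volume {ψ : OutputParams a m | (ψ o).1 i = 0} = 0 := by
  have : BorelSpace ((Fin a → ℝ) × ℝ) := Prod.borelSpace
  let ℓ : OutputParams a m →ₗ[ℝ] ℝ :=
    LinearMap.proj i ∘ₗ LinearMap.fst ℝ (Fin a → ℝ) ℝ ∘ₗ LinearMap.proj o
  refine Measure.addHaar_submodule (volume : Measure (UnitParams a m)) (LinearMap.ker ℓ) fun h => ?_
  have h1 : (fun _ => (1, 0)) ∈ LinearMap.ker ℓ := h ▸ Submodule.mem_top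
  exact one_ne_zero (α := ℝ) (LinearMap.mem_ker.1 h1)

end Parameters

/-! ### Numbers of linear regions of shallow and deep networks -/

section Networks

variable {d b K m : ℕ} {k : Fin b → ℕ}

theorem shallowCount_one (hd : 1 ≤ d) {k : ℕ} (hk : 1 ≤ k) :
    shallowCount d (fun _ : Fin 1 => k) = k := by
  obtain ⟨d, rfl⟩ := Nat.exists_eq_add_of_le hd
  have h2 : ∀ j, Finset.powersetCard (j + 1 + 1) (Finset.univ : Finset (Fin 1)) = ∅ :=
    fun j => Finset.powersetCard_eq_empty.2 (by simp)
  have h1 : Finset.powersetCard (0 + 1) (Finset.univ : Finset (Fin 1)) = {Finset.univ} := by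
    simpa using Finset.powersetCard_self (Finset.univ : Finset (Fin 1))
  rw [shallowCount, show 1 + d + 1 = d + 2 by ring, Finset.sum_range_succ', Finset.sum_range_succ',
    h1, Finset.sum_congr rfl fun j _ => by rw [h2, Finset.sum_empty]]
  simp only [Finset.sum_const_zero, Finset.sum_singleton, Finset.prod_const, Finset.card_fin,
    Finset.powersetCard_zero, Finset.card_empty, pow_one, pow_zero]
  omega

theorem nonempty_pattern (hk : ∀ i, 1 ≤ k i ∧ k i ≤ K) : Nonempty (Fin b → Fin K) :=
  ⟨fun i => ⟨0, (hk i).1.trans (hk i).2⟩⟩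

theorem mem_regionCountSet_maxoutLayer {N : ℕ} {θ : LayerParams d b K}
    (hne : Nonempty (Fin b → Fin K)) (h : HasGenericPatterns θ N) :
    θ ∈ regionCountSet (maxoutLayer (a := d) (b := b) (K := K)) Set.univ N := by
  have := h.numLinearRegionsOn hne (ContinuousLinearMap.id ℝ (Fin b → ℝ)) 0 fun i hi => by
    simpa using congrFun hi i
  simpa [regionCountSet] using this

theorem mem_regionCountSet_maxoutUnit {N : ℕ} {θ : UnitParams d K} (hK : 1 ≤ K)
    (h : HasGenericPatterns (b := 1) (κ := fun _ => Fin K) (fun _ => θ) N) :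
    θ ∈ regionCountSet (maxoutUnit (a := d) (K := K)) Set.univ N :=
  HasGenericPatterns.numLinearRegionsOn h ⟨fun _ => ⟨0, hK⟩⟩
    (ContinuousLinearMap.proj (R := ℝ) (φ := fun _ : Fin 1 => ℝ) 0) 0 (by
      intro i
      rw [Subsingleton.elim i 0]
      simp) |> fun h => by simpa [regionCountSet, maxoutLayer] using h

theorem mem_regionCountSet_shallowNetwork {N : ℕ} {θ : LayerParams d b K}
    {ψ : OutputParams b m} (hne : Nonempty (Fin b → Fin K)) (h : HasGenericPatterns θ N)
    (hψ : ∃ o, ∀ i, (ψ o).1 i ≠ 0) :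
    (θ, ψ) ∈ regionCountSet (shallowNetwork (a := d) (b := b) (K := K) (m := m)) Set.univ N := by
  obtain ⟨o, ho⟩ := hψ
  have := h.numLinearRegionsOn hne (outputGrad ψ) (fun o => (ψ o).2) fun i hi => by
    have h0 : featureGrad (ψ o).1 (Pi.single i 1) = 0 := congrFun hi o
    exact ho i (by simpa [featureGrad_apply, Pi.single_apply] using h0)
  simp only [regionCountSet, Set.mem_ofPred_eq, ← this]
  congr 1
  exact funext fun x => outputLayer_eq ψ _

theorem exists_mem_regionCountSet_shallowNetwork (hm : 1 ≤ m) (hd : 1 ≤ d)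
    (hk : ∀ i, 1 ≤ k i ∧ k i ≤ K) :
    (regionCountSet (shallowNetwork (a := d) (b := b) (K := K) (m := m)) Set.univ
      (shallowCount d k)).Nonempty := by
  obtain ⟨θ, hθ⟩ := exists_hasGenericPatterns hd hk
  exact ⟨(θ, fun _ => (fun _ => 1, 0)), mem_regionCountSet_shallowNetwork (nonempty_pattern hk) hθ
    ⟨⟨0, hm⟩, fun _ => one_ne_zero⟩⟩

theorem hasPositiveMeasure_shallowNetwork (hm : 1 ≤ m) (hd : 1 ≤ d)
    (hk : ∀ i, 1 ≤ k i ∧ k i ≤ K) (hmin : ∀ i, min K (d + 1) ≤ k i) :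
    HasPositiveMeasure (regionCountSet (shallowNetwork (a := d) (b := b) (K := K) (m := m)) Set.univ
      (shallowCount d k)) := by
  obtain ⟨θ₀, hθ₀⟩ := exists_eventually_hasGenericPatterns hd hk hmin
  let ψ₀ : OutputParams b m := fun _ => (fun _ => 1, 0)
  have hψ : ∀ᶠ ψ : OutputParams b m in nhds ψ₀, ∀ i, (ψ ⟨0, hm⟩).1 i ≠ 0 := by
    refine Filter.eventually_all.2 fun i => ?_
    refine (isOpen_ne_fun (by fun_prop) continuous_const).mem_nhds ?_
    exact one_ne_zero (α := ℝ)
  refine hasPositiveMeasure_of_eventually (θ₀ := (θ₀, ψ₀)) ?_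
  rw [nhds_prod_eq]
  filter_upwards [hθ₀.prod_mk hψ] with p hp
  exact mem_regionCountSet_shallowNetwork (nonempty_pattern hk) hp.1 ⟨_, hp.2⟩

theorem volume_regionCountSet_maxoutUnit {k : ℕ} (hd : 1 ≤ d) (hk : k < min K (d + 1)) :
    volume (regionCountSet (maxoutUnit (a := d) (K := K)) Set.univ k) = 0 := by
  refine measure_mono_null ?_ (volume_setOf_not_hasGenericWeights d K)
  intro θ hθ hgen
  have h := HasGenericWeights.min_le_numLinearRegionsOn hgen hd (one_ne_zero (α := ℝ)) 0
  simp only [smul_eq_mul, mul_one, add_zero] at h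
  have hθ' : numLinearRegionsOn (maxoutUnit θ) Set.univ = (k : ℕ∞) := hθ
  exact absurd (Nat.cast_le.1 (h.trans hθ'.le)) (not_le.2 hk)

theorem volume_regionCountSet_shallowNetwork {k : ℕ} (hm : 1 ≤ m) (hd : 1 ≤ d)
    (hk : k < min K (d + 1)) :
    volume (regionCountSet (shallowNetwork (a := d) (b := 1) (K := K) (m := m)) Set.univ k)
      = 0 := by
  have h1 : volume {p : LayerParams d 1 K × OutputParams 1 m | ¬ HasGenericWeights (p.1 0)} = 0 :=
    (Measure.quasiMeasurePreserving_fst (μ := (volume : Measure (LayerParams d 1 K)))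
      (ν := (volume : Measure (OutputParams 1 m)))).preimage_null
      (((Measure.quasiMeasurePreserving_eval
        (fun _ : Fin 1 => (volume : Measure (UnitParams d K))) 0)).preimage_null
          (volume_setOf_not_hasGenericWeights d K))
  have h2 : volume {p : LayerParams d 1 K × OutputParams 1 m | (p.2 ⟨0, hm⟩).1 0 = 0} = 0 :=
    (Measure.quasiMeasurePreserving_snd (μ := (volume : Measure (LayerParams d 1 K)))
      (ν := (volume : Measure (OutputParams 1 m)))).preimage_null
      (volume_setOf_weight_eq_zero ⟨0, hm⟩ 0)
  refine measure_mono_null (fun p hp => ?_) (measure_union_null h1 h2)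
  by_contra hcon
  simp only [Set.mem_union, Set.mem_ofPred_eq, not_or, not_not] at hcon
  have hf : shallowNetwork p =
      fun x => maxoutUnit (p.1 0) x • (fun o => (p.2 o).1 0) + fun o => (p.2 o).2 := by
    funext x o
    simp [shallowNetwork, outputLayer, maxoutLayer, mul_comm]
  have h := hcon.1.min_le_numLinearRegionsOn hd
    (v := fun o => (p.2 o).1 0) (fun h0 => hcon.2 (congrFun h0 ⟨0, hm⟩)) fun o => (p.2 o).2
  have hp' : numLinearRegionsOn (shallowNetwork p) Set.univ = (k : ℕ∞) := hp
  rw [← hf, hp'] at h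
  exact absurd (Nat.cast_le.1 h) (not_le.2 hk)

/-- The sum of the coordinate readouts of the zigzag network is a linear output whose gradients
have the coordinatewise slopes as entries, so it separates adjacent patterns. -/
theorem exists_deepNetwork {n : ℕ → ℕ} {L : ℕ} (hK : 1 ≤ K) (hm : 1 ≤ m) (q : Fin L → ℕ)
    (hq : ∀ l, 0 < q l) (heven : ∀ l, Even (q l)) (hn : ∀ l : Fin L, n 0 * q l = n (l + 1))
    (k : Fin L → Fin (n 0) → ℕ) (hk : ∀ l c, 1 ≤ k l c ∧ k l c ≤ K) :
    (regionCountSet (deepNetwork (n := n) (K := K) (L := L) (m := m)) Set.univ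
        (∏ l, ∏ c, pieceCount (q l) (k l c))).Nonempty ∧
      HasPositiveMeasure (regionCountSet (deepNetwork (n := n) (K := K) (L := L) (m := m))
        (openUnitCube (n 0)) (∏ l, ∏ c, pieceCount (q l) (k l c))) := by
  obtain ⟨θ, ρ, hA, hB, hC, hD⟩ := exists_zigzagNetwork (n := n) L q hq heven hn k hk
  let ψ : OutputParams (n L) m := fun _ => (fun i => ∑ c, ρ c i, 0)
  have hcenter : (fun _ => 1 / 2) ∈ openUnitCube (n 0) := fun _ _ => by norm_num
  have hfeas : ∀ J x, IsDeepWeaklyActive n K L θ J x →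
      ∃ y ∈ openUnitCube (n 0), IsDeepStrictlyActive n K L θ J y := fun J x hx => by
    obtain ⟨y, hy, hJ, _⟩ := hA J x hx _ hcenter
    exact ⟨y, hy, hJ⟩
  have hrow : ∀ J c, outputGrad ψ (deepGrad n K L θ J (Pi.single c 1)) ⟨0, hm⟩ =
      featureGrad (ρ c) (deepGrad n K L θ J (Pi.single c 1)) := by
    intro J c
    obtain ⟨σ, -, hσ⟩ := hC J
    have h1 : outputGrad ψ (deepGrad n K L θ J (Pi.single c 1)) ⟨0, hm⟩ =
        ∑ c', featureGrad (ρ c') (deepGrad n K L θ J (Pi.single c 1)) := by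
      change featureGrad (fun i => ∑ c, ρ c i) _ = _
      simp only [featureGrad_apply, Finset.sum_mul]
      exact Finset.sum_comm
    rw [h1, Finset.sum_eq_single c (fun c' _ hc' => by rw [hσ]; simp [hc']) (by simp)]
  have hgrad : ∀ J J', IsAdjacent n K L J J' →
      (∃ y ∈ openUnitCube (n 0), IsDeepStrictlyActive n K L θ J y) →
      (∃ y ∈ openUnitCube (n 0), IsDeepStrictlyActive n K L θ J' y) →
      outputGrad ψ ∘L deepGrad n K L θ J ≠ outputGrad ψ ∘L deepGrad n K L θ J' := by
    intro J J' hadj hJ hJ' heq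
    obtain ⟨c, hc⟩ := hD J J' hadj hJ hJ'
    refine hc ?_
    rw [← hrow, ← hrow]
    exact congrFun (congrArg (fun g : (Fin (n 0) → ℝ) →L[ℝ] Fin m → ℝ =>
      g (Pi.single c 1)) heq) ⟨0, hm⟩
  have hmono : ∀ J, (∃ y ∈ Set.univ, IsDeepStrictlyActive n K L θ J y) →
      ∃ y ∈ openUnitCube (n 0), IsDeepStrictlyActive n K L θ J y := by
    rintro J ⟨y, -, hy⟩
    exact hfeas J y hy.isDeepWeaklyActive
  constructor
  · refine ⟨(θ, ψ), ?_⟩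
    change numLinearRegionsOn (deepNetwork (θ, ψ)) Set.univ = _
    rw [numLinearRegionsOn_deepNetwork hK convex_univ, ← hB]
    · congr 2
      ext J
      refine ⟨hmono J, ?_⟩
      rintro ⟨y, -, hy⟩
      exact ⟨y, Set.mem_univ y, hy⟩
    · intro J x _ hx
      obtain ⟨y, -, hy⟩ := hfeas J x hx
      exact ⟨y, Set.mem_univ y, hy⟩
    · exact fun J J' hadj hJ hJ' => hgrad J J' hadj (hmono J hJ) (hmono J' hJ')
  · have hconv : Convex ℝ (openUnitCube (n 0)) := convex_pi fun _ _ => convex_Ioo 0 1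
    have hcomp : IsCompact (closure (openUnitCube (n 0))) :=
      (Bornology.IsBounded.pi fun _ => Metric.isBounded_Ioo 0 1).isCompact_closure
    refine hasPositiveMeasure_of_eventually (θ₀ := (θ, ψ)) ?_
    filter_upwards [eventually_numLinearRegionsOn_deepNetwork (p₀ := (θ, ψ)) hK hconv hcomp hfeas
      hgrad] with p hp
    rw [← hB]
    exact hp

end Networks

theorem theorem1 :
    -- a single maxout unit, by itself and as a network with a linear output layer
    (∀ n₀ K : ℕ, 1 ≤ n₀ → ∀ k : ℕ, 1 ≤ k → k ≤ K →
      ((regionCountSet (maxoutUnit (a := n₀) (K := K)) Set.univ k).Nonempty ∧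
        (min K (n₀ + 1) ≤ k →
          HasPositiveMeasure (regionCountSet (maxoutUnit (a := n₀) (K := K)) Set.univ k)) ∧
        (k < min K (n₀ + 1) →
          MeasureTheory.volume
            (regionCountSet (maxoutUnit (a := n₀) (K := K)) Set.univ k) = 0)) ∧
      (∀ m : ℕ, 1 ≤ m →
        (regionCountSet (shallowNetwork (a := n₀) (b := 1) (K := K) (m := m))
            Set.univ k).Nonempty ∧
        (min K (n₀ + 1) ≤ k →
          HasPositiveMeasure
            (regionCountSet (shallowNetwork (a := n₀) (b := 1) (K := K) (m := m))
              Set.univ k)) ∧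
        (k < min K (n₀ + 1) →
          MeasureTheory.volume
            (regionCountSet (shallowNetwork (a := n₀) (b := 1) (K := K) (m := m))
              Set.univ k) = 0))) ∧
    -- a single layer of maxout units, by itself and as a network with a linear output layer
    (∀ n₀ n₁ K : ℕ, 1 ≤ n₀ → ∀ k : Fin n₁ → ℕ, (∀ i, 1 ≤ k i ∧ k i ≤ K) →
      ((regionCountSet (maxoutLayer (a := n₀) (b := n₁) (K := K)) Set.univ
            (shallowCount n₀ k)).Nonempty ∧
        ((∀ i, min K (n₀ + 1) ≤ k i) →
          HasPositiveMeasure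
            (regionCountSet (maxoutLayer (a := n₀) (b := n₁) (K := K)) Set.univ
              (shallowCount n₀ k)))) ∧
      (∀ m : ℕ, 1 ≤ m →
        (regionCountSet (shallowNetwork (a := n₀) (b := n₁) (K := K) (m := m)) Set.univ
            (shallowCount n₀ k)).Nonempty ∧
        ((∀ i, min K (n₀ + 1) ≤ k i) →
          HasPositiveMeasure
            (regionCountSet (shallowNetwork (a := n₀) (b := n₁) (K := K) (m := m)) Set.univ
              (shallowCount n₀ k))))) ∧
    -- deep networks; `n 0` is the number of inputs and `n 1, …, n L` are the layer widths
    (∀ (L K m : ℕ) (n : ℕ → ℕ), 2 ≤ K → 1 ≤ m → 1 ≤ n 0 →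
      (∀ l : Fin L, 1 ≤ n (l + 1) ∧ n 0 ∣ n (l + 1) ∧ Even (n (l + 1) / n 0)) →
      ∀ k : Fin L → Fin (n 0) → ℕ, (∀ l i, 1 ≤ k l i ∧ k l i ≤ K) →
        (regionCountSet (deepNetwork (n := n) (K := K) (L := L) (m := m)) Set.univ
            (∏ l : Fin L, ∏ i, (n (l + 1) / n 0 * (k l i - 1) + 1))).Nonempty ∧
        HasPositiveMeasure
          (regionCountSet (deepNetwork (n := n) (K := K) (L := L) (m := m))
            (openUnitCube (n 0))
            (∏ l : Fin L, ∏ i, (n (l + 1) / n 0 * (k l i - 1) + 1)))) := by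
  refine ⟨fun n₀ K hd k hk hkK => ?_, fun n₀ n₁ K hd k hk => ?_, ?_⟩
  · have hk1 : ∀ _ : Fin 1, 1 ≤ k ∧ k ≤ K := fun _ => ⟨hk, hkK⟩
    have hcount := shallowCount_one hd hk
    refine ⟨⟨?_, fun hmin => ?_, volume_regionCountSet_maxoutUnit hd⟩,
      fun m hm => ⟨?_, fun hmin => ?_, volume_regionCountSet_shallowNetwork hm hd⟩⟩
    · obtain ⟨θ, hθ⟩ := exists_hasGenericPatterns hd hk1
      rw [hcount] at hθ
      exact ⟨θ 0, mem_regionCountSet_maxoutUnit (hk.trans hkK)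
        (by rwa [show (fun _ => θ 0) = θ from funext fun i => by rw [Subsingleton.elim i 0]])⟩
    · obtain ⟨θ₀, hθ₀⟩ := exists_eventually_hasGenericPatterns hd hk1 fun _ => hmin
      rw [hcount] at hθ₀
      have hcont : Continuous fun θ : UnitParams n₀ K => fun _ : Fin 1 => θ :=
        continuous_pi fun _ => continuous_id
      have h0 : (fun _ : Fin 1 => θ₀ 0) = θ₀ := funext fun i => by rw [Subsingleton.elim i 0]
      refine hasPositiveMeasure_of_eventually (θ₀ := θ₀ 0) ?_
      have htend := hcont.tendsto (θ₀ 0)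
      rw [h0] at htend
      filter_upwards [htend.eventually hθ₀] with θ hθ
      exact mem_regionCountSet_maxoutUnit (hk.trans hkK) hθ
    · rw [← hcount]
      exact exists_mem_regionCountSet_shallowNetwork hm hd hk1
    · rw [← hcount]
      exact hasPositiveMeasure_shallowNetwork hm hd hk1 fun _ => hmin
  · refine ⟨⟨?_, fun hmin => ?_⟩, fun m hm =>
      ⟨exists_mem_regionCountSet_shallowNetwork hm hd hk,
        hasPositiveMeasure_shallowNetwork hm hd hk⟩⟩
    · obtain ⟨θ, hθ⟩ := exists_hasGenericPatterns hd hk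
      exact ⟨θ, mem_regionCountSet_maxoutLayer (nonempty_pattern hk) hθ⟩
    · obtain ⟨θ₀, hθ₀⟩ := exists_eventually_hasGenericPatterns hd hk hmin
      exact hasPositiveMeasure_of_eventually
        (hθ₀.mono fun θ hθ => mem_regionCountSet_maxoutLayer (nonempty_pattern hk) hθ)
  · intro L K m n hK hm hn0 hn k hk
    exact exists_deepNetwork (by omega) hm (fun l : Fin L => n (l + 1) / n 0)
      (fun l => Nat.div_pos (Nat.le_of_dvd (hn l).1 (hn l).2.1) hn0) (fun l => (hn l).2.2)
      (fun l => Nat.mul_div_cancel' (hn l).2.1) k hk
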